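/- Let $\mathbb F_q$ denote the finite field with $q$ elements. For positive integers $k,m,r$, a $(k,m,r)$-periodic matrix over $\mathbb F_q$ is a $km\times kr$ matrix $M=(M_{i,j})_{i,j\in[k]}$ of maximal rank, with blocks $M_{i,j}\in\mathbb F_q^{m\times r}$, such that $M_{i,j}=0$ for $i<j$ and $M_{1,1}=M_{2,2}=\dots=M_{k,k}$. A $(k,m,r)$-periodic subspace of $\mathbb F_q^{km}$ is the image of such a matrix. A subspace $W\subseteq\mathbb F_q^{km}$ is $(k,m,r,s)$-periodic evasive if $\dim(V\cap W)\le s$ for every $(k,m,r)$-periodic subspace $V\subseteq\mathbb F_q^{km}$. An $(r,s)$-subspace design of cardinality $k$ in $\mathbb F_q^m\cong\mathbb F_{q^m}$ is a collection of $k$ $\mathbb F_q$-linear subspaces $H_1,\dots,H_k\subseteq\mathbb F_q^m$ such that $\sum_{i=1}^k\dim(\hat V\cap H_i)\le s$ for every $\mathbb F_q$-linear subspace $\hat V\subseteq\mathbb F_q^m$ of dimension at most $r$. **Corollary 2.6.** There exists an absolute constant $c>1$ such that for every real $\epsilon>0$, all positive integers $k,m,r$ with $r<\frac{\epsilon m}{4}$,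 and every prime power $q$ satisfying $$q^m\ \ge\ \max\left\{k^{c\cdot r/\epsilon},\ \left(\frac{2r}{\epsilon}\right)^{2r/\epsilon}\right\},$$ there exists a $(k,m,r,s)$-periodic evasive subspace $W\subseteq\mathbb F_q^{km}$ of co-dimension at most $\epsilon km$, for $s=\frac{2r^2}{\epsilon}$. Moreover, $W$ can be taken to be a product $W=H_1\times\dots\times H_k$, where $H_1,\dots,H_k\subseteq\mathbb F_q^m$ is an $(r,s)$-subspace design in which each $H_i$ has co-dimension at most $\epsilon m$, and a basis for $W$ can be found in time $\mathrm{poly}(q,k,m)$. Here the last claim means that there is a single deterministic algorithm, with a single polynomial time bound in $q,k,m$, for all parameters as above (on a unit-cost random access machine with addition, truncated subtraction and indirect addressing). Its input consists of the integers $q,k,m,r$, the integer parts $\lfloor\epsilon km\rfloor$ and $\lfloor s\rfloor$ of the two required bounds, and the addition and multiplication tables of $\mathbb F_q$, whose elements are numbered $0,\dots,q-1$ in an arbitrary way. Its output is a list of basis vectors of $W$ in this numbering; the subspace $W$ may depend on the input, including the numbering. -/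

import Mathlib

/-! ### A random access machine with a step count -/

namespace Ram

/-- The memory of the machine: registers and arrays, all holding natural numbers. -/
structure State where
  reg : ℕ → ℕ
  arr : ℕ → ℕ → ℕ

/-- Write `v` into register `x`. -/
def State.setReg (σ : State) (x v : ℕ) : State :=
  { σ with reg := Function.update σ.reg x v }

/-- Write `v` into cell `i` of the array `a`. -/
def State.setArr (σ : State) (a i v : ℕ) : State :=
  { σ with arr := Function.update σ.arr a (Function.update (σ.arr a) i v) }

/-- Programs. Registers and arrays are named by fixed numbers, so that a program uses finitely many
of them; array cells are addressed indirectly, through the content of a register. The only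
arithmetic instructions are addition and truncated subtraction, so that unit-cost time is
polynomially equivalent to time on a multitape Turing machine. -/
inductive Program where
  /-- do nothing -/
  | skip : Program
  /-- `x := c` -/
  | const (x c : ℕ) : Program
  /-- `x := y + z` -/
  | add (x y z : ℕ) : Program
  /-- `x := y - z` (zero if `y < z`) -/
  | sub (x y z : ℕ) : Program
  /-- `x := a[y]` -/
  | load (x a y : ℕ) : Program
  /-- `a[x] := y` -/
  | store (a x y : ℕ) : Program
  /-- first `P`, then `Q` -/
  | seq (P Q : Program) : Program
  /-- if `x ≠ 0` then `P` else `Q` -/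
  | ite (x : ℕ) (P Q : Program) : Program
  /-- as long as `x ≠ 0`, do `P` -/
  | loop (x : ℕ) (P : Program) : Program

/-- `Exec P σ τ t`: started in the state `σ`, the program `P` halts in the state `τ` after exactly
`t` steps. Every instruction and every test of a register costs one step. -/
inductive Exec : Program → State → State → ℕ → Prop where
  | skip (σ : State) : Exec .skip σ σ 1
  | const (x c : ℕ) (σ : State) : Exec (.const x c) σ (σ.setReg x c) 1
  | add (x y z : ℕ) (σ : State) : Exec (.add x y z) σ (σ.setReg x (σ.reg y + σ.reg z)) 1
  | sub (x y z : ℕ) (σ : State) : Exec (.sub x y z) σ (σ.setReg x (σ.reg y - σ.reg z)) 1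
  | load (x a y : ℕ) (σ : State) : Exec (.load x a y) σ (σ.setReg x (σ.arr a (σ.reg y))) 1
  | store (a x y : ℕ) (σ : State) : Exec (.store a x y) σ (σ.setArr a (σ.reg x) (σ.reg y)) 1
  | seq {P Q : Program} {σ τ ρ : State} {s t : ℕ} :
      Exec P σ τ s → Exec Q τ ρ t → Exec (.seq P Q) σ ρ (s + t)
  | ite_true {x : ℕ} {P Q : Program} {σ τ : State} {t : ℕ} :
      σ.reg x ≠ 0 → Exec P σ τ t → Exec (.ite x P Q) σ τ (t + 1)
  | ite_false {x : ℕ} {P Q : Program} {σ τ : State} {t : ℕ} :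
      σ.reg x = 0 → Exec Q σ τ t → Exec (.ite x P Q) σ τ (t + 1)
  | loop_done {x : ℕ} {P : Program} {σ : State} :
      σ.reg x = 0 → Exec (.loop x P) σ σ 1
  | loop_step {x : ℕ} {P : Program} {σ τ ρ : State} {s t : ℕ} :
      σ.reg x ≠ 0 → Exec P σ τ s → Exec (.loop x P) τ ρ t → Exec (.loop x P) σ ρ (s + t + 1)

end Ram

namespace PeriodicEvasive

/-! ### Periodic subspaces, evasive subspaces, subspace designs

The space `F_q^{km}` is `Fin k × Fin m → F`: the pair `(i, j)` is the `j`-th coordinate of the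
`i`-th block. -/

variable {F : Type*} [Field F] {k m r : ℕ}

/-- `(k, m, r)`-periodic matrices: block-lower-triangular `k × k`-block matrices with blocks of size
`m × r`, with identical blocks on the diagonal, of maximal rank. -/
structure IsPeriodicMatrix (M : Matrix (Fin k × Fin m) (Fin k × Fin r) F) : Prop where
  lower : ∀ i i' : Fin k, i < i' → ∀ (a : Fin m) (b : Fin r), M (i, a) (i', b) = 0
  diag : ∀ (i i' : Fin k) (a : Fin m) (b : Fin r), M (i, a) (i, b) = M (i', a) (i', b)
  rank_eq : M.rank = min (k * m) (k * r)

/-- `(k, m, r)`-periodic subspaces: images of `(k, m, r)`-periodic matrices. -/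
def IsPeriodicSubspace (r : ℕ) (V : Submodule F (Fin k × Fin m → F)) : Prop :=
  ∃ M : Matrix (Fin k × Fin m) (Fin k × Fin r) F,
    IsPeriodicMatrix M ∧ V = LinearMap.range M.mulVecLin

/-- `(k, m, r, s)`-periodic evasive subspaces. -/
def IsPeriodicEvasive (r : ℕ) (s : ℝ) (W : Submodule F (Fin k × Fin m → F)) : Prop :=
  ∀ V : Submodule F (Fin k × Fin m → F), IsPeriodicSubspace r V →
    (Module.finrank F ↥(V ⊓ W) : ℝ) ≤ s

/-- `(r, s)`-subspace designs of cardinality `k`, in the `m`-dimensional space `F_q^m`. -/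
def IsSubspaceDesign (r : ℕ) (s : ℝ) (H : Fin k → Submodule F (Fin m → F)) : Prop :=
  ∀ V : Submodule F (Fin m → F), Module.finrank F V ≤ r →
    ∑ i, (Module.finrank F ↥(V ⊓ H i) : ℝ) ≤ s

/-- The product `H_1 × ⋯ × H_k`: the vectors whose `i`-th block belongs to `H_i` for all `i`. -/
def blockProduct (H : Fin k → Submodule F (Fin m → F)) : Submodule F (Fin k × Fin m → F) :=
  ⨅ i, (H i).comap (LinearMap.funLeft F F fun j : Fin m => (i, j))

theorem mem_blockProduct (H : Fin k → Submodule F (Fin m → F)) (w : Fin k × Fin m → F) :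
    w ∈ blockProduct H ↔ ∀ i, (fun j => w (i, j)) ∈ H i := by
  simp only [blockProduct, Submodule.mem_iInf, Submodule.mem_comap]
  rfl

/-! ### Input and output of an algorithm over a finite field

The elements of the field are presented to the machine as the numbers `0, …, q - 1`, through an
arbitrary bijection `ν`; the arithmetic of the field is given by the tables of its operations. -/

/-- The table of a binary operation: the entry at `a * q + b` (where `a, b < q`) is the number of
the result of the operation on the elements with numbers `a` and `b`. -/
def opTable {q : ℕ} (ν : F ≃ Fin q) (op : F → F → F) (i : ℕ) : ℕ :=
  if h : i < q * q then
    ν (op (ν.symm (finProdFinEquiv.symm ⟨i, h⟩).1) (ν.symm (finProdFinEquiv.symm ⟨i, h⟩).2))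
  else 0

/-- The initial memory: the integers `q, k, m, r, D, S` in registers 0 to 5, the addition and
multiplication tables of the field in arrays 0 and 1, and zeros elsewhere. -/
def inputState {q : ℕ} (ν : F ≃ Fin q) (k m r D S : ℕ) : Ram.State where
  reg
    | 0 => q
    | 1 => k
    | 2 => m
    | 3 => r
    | 4 => D
    | 5 => S
    | _ => 0
  arr
    | 0 => opTable ν (· + ·)
    | 1 => opTable ν (· * ·)
    | _ => fun _ => 0

/-- The memory `τ` lists a basis of `W`: register 0 holds the number `n` of basis vectors, and
array 2 holds them one after the other, each as a list of `k * m` numbers of field elements. -/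
def ListsBasis {q : ℕ} (ν : F ≃ Fin q) (W : Submodule F (Fin k × Fin m → F))
    (τ : Ram.State) : Prop :=
  ∃ b : Module.Basis (Fin (τ.reg 0)) F W, ∀ (l : Fin (τ.reg 0)) (i : Fin k) (j : Fin m),
    τ.arr 2 (l * (k * m) + (i * m + j)) = (ν ((b l : Fin k × Fin m → F) (i, j)) : ℕ)

end PeriodicEvasive

/-!
The constant is `c = 24`. The algorithm distinguishes three cases. If `k r ≤ ⌊s⌋`, then every
periodic subspace has dimension at most `s`, and `W` may be the whole space. Otherwise, if
`ε k m ≥ k m`, then `W` may be zero. In the remaining case `ε < 1` and `2 r / ε < k`, and `W` is a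
product of members of a subspace design, obtained from multiples of products of linear factors, as
follows.

Let `e` be minimal with `q ^ e > k m`, and let `K = F[Y] / (p)` be the field with `q ^ e` elements,
where the class `γ` of `Y` generates the multiplicative group. The space `F ^ m` is identified with
a space of polynomials over `K` of degree at most `(m - 1) / e`, by means of the basis
`Y ^ u X ^ b`, where the coordinate has number `b e + u`. With `t = ⌊⌊ε m⌋ / e⌋`, the space `H i`
consists of the multiples of `∏ (X + γ ^ (i t + j))`, the product over `j < t`; its codimension is
`t e`. That `k t < q ^ e` makes all these factors distinct.

*Few spaces `H i` meet a space `V` of dimension `r` nontrivially.* The `K`-span of `V` has a basis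
of at most `r` polynomials `f a` with distinct degrees (`exists_injective_natDegree_span`). The
determinant of `f a (γ ^ b X)` is nonzero, since its top coefficient is a Vandermonde determinant
(`foldedWronskian_ne_zero`), and has degree at most `r (m - 1) / e`. A nonzero element of `V ⊓ H i`
forces it to vanish in `t + 1 - r` points that belong to `i`. Hence at most
`r ((m - 1) / e) / (t + 1 - r)` of the intersections are nonzero
(`card_inf_designMap_ne_bot_mul_le`). The lower bound for `q ^ m` gives `e ≤ ε m / (2 r)`
(`degree_le`), whence this number is at most `2 r / ε` (`card_le_of_mul_le`), and the sum of the
dimensions is at most `2 r ^ 2 / ε`.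

*From designs to periodic subspaces.* Let `V` be the image of a periodic matrix with diagonal block
`A`. Filter `V ⊓ ∏ H i` by the number of leading zero blocks; since `A` is injective, the graded
pieces embed into the spaces `range A ⊓ H i`
(`IsPeriodicMatrix.finrank_inf_blockProduct_le`).

*The algorithm.* Programs are written in a structured language `Ram.Cmd` whose loops have a number
of rounds that is fixed on entry, and are then compiled to the machine. Compiled programs are
correct, and their running time is bounded by a polynomial in a bound for the numbers of rounds
(`Ram.Cmd.exec_code`, `Ram.Cmd.exists_time_le`). The polynomial `p` is found by trying all
`q ^ e ≤ q k m` candidates, which is polynomial time; a candidate is accepted if `Y` is invertible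
modulo `p` and `Y ^ i ≠ 1` for `1 ≤ i < q ^ e - 1`, which already implies that `p` is irreducible
(`IsPrimitive.irreducible`). Multiplication by `Y` is a step of a shift register on each block of
`e` coordinates, so that the generators of the spaces `H i` are computed by table lookups only.
-/

/-! ### A structured language compiled to the random access machine -/

namespace Ram

@[simp] theorem State.setReg_reg (σ : State) (x v y : ℕ) :
    (σ.setReg x v).reg y = if y = x then v else σ.reg y := by
  simp [State.setReg, Function.update_apply]

@[simp] theorem State.setReg_arr (σ : State) (x v : ℕ) : (σ.setReg x v).arr = σ.arr := rfl

@[simp] theorem State.setArr_reg (σ : State) (a i v : ℕ) : (σ.setArr a i v).reg = σ.reg := rfl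

@[simp] theorem State.setArr_arr (σ : State) (a i v b : ℕ) :
    (σ.setArr a i v).arr b = if b = a then Function.update (σ.arr a) i v else σ.arr b := by
  simp [State.setArr, Function.update_apply]

/-- Expressions: constants, registers, sums, truncated differences and array cells. -/
inductive Expr where
  | lit (n : ℕ) : Expr
  | var (x : ℕ) : Expr
  | add (E E' : Expr) : Expr
  | sub (E E' : Expr) : Expr
  | get (a : ℕ) (E : Expr) : Expr

namespace Expr

/-- The value of an expression in a state. -/
@[simp] def eval (σ : State) : Expr → ℕ
  | lit n => n
  | var x => σ.reg x
  | add E E' => E.eval σ + E'.eval σ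
  | sub E E' => E.eval σ - E'.eval σ
  | get a E => σ.arr a (E.eval σ)

/-- All registers that are read have a number below `64`. Those from `64` on hold the intermediate
results of compiled programs. -/
def wf : Expr → Bool
  | lit _ => true
  | var x => decide (x < 64)
  | add E E' => E.wf && E'.wf
  | sub E E' => E.wf && E'.wf
  | get _ E => E.wf

/-- Machine code that leaves the value of the expression in register `d`, and changes no register
below `d`. -/
def code : Expr → ℕ → Program
  | lit n, d => .const d n
  | var x, d => .seq (.const d 0) (.add d x d)
  | add E E', d => .seq (E.code d) (.seq (E'.code (d + 1)) (.add d d (d + 1)))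
  | sub E E', d => .seq (E.code d) (.seq (E'.code (d + 1)) (.sub d d (d + 1)))
  | get a E, d => .seq (E.code d) (.load d a d)

/-- The number of steps taken by `Expr.code`. -/
def cost : Expr → ℕ
  | lit _ => 1
  | var _ => 2
  | add E E' => E.cost + (E'.cost + 1)
  | sub E E' => E.cost + (E'.cost + 1)
  | get _ E => E.cost + 1

theorem eval_congr {σ τ : State} (E : Expr) (hE : E.wf) (h : ∀ x < 64, τ.reg x = σ.reg x)
    (ha : τ.arr = σ.arr) : E.eval τ = E.eval σ := by
  induction E with
  | lit n => rfl
  | var x => exact h x (by simpa [wf] using hE)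
  | add E E' h1 h2 =>
    simp only [wf, Bool.and_eq_true] at hE
    simp [h1 hE.1, h2 hE.2]
  | sub E E' h1 h2 =>
    simp only [wf, Bool.and_eq_true] at hE
    simp [h1 hE.1, h2 hE.2]
  | get a E h1 => simp [h1 hE, ha]

/-- The code of an expression computes its value, in exactly `E.cost` steps. -/
theorem exec_code (E : Expr) (hE : E.wf) (d : ℕ) (hd : 64 ≤ d) (σ : State) :
    ∃ τ, Exec (E.code d) σ τ E.cost ∧ τ.reg d = E.eval σ ∧ (∀ x < d, τ.reg x = σ.reg x) ∧
      τ.arr = σ.arr := by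
  induction E generalizing d σ with
  | lit n => exact ⟨_, .const d n σ, by simp, fun x hx => by simp [hx.ne], rfl⟩
  | var x =>
    have hx : x < 64 := by simpa [wf] using hE
    refine ⟨_, .seq (.const d 0 σ) (.add d x d _), ?_, ?_, rfl⟩
    · simp [show x ≠ d by omega]
    · intro y hy
      simp [hy.ne]
  | add E E' h1 h2 =>
    simp only [wf, Bool.and_eq_true] at hE
    obtain ⟨τ, e1, v1, r1, a1⟩ := h1 hE.1 d hd σ
    obtain ⟨ρ, e2, v2, r2, a2⟩ := h2 hE.2 (d + 1) (by omega) τ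
    refine ⟨_, .seq e1 (.seq e2 (.add d d (d + 1) ρ)), ?_, ?_, ?_⟩
    · simp [v2, r2 d (by omega), v1,
        E'.eval_congr hE.2 (fun x hx => r1 x (by omega)) a1]
    · intro x hx
      simp [hx.ne, r2 x (by omega), r1 x hx]
    · simp [a2, a1]
  | sub E E' h1 h2 =>
    simp only [wf, Bool.and_eq_true] at hE
    obtain ⟨τ, e1, v1, r1, a1⟩ := h1 hE.1 d hd σ
    obtain ⟨ρ, e2, v2, r2, a2⟩ := h2 hE.2 (d + 1) (by omega) τ
    refine ⟨_, .seq e1 (.seq e2 (.sub d d (d + 1) ρ)), ?_, ?_, ?_⟩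
    · simp [v2, r2 d (by omega), v1,
        E'.eval_congr hE.2 (fun x hx => r1 x (by omega)) a1]
    · intro x hx
      simp [hx.ne, r2 x (by omega), r1 x hx]
    · simp [a2, a1]
  | get a E h1 =>
    obtain ⟨τ, e1, v1, r1, a1⟩ := h1 hE d hd σ
    refine ⟨_, .seq e1 (.load d a d τ), ?_, ?_, ?_⟩
    · simp [v1, a1]
    · intro x hx
      simp [hx.ne, r1 x hx]
    · simp [a1]

end Expr

/-- Structured commands: `put a I E` stores the value of `E` in cell `I` of the array `a`, and
`rep x n P` runs `P` for `x = 0, …, N - 1`, where `N` is the content of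
register `n`. -/
inductive Cmd where
  | skip : Cmd
  | set (x : ℕ) (E : Expr) : Cmd
  | put (a : ℕ) (I E : Expr) : Cmd
  | seq (P P' : Cmd) : Cmd
  | ite (E : Expr) (P P' : Cmd) : Cmd
  | rep (x n : ℕ) (P : Cmd) : Cmd

namespace Cmd

/-- The effect of a command on a state. -/
def eval : Cmd → State → State
  | skip, σ => σ
  | set x E, σ => σ.setReg x (E.eval σ)
  | put a I E, σ => σ.setArr a (I.eval σ) (E.eval σ)
  | seq P P', σ => P'.eval (P.eval σ)
  | ite E P P', σ => if E.eval σ ≠ 0 then P.eval σ else P'.eval σ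
  | rep x n P, σ =>
    (fun τ => (P.eval τ).setReg x (τ.reg x + 1))^[σ.reg n] (σ.setReg x 0)

@[simp] theorem eval_skip (σ : State) : skip.eval σ = σ := rfl
@[simp] theorem eval_set (x : ℕ) (E : Expr) (σ : State) :
    (set x E).eval σ = σ.setReg x (E.eval σ) := rfl
@[simp] theorem eval_put (a : ℕ) (I E : Expr) (σ : State) :
    (put a I E).eval σ = σ.setArr a (I.eval σ) (E.eval σ) := rfl
@[simp] theorem eval_seq (P P' : Cmd) (σ : State) : (seq P P').eval σ = P'.eval (P.eval σ) := rfl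
@[simp] theorem eval_ite (E : Expr) (P P' : Cmd) (σ : State) :
    (ite E P P').eval σ = if E.eval σ ≠ 0 then P.eval σ else P'.eval σ := rfl

/-- The registers that a command may change. -/
def writes : Cmd → List ℕ
  | skip => []
  | set x _ => [x]
  | put _ _ _ => []
  | seq P P' => P.writes ++ P'.writes
  | ite _ P P' => P.writes ++ P'.writes
  | rep x _ P => x :: P.writes

/-- The arrays that a command may change. -/
def arrWrites : Cmd → List ℕ
  | skip => []
  | set _ _ => []
  | put a _ _ => [a]
  | seq P P' => P.arrWrites ++ P'.arrWrites
  | ite _ P P' => P.arrWrites ++ P'.arrWrites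
  | rep _ _ P => P.arrWrites

theorem eval_reg (P : Cmd) {y : ℕ} (hy : y ∉ P.writes) (σ : State) :
    (P.eval σ).reg y = σ.reg y := by
  induction P generalizing σ with
  | skip => rfl
  | set x E =>
    simp only [writes, List.mem_singleton] at hy
    simp [hy]
  | put a I E => rfl
  | seq P P' h1 h2 =>
    simp only [writes, List.mem_append, not_or] at hy
    simp [h1 hy.1, h2 hy.2]
  | ite E P P' h1 h2 =>
    simp only [writes, List.mem_append, not_or] at hy
    simp only [eval_ite]
    split_ifs
    exacts [h1 hy.1 σ, h2 hy.2 σ]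
  | rep x n P h =>
    simp only [writes, List.mem_cons, not_or] at hy
    simp only [eval]
    refine Function.Iterate.rec (fun τ : State => τ.reg y = σ.reg y) ?_ ?_ _
    · simp [hy.1]
    · intro τ hτ
      simp [hy.1, h hy.2, hτ]

theorem eval_arr (P : Cmd) {a : ℕ} (ha : a ∉ P.arrWrites) (σ : State) :
    (P.eval σ).arr a = σ.arr a := by
  induction P generalizing σ with
  | skip => rfl
  | set x E => rfl
  | put b I E =>
    simp only [arrWrites, List.mem_singleton] at ha
    simp [ha]
  | seq P P' h1 h2 =>
    simp only [arrWrites, List.mem_append, not_or] at ha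
    simp [h1 ha.1, h2 ha.2]
  | ite E P P' h1 h2 =>
    simp only [arrWrites, List.mem_append, not_or] at ha
    simp only [eval_ite]
    split_ifs
    exacts [h1 ha.1 σ, h2 ha.2 σ]
  | rep x n P h =>
    simp only [eval]
    refine Function.Iterate.rec (fun τ : State => τ.arr a = σ.arr a) ?_ ?_ _
    · simp
    · intro τ hτ
      simp [h ha, hτ]

/-- The invariant rule for `rep`. Everything that the loop does not write keeps its initial value
in every iteration. -/
theorem eval_rep_induction {x n : ℕ} {P : Cmd} {σ : State} (I : ℕ → State → Prop)
    (h0 : I 0 (σ.setReg x 0))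
    (hstep : ∀ i < σ.reg n, ∀ τ : State, τ.reg x = i →
      (∀ y, y ∉ (rep x n P).writes → τ.reg y = σ.reg y) →
      (∀ a, a ∉ P.arrWrites → τ.arr a = σ.arr a) →
      I i τ → I (i + 1) ((P.eval τ).setReg x (i + 1))) :
    I (σ.reg n) ((rep x n P).eval σ) := by
  have key : ∀ i ≤ σ.reg n, ∀ τ : State,
      τ = (fun τ => (P.eval τ).setReg x (τ.reg x + 1))^[i] (σ.setReg x 0) →
      τ.reg x = i ∧ (∀ y, y ∉ (rep x n P).writes → τ.reg y = σ.reg y) ∧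
        (∀ a, a ∉ P.arrWrites → τ.arr a = σ.arr a) ∧ I i τ := by
    intro i
    induction i with
    | zero =>
      rintro - τ rfl
      refine ⟨by simp, fun y hy => ?_, fun a _ => by simp, by simpa using h0⟩
      simp only [writes, List.mem_cons, not_or] at hy
      simp [hy.1]
    | succ i ih =>
      rintro hi τ rfl
      obtain ⟨h1, h2, h3, h4⟩ := ih (by omega) _ rfl
      rw [Function.iterate_succ_apply']
      set τ' := (fun τ => (P.eval τ).setReg x (τ.reg x + 1))^[i] (σ.setReg x 0) with hτ'
      refine ⟨by simp [h1], fun y hy => ?_, fun a ha => ?_, ?_⟩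
      · have hy' := hy
        simp only [writes, List.mem_cons, not_or] at hy'
        simp [hy'.1, eval_reg P hy'.2, h2 y hy]
      · simp [eval_arr P ha, h3 a ha]
      · rw [h1]
        exact hstep i (by omega) τ' h1 h2 h3 h4
  exact (key _ le_rfl _ rfl).2.2.2

/-- A command is well formed relative to a list `B` of registers if it never writes to a register in
`B`, the number of rounds of every loop is the content of a register in `B`, and no loop body
writes to the counter of its loop. -/
def wf (B : List ℕ) : Cmd → Bool
  | skip => true
  | set x E => decide (x < 64) && decide (x ∉ B) && E.wf
  | put _ I E => I.wf && E.wf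
  | seq P P' => P.wf B && P'.wf B
  | ite E P P' => E.wf && P.wf B && P'.wf B
  | rep x n P => decide (x < 64) && decide (n < 64) && decide (x ∉ B) && decide (n ∈ B) &&
      decide (x ∉ P.writes) && P.wf B

theorem wf.notMem_writes {B : List ℕ} {P : Cmd} (h : P.wf B) {n : ℕ} (hn : n ∈ B) :
    n ∉ P.writes := by
  induction P with
  | skip => simp [writes]
  | set x E =>
    simp only [wf, Bool.and_eq_true, decide_eq_true_eq] at h
    simp only [writes, List.mem_singleton]
    rintro rfl
    exact h.1.2 hn
  | put a I E => simp [writes]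
  | seq P P' h1 h2 =>
    simp only [wf, Bool.and_eq_true] at h
    simp [writes, h1 h.1, h2 h.2]
  | ite E P P' h1 h2 =>
    simp only [wf, Bool.and_eq_true] at h
    simp [writes, h1 h.1.2, h2 h.2]
  | rep x m P h1 =>
    simp only [wf, Bool.and_eq_true, decide_eq_true_eq] at h
    simp only [writes, List.mem_cons, not_or]
    refine ⟨?_, h1 h.2⟩
    rintro rfl
    exact h.1.1.1.2 hn

/-- The machine program of a command. -/
def code : Cmd → Program
  | skip => .skip
  | set x E => .seq (E.code 64) (.seq (.const x 0) (.add x 64 x))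
  | put a I E => .seq (I.code 64) (.seq (E.code 65) (.store a 64 65))
  | seq P P' => .seq P.code P'.code
  | ite E P P' => .seq (E.code 64) (.ite 64 P.code P'.code)
  | rep x n P => .seq (.const x 0) (.seq (.sub 64 n x)
      (.loop 64 (.seq P.code (.seq (.const 64 1) (.seq (.add x x 64) (.sub 64 n x))))))

/-- A bound for the running time of a command all of whose loops have at most `b` rounds. -/
def time (b : ℕ) : Cmd → ℕ
  | skip => 1
  | set _ E => E.cost + (1 + 1)
  | put _ I E => I.cost + (E.cost + 1)
  | seq P P' => P.time b + P'.time b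
  | ite E P P' => E.cost + (P.time b + P'.time b + 1)
  | rep _ _ P => 1 + (1 + (b * (P.time b + 4) + 1))

/-- The running time is polynomial in the bound for the numbers of rounds of the loops. -/
theorem exists_time_le (P : Cmd) : ∃ C : ℕ, ∀ b, P.time b ≤ C * (b + 1) ^ C := by
  induction P with
  | skip => exact ⟨1, fun b => by simp [time]⟩
  | set x E =>
    refine ⟨E.cost + 2, fun b => ?_⟩
    exact Nat.le_mul_of_pos_right _ (by positivity)
  | put a I E =>
    refine ⟨I.cost + (E.cost + 1), fun b => ?_⟩
    exact Nat.le_mul_of_pos_right _ (by positivity)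
  | seq P P' h1 h2 =>
    obtain ⟨C, hC⟩ := h1
    obtain ⟨C', hC'⟩ := h2
    refine ⟨C + C', fun b => ?_⟩
    have e1 : (b + 1) ^ C ≤ (b + 1) ^ (C + C') := Nat.pow_le_pow_right (by omega) (by omega)
    have e2 : (b + 1) ^ C' ≤ (b + 1) ^ (C + C') := Nat.pow_le_pow_right (by omega) (by omega)
    calc P.time b + P'.time b ≤ C * (b + 1) ^ C + C' * (b + 1) ^ C' := add_le_add (hC b) (hC' b)
      _ ≤ C * (b + 1) ^ (C + C') + C' * (b + 1) ^ (C + C') := by gcongr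
      _ = _ := by ring
  | ite E P P' h1 h2 =>
    obtain ⟨C, hC⟩ := h1
    obtain ⟨C', hC'⟩ := h2
    refine ⟨E.cost + 1 + (C + C'), fun b => ?_⟩
    set X := (b + 1) ^ (E.cost + 1 + (C + C')) with hX
    have e0 : 1 ≤ X := Nat.one_le_pow _ _ (by omega)
    have e1 : (b + 1) ^ C ≤ X := Nat.pow_le_pow_right (by omega) (by omega)
    have e2 : (b + 1) ^ C' ≤ X := Nat.pow_le_pow_right (by omega) (by omega)
    calc E.cost + (P.time b + P'.time b + 1)
        ≤ E.cost + (C * (b + 1) ^ C + C' * (b + 1) ^ C' + 1) := by gcongr; exacts [hC b, hC' b]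
      _ ≤ (E.cost + 1) * 1 + (C * X + C' * X) := by
        have := Nat.mul_le_mul_left C e1
        have := Nat.mul_le_mul_left C' e2
        omega
      _ ≤ (E.cost + 1) * X + (C * X + C' * X) := by gcongr
      _ = _ := by ring
  | rep x n P h =>
    obtain ⟨C, hC⟩ := h
    refine ⟨C + 7, fun b => ?_⟩
    have e0 : 1 ≤ (b + 1) ^ (C + 1) := Nat.one_le_pow _ _ (by omega)
    have e1 : (b + 1) ^ (C + 1) ≤ (b + 1) ^ (C + 7) := Nat.pow_le_pow_right (by omega) (by omega)
    have e2 : b ≤ (b + 1) ^ (C + 1) :=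
      (Nat.le_succ b).trans (Nat.le_self_pow (by omega) (b + 1))
    have e3 : b * (C * (b + 1) ^ C) ≤ C * (b + 1) ^ (C + 1) := by
      rw [pow_succ]
      calc b * (C * (b + 1) ^ C) ≤ (b + 1) * (C * (b + 1) ^ C) := by gcongr; omega
        _ = _ := by ring
    calc 1 + (1 + (b * (P.time b + 4) + 1))
        ≤ 1 + (1 + (b * (C * (b + 1) ^ C + 4) + 1)) := by gcongr; exact hC b
      _ = 3 * 1 + b * (C * (b + 1) ^ C) + 4 * b := by ring
      _ ≤ 3 * (b + 1) ^ (C + 1) + C * (b + 1) ^ (C + 1) + 4 * (b + 1) ^ (C + 1) := by gcongr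
      _ = (C + 7) * (b + 1) ^ (C + 1) := by ring
      _ ≤ _ := by gcongr

/-- Compiled commands run correctly, up to the registers from `64` on, and within the static time
bound. -/
theorem exec_code {B : List ℕ} {b : ℕ} (P : Cmd) (hP : P.wf B) (σ σ' : State)
    (hreg : ∀ x < 64, σ'.reg x = σ.reg x) (harr : σ'.arr = σ.arr) (hb : ∀ n ∈ B, σ.reg n ≤ b) :
    ∃ τ' t, Exec P.code σ' τ' t ∧ t ≤ P.time b ∧ (∀ x < 64, τ'.reg x = (P.eval σ).reg x) ∧
      τ'.arr = (P.eval σ).arr := by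
  induction P generalizing σ σ' with
  | skip => exact ⟨σ', 1, .skip σ', le_rfl, hreg, harr⟩
  | set x E =>
    simp only [wf, Bool.and_eq_true, decide_eq_true_eq] at hP
    obtain ⟨τ, e1, v1, r1, a1⟩ := E.exec_code hP.2 64 le_rfl σ'
    refine ⟨_, _, .seq e1 (.seq (.const x 0 _) (.add x 64 x _)), le_rfl, ?_, ?_⟩
    · intro y hy
      by_cases hyx : y = x
      · simp [hyx, v1, show 64 ≠ x by omega, E.eval_congr hP.2 hreg harr]
      · simp [hyx, r1 y hy, hreg y hy]
    · simp [a1, harr]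
  | put a I E =>
    simp only [wf, Bool.and_eq_true] at hP
    obtain ⟨τ, e1, v1, r1, a1⟩ := I.exec_code hP.1 64 le_rfl σ'
    obtain ⟨ρ, e2, v2, r2, a2⟩ := E.exec_code hP.2 65 (by omega) τ
    refine ⟨_, _, .seq e1 (.seq e2 (.store a 64 65 ρ)), le_rfl, ?_, ?_⟩
    · intro y hy
      simp [r2 y (by omega), r1 y hy, hreg y hy]
    · funext c
      have h1 : ρ.reg 64 = I.eval σ := by
        rw [r2 64 (by omega), v1, I.eval_congr hP.1 hreg harr]
      have h2 : ρ.reg 65 = E.eval σ := by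
        rw [v2, E.eval_congr hP.2 (fun x hx => (r1 x hx).trans (hreg x hx)) (a1.trans harr)]
      simp [h1, h2, a2, a1, harr]
  | seq P P' h1 h2 =>
    simp only [wf, Bool.and_eq_true] at hP
    obtain ⟨τ, s, e1, t1, r1, a1⟩ := h1 hP.1 σ σ' hreg harr hb
    obtain ⟨ρ, t, e2, t2, r2, a2⟩ := h2 hP.2 (P.eval σ) τ r1 a1 fun n hn => by
      rw [eval_reg P (wf.notMem_writes hP.1 hn)]
      exact hb n hn
    exact ⟨ρ, s + t, .seq e1 e2, add_le_add t1 t2, r2, a2⟩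
  | ite E P P' h1 h2 =>
    simp only [wf, Bool.and_eq_true] at hP
    obtain ⟨τ, e1, v1, r1, a1⟩ := E.exec_code hP.1.1 64 le_rfl σ'
    have hr : ∀ x < 64, τ.reg x = σ.reg x := fun x hx => (r1 x hx).trans (hreg x hx)
    have ha : τ.arr = σ.arr := a1.trans harr
    have hv : τ.reg 64 = E.eval σ := v1.trans (E.eval_congr hP.1.1 hreg harr)
    by_cases hE : E.eval σ = 0
    · obtain ⟨ρ, t, e2, t2, r2, a2⟩ := h2 hP.2 σ τ hr ha hb
      refine ⟨ρ, _, .seq e1 (.ite_false (hv.trans hE) e2), ?_, ?_, ?_⟩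
      · simp only [time]
        omega
      · simpa [hE] using r2
      · simpa [hE] using a2
    · obtain ⟨ρ, t, e2, t2, r2, a2⟩ := h1 hP.1.2 σ τ hr ha hb
      refine ⟨ρ, _, .seq e1 (.ite_true (by rwa [hv]) e2), ?_, ?_, ?_⟩
      · simp only [time]
        omega
      · simpa [hE] using r2
      · simpa [hE] using a2
  | rep x n P h =>
    simp only [wf, Bool.and_eq_true, decide_eq_true_eq] at hP
    obtain ⟨⟨⟨⟨⟨hx, hn⟩, hxB⟩, hnB⟩, hxP⟩, hwf⟩ := hP
    have hnP : n ∉ P.writes := wf.notMem_writes hwf hnB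
    have hnx : n ≠ x := fun h => hxB (h ▸ hnB)
    set N := σ.reg n with hN
    -- `j` rounds are left
    have key : ∀ j ≤ N, ∀ ρ ρ' : State, ρ.reg x = N - j → (∀ n ∈ B, ρ.reg n = σ.reg n) →
        (∀ y < 64, ρ'.reg y = ρ.reg y) → ρ'.arr = ρ.arr → ρ'.reg 64 = j →
        ∃ τ' t, Exec (.loop 64 (.seq P.code (.seq (.const 64 1) (.seq (.add x x 64)
            (.sub 64 n x))))) ρ' τ' t ∧ t ≤ j * (P.time b + 4) + 1 ∧
          (∀ y < 64, τ'.reg y =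
            ((fun τ => (P.eval τ).setReg x (τ.reg x + 1))^[j] ρ).reg y) ∧
          τ'.arr = ((fun τ => (P.eval τ).setReg x (τ.reg x + 1))^[j] ρ).arr := by
      intro j
      induction j with
      | zero =>
        intro _ ρ ρ' _ _ h3 h4 h5
        exact ⟨ρ', 1, .loop_done h5, by omega, h3, h4⟩
      | succ j ih =>
        intro hj ρ ρ' h1 h2 h3 h4 h5
        obtain ⟨τ, s, e1, t1, r1, a1⟩ := h hwf ρ ρ' h3 h4 fun n hn => by
          rw [h2 n hn]
          exact hb n hn
        have hτx : τ.reg x = N - (j + 1) := by rw [r1 x hx, eval_reg P hxP, h1]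
        have hτn : τ.reg n = N := by rw [r1 n hn, eval_reg P hnP, h2 n hnB]
        obtain ⟨τ', t, e2, t2, r2, a2⟩ := ih (by omega)
          ((P.eval ρ).setReg x (ρ.reg x + 1))
          (((τ.setReg 64 1).setReg x (τ.reg x + 1)).setReg 64 j)
          (by simp [h1]; omega)
          (fun n' hn' => by
            rw [State.setReg_reg, if_neg (ne_of_mem_of_not_mem hn' hxB),
              eval_reg P (wf.notMem_writes hwf hn'), h2 n' hn'])
          (fun y hy => by
            by_cases hyx : y = x
            · simp [hyx, show x ≠ 64 by omega, hτx, h1]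
            · simp [hyx, show y ≠ 64 by omega, r1 y hy])
          (by simp [a1]) (by simp)
        have e3 : Exec (.seq P.code (.seq (.const 64 1) (.seq (.add x x 64) (.sub 64 n x)))) ρ'
            (((τ.setReg 64 1).setReg x (τ.reg x + 1)).setReg 64 j) (s + (1 + (1 + 1))) := by
          refine .seq e1 (.seq (.const 64 1 τ) (.seq (.add x x 64 _) ?_))
          have := Exec.sub 64 n x (((τ.setReg 64 1).setReg x
            ((τ.setReg 64 1).reg x + (τ.setReg 64 1).reg 64)))
          have h6 : (τ.setReg 64 1).reg x + (τ.setReg 64 1).reg 64 = τ.reg x + 1 := by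
            simp [show x ≠ 64 by omega]
          rw [h6] at this ⊢
          have h7 : ((τ.setReg 64 1).setReg x (τ.reg x + 1)).reg n -
              ((τ.setReg 64 1).setReg x (τ.reg x + 1)).reg x = j := by
            simp [hnx, show n ≠ 64 by omega, hτn, hτx]
            omega
          rwa [h7] at this
        refine ⟨τ', _, .loop_step (by omega) e3 e2, ?_, ?_, ?_⟩
        · have : (j + 1) * (P.time b + 4) = j * (P.time b + 4) + P.time b + 4 := by ring
          omega
        · intro y hy
          rw [Function.iterate_succ_apply]
          exact r2 y hy
        · rw [Function.iterate_succ_apply]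
          exact a2
    obtain ⟨τ', t, e1, t1, r1, a1⟩ := key N le_rfl (σ.setReg x 0)
      ((σ'.setReg x 0).setReg 64 N) (by simp)
      (fun n' hn' => by
        rw [State.setReg_reg, if_neg (ne_of_mem_of_not_mem hn' hxB)])
      (fun y hy => by
        by_cases hyx : y = x
        · simp [hyx, show x ≠ 64 by omega]
        · simp [hyx, show y ≠ 64 by omega, hreg y hy])
      (by simp [harr]) (by simp)
    have h0 : (σ'.setReg x 0).reg n - (σ'.setReg x 0).reg x = N := by simp [hnx, hreg n hn, hN]
    refine ⟨τ', _, .seq (.const x 0 σ') (.seq (.sub 64 n x _) (by rw [h0]; exact e1)), ?_, r1, a1⟩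
    have : N * (P.time b + 4) ≤ b * (P.time b + 4) := Nat.mul_le_mul_right _ (hb n hnB)
    simp only [time]
    omega

/-- Started in a state that agrees with `σ`, the code of `P` does what `P` does, within the time
`P.time b`. -/
def Runs (b : ℕ) (P : Cmd) (σ : State) : Prop :=
  ∀ σ' : State, (∀ x < 64, σ'.reg x = σ.reg x) → σ'.arr = σ.arr →
    ∃ τ t, Exec P.code σ' τ t ∧ t ≤ P.time b ∧ (∀ x < 64, τ.reg x = (P.eval σ).reg x) ∧
      τ.arr = (P.eval σ).arr

theorem runs_of_wf {B : List ℕ} {b : ℕ} {P : Cmd} {σ : State} (hP : P.wf B)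
    (hb : ∀ n ∈ B, σ.reg n ≤ b) : P.Runs b σ :=
  fun σ' hreg harr => P.exec_code hP σ σ' hreg harr hb

theorem Runs.seq {b : ℕ} {P P' : Cmd} {σ τ : State} (h : P.Runs b σ)
    (hτ : τ = P.eval σ) (h' : P'.Runs b τ) : (Cmd.seq P P').Runs b σ := by
  subst hτ
  intro σ' hreg harr
  obtain ⟨τ, s, e1, t1, r1, a1⟩ := h σ' hreg harr
  obtain ⟨ρ, t, e2, t2, r2, a2⟩ := h' τ r1 a1
  exact ⟨ρ, _, .seq e1 e2, add_le_add t1 t2, r2, a2⟩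

end Cmd

end Ram

open Polynomial

namespace PeriodicEvasive

/-! ### Evasiveness of products, and counting with a folded Wronskian -/

section Evasive

variable {F : Type*} [Field F] {k m r : ℕ}

/-- The rank-nullity bound for the restriction of a linear map to `U`, with values in `Z` and kernel
in `U'`. -/
theorem finrank_le_finrank_add_of_map_le {E E' : Type*} [AddCommGroup E] [Module F E]
    [FiniteDimensional F E] [AddCommGroup E'] [Module F E'] [FiniteDimensional F E']
    (f : E →ₗ[F] E') (U U' : Submodule F E) (Z : Submodule F E') (hZ : ∀ x ∈ U, f x ∈ Z)
    (hU' : ∀ x ∈ U, f x = 0 → x ∈ U') :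
    Module.finrank F U ≤ Module.finrank F Z + Module.finrank F U' := by
  rw [← LinearMap.finrank_range_add_finrank_ker (f.domRestrict U)]
  refine add_le_add (Submodule.finrank_mono ?_) ?_
  · rintro _ ⟨x, rfl⟩
    exact hZ x x.2
  · let g : LinearMap.ker (f.domRestrict U) →ₗ[F] U' :=
      LinearMap.codRestrict U' (U.subtype ∘ₗ (LinearMap.ker (f.domRestrict U)).subtype)
        fun x => hU' _ x.1.2 x.2
    refine LinearMap.finrank_le_finrank_of_injective (f := g) fun x y hxy => ?_
    have : ((x : U) : E) = ((y : U) : E) := congrArg (Subtype.val : U' → E) hxy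
    exact Subtype.ext (Subtype.ext this)

/-- If the first nonzero block of `u` is the one with number `i`, or a later one, then block `i` of
the image is the image of block `i` under the diagonal block of the matrix. -/
theorem IsPeriodicMatrix.mulVec_apply_of_forall_lt
    {M : Matrix (Fin k × Fin m) (Fin k × Fin r) F} (hM : IsPeriodicMatrix M)
    {u : Fin k × Fin r → F} {i : Fin k} (hu : ∀ i' < i, ∀ b, u (i', b) = 0) (a : Fin m) :
    M.mulVec u (i, a) = ∑ b, M (i, a) (i, b) * u (i, b) := by
  simp only [Matrix.mulVec, dotProduct, Fintype.sum_prod_type]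
  refine Finset.sum_eq_single i (fun i' _ hi' => Finset.sum_eq_zero fun b _ => ?_) (by simp)
  rcases lt_or_gt_of_ne hi' with h | h
  · simp [hu i' h]
  · simp [hM.lower i i' h]

/-- The diagonal block of a periodic matrix with at most as many columns as rows is injective, so
that the filtration of the image by the number of leading zero blocks has graded pieces that embed
into the intersections of the image of the diagonal block with the factors of the product. -/
theorem IsPeriodicMatrix.finrank_inf_blockProduct_le
    {M : Matrix (Fin k × Fin m) (Fin k × Fin r) F} (hM : IsPeriodicMatrix M) (hr : r ≤ m)
    (A : Matrix (Fin m) (Fin r) F) (hA : ∀ i a b, M (i, a) (i, b) = A a b)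
    (H : Fin k → Submodule F (Fin m → F)) :
    Module.finrank F ↥(LinearMap.range M.mulVecLin ⊓ blockProduct H) ≤
      ∑ i, Module.finrank F ↥(LinearMap.range A.mulVecLin ⊓ H i) := by
  have hinj : Function.Injective M.mulVecLin := by
    rw [← LinearMap.ker_eq_bot, ← Submodule.finrank_eq_zero]
    have h1 := LinearMap.finrank_range_add_finrank_ker M.mulVecLin
    have h2 : Module.finrank F (LinearMap.range M.mulVecLin) = k * r := by
      have := hM.rank_eq
      rw [min_eq_right (Nat.mul_le_mul_left k hr)] at this
      exact this
    simp only [Module.finrank_fintype_fun_eq_card, Fintype.card_prod, Fintype.card_fin] at h1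
    omega
  have hAinj : 0 < k → ∀ v : Fin r → F, A.mulVec v = 0 → v = 0 := by
    intro hk v hv
    -- a vector supported on the last block is mapped to its image under `A` in the last block
    let last : Fin k := ⟨k - 1, by omega⟩
    let u : Fin k × Fin r → F := fun p => if p.1 = last then v p.2 else 0
    have hu : M.mulVec u = 0 := by
      ext ⟨i, a⟩
      have hi : i ≤ last := by
        rw [Fin.le_def]
        have : (last : ℕ) = k - 1 := rfl
        omega
      rcases hi.eq_or_lt with rfl | hi
      · rw [hM.mulVec_apply_of_forall_lt (fun i' hi' b => by simp [u, hi'.ne])]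
        simp only [hA, u, if_true]
        exact congrFun hv a
      · rw [hM.mulVec_apply_of_forall_lt (fun i' hi' b => by simp [u, (hi'.trans hi).ne])]
        simp [u, hi.ne]
    have h0 : u = 0 := hinj (by simpa using hu)
    funext b
    simpa [u] using congrFun h0 (last, b)
  -- the vectors of the intersection whose first `n` blocks vanish
  let U : ℕ → Submodule F (Fin k × Fin m → F) := fun n =>
    { carrier := {w | w ∈ LinearMap.range M.mulVecLin ⊓ blockProduct H ∧
        ∀ i : Fin k, (i : ℕ) < n → ∀ a, w (i, a) = 0}
      zero_mem' := ⟨zero_mem _, fun _ _ _ => rfl⟩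
      add_mem' := fun hx hy => ⟨add_mem hx.1 hy.1, fun i hi a => by
        simp [hx.2 i hi a, hy.2 i hi a]⟩
      smul_mem' := fun c x hx => ⟨Submodule.smul_mem _ c hx.1, fun i hi a => by
        simp [hx.2 i hi a]⟩ }
  have hstep : ∀ n : Fin k, Module.finrank F (U n) ≤
      Module.finrank F ↥(LinearMap.range A.mulVecLin ⊓ H n) + Module.finrank F (U (n + 1)) := by
    intro n
    refine finrank_le_finrank_add_of_map_le
      (LinearMap.funLeft F F fun j : Fin m => (n, j)) _ _ _ ?_ ?_
    · rintro w ⟨⟨⟨u, rfl⟩, hw⟩, h0⟩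
      refine ⟨?_, (mem_blockProduct H _).1 hw n⟩
      -- the blocks of `u` before the first nonzero block of its image vanish
      have hu : ∀ i : Fin k, i < n → ∀ b, u (i, b) = 0 := by
        intro i
        induction i using WellFoundedLT.induction with
        | ind i ih =>
          intro hi b
          refine congrFun (hAinj (Fin.pos i) (fun b => u (i, b)) ?_) b
          ext a
          have h1 := h0 i hi a
          rw [Matrix.mulVecLin_apply,
            hM.mulVec_apply_of_forall_lt fun i' hi' b => ih i' hi' (hi'.trans hi) b] at h1
          simpa [hA, Matrix.mulVec, dotProduct] using h1
      refine ⟨fun b => u (n, b), ?_⟩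
      ext a
      simp only [Matrix.mulVecLin_apply, LinearMap.funLeft_apply]
      rw [hM.mulVec_apply_of_forall_lt (fun i' hi' b => hu i' hi' b)]
      simp [hA, Matrix.mulVec, dotProduct]
    · rintro w ⟨hw, h0⟩ hn
      refine ⟨hw, fun i hi a => ?_⟩
      rcases Nat.lt_succ_iff_lt_or_eq.1 hi with h | h
      · exact h0 i h a
      · obtain rfl : i = n := Fin.ext h
        exact congrFun hn a
  -- summation from the last block, where `j` is the number of blocks that are covered
  have hk0 : ∀ j ≤ k, Module.finrank F (U (k - j)) ≤
      ∑ i ∈ Finset.univ.filter fun i : Fin k => k - j ≤ (i : ℕ),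
        Module.finrank F ↥(LinearMap.range A.mulVecLin ⊓ H i) := by
    intro j
    induction j with
    | zero =>
      intro _
      have : U (k - 0) = ⊥ := by
        rw [eq_bot_iff]
        rintro w ⟨-, hw⟩
        refine (Submodule.mem_bot F).2 (funext fun p => hw p.1 ?_ p.2)
        simp
      rw [this]
      simp
    | succ j ih =>
      intro hj
      have h1 : Module.finrank F (U (k - (j + 1))) ≤ _ + Module.finrank F (U (k - (j + 1) + 1)) :=
        hstep ⟨k - (j + 1), by omega⟩
      rw [show k - (j + 1) + 1 = k - j by omega] at h1
      have h3 : (Finset.univ.filter fun i : Fin k => k - (j + 1) ≤ (i : ℕ)) =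
          insert ⟨k - (j + 1), by omega⟩ (Finset.univ.filter fun i : Fin k => k - j ≤ (i : ℕ)) := by
        ext i
        simp only [Finset.mem_filter, Finset.mem_univ, true_and, Finset.mem_insert, Fin.ext_iff]
        omega
      rw [h3, Finset.sum_insert (by simp; omega)]
      exact h1.trans (Nat.add_le_add_left (ih (by omega)) _)
  have h1 := hk0 k le_rfl
  have h2 : U (k - k) = LinearMap.range M.mulVecLin ⊓ blockProduct H := by
    ext w
    exact ⟨fun h => h.1, fun h => ⟨h, fun i hi => absurd hi (by omega)⟩⟩
  rw [h2] at h1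
  simpa using h1

/-- A product of the members of a subspace design is periodic evasive. -/
theorem IsSubspaceDesign.isPeriodicEvasive (hk : 0 < k) (hr : r ≤ m) {s : ℝ}
    {H : Fin k → Submodule F (Fin m → F)} (hH : IsSubspaceDesign r s H) :
    IsPeriodicEvasive r s (blockProduct H) := by
  rintro V ⟨M, hM, rfl⟩
  let A : Matrix (Fin m) (Fin r) F := fun a b => M (⟨0, hk⟩, a) (⟨0, hk⟩, b)
  have h1 := hM.finrank_inf_blockProduct_le hr A (fun i a b => hM.diag _ _ a b) H
  refine le_trans ?_ (hH (LinearMap.range A.mulVecLin) ?_)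
  · exact_mod_cast h1
  · refine (LinearMap.finrank_range_le _).trans ?_
    simp

end Evasive

section Wronskian

variable {K : Type*} [Field K]

theorem coeff_prod_sum_of_natDegree_le {ι : Type*} (s : Finset ι) (f : ι → K[X]) (δ : ι → ℕ)
    (h : ∀ i ∈ s, (f i).natDegree ≤ δ i) :
    (∏ i ∈ s, f i).coeff (∑ i ∈ s, δ i) = ∏ i ∈ s, (f i).coeff (δ i) := by
  classical
  induction s using Finset.induction_on with
  | empty => simp
  | insert a s ha ih =>
    have hs : (∏ i ∈ s, f i).natDegree ≤ ∑ i ∈ s, δ i :=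
      (natDegree_prod_le _ _).trans (Finset.sum_le_sum fun i hi =>
        h i (Finset.mem_insert_of_mem hi))
    rw [Finset.prod_insert ha, Finset.sum_insert ha, Finset.prod_insert ha,
      coeff_mul_add_eq_of_natDegree_le (h a (Finset.mem_insert_self a s)) hs,
      ih fun i hi => h i (Finset.mem_insert_of_mem hi)]

theorem natDegree_comp_C_mul_X_le (f : K[X]) (a : K) :
    (f.comp (C a * X)).natDegree ≤ f.natDegree := by
  refine natDegree_comp_le.trans ?_
  have : (C a * X : K[X]).natDegree ≤ 1 := (natDegree_C_mul_le _ _).trans natDegree_X_le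
  simpa using Nat.mul_le_mul_left f.natDegree this

/-- A space of polynomials of dimension at most `r` is spanned by at most `r` polynomials with
distinct degrees. -/
theorem exists_injective_natDegree_span (V : Submodule K K[X]) [FiniteDimensional K V] :
    ∃ (ρ : ℕ) (f : Fin ρ → K[X]), ρ ≤ Module.finrank K V ∧ (∀ a, f a ∈ V) ∧ (∀ a, f a ≠ 0) ∧
      Function.Injective (fun a => (f a).natDegree) ∧ V ≤ Submodule.span K (Set.range f) := by
  -- choose one polynomial for each degree that occurs in `V`
  let D : Set ℕ := {n | ∃ f ∈ V, f ≠ 0 ∧ f.natDegree = n}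
  choose g hgV hg0 hgd using fun n : D => n.2
  have hli : LinearIndependent K g := by
    rw [linearIndependent_iff']
    intro s c hsum i hi
    have h1 := degree_sum_eq_of_disjoint (fun n => c n • g n) s fun n hn n' hn' hne => by
      have hdeg : ∀ n : D, c n • g n ≠ 0 → (c n • g n).degree = (n : ℕ) := fun n hn => by
        have hc : c n ≠ 0 := fun h => hn (by simp [h])
        rw [degree_smul_of_smul_regular _ (IsSMulRegular.of_ne_zero hc),
          degree_eq_natDegree (hg0 n), hgd]
      simp only [Function.onFun, Function.comp_apply, hdeg n hn.2, hdeg n' hn'.2]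
      exact fun h => hne (Subtype.ext (by exact_mod_cast h))
    rw [hsum, degree_zero] at h1
    have h2 : (c i • g i).degree ≤ ⊥ := h1 ▸ Finset.le_sup (f := fun n => (c n • g n).degree) hi
    have h3 : c i • g i = 0 := degree_eq_bot.1 (le_bot_iff.1 h2)
    exact (smul_eq_zero.1 h3).resolve_right (hg0 i)
  have hliV : LinearIndependent K fun n : D => (⟨g n, hgV n⟩ : V) :=
    LinearIndependent.of_comp V.subtype hli
  have : Finite D := hliV.finite
  have : Fintype D := Fintype.ofFinite D
  let e : Fin (Fintype.card D) ≃ D := (Fintype.equivFin D).symm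
  refine ⟨Fintype.card D, g ∘ e, hliV.fintype_card_le_finrank, fun a => hgV _, fun a => hg0 _,
    fun a b hab => ?_, ?_⟩
  · simp only [Function.comp_apply, hgd] at hab
    exact e.injective (Subtype.ext hab)
  · rw [e.surjective.range_comp]
    -- the leading term of an element of `V` can be cancelled by the chosen polynomial
    have key : ∀ n, ∀ f ∈ V, f.natDegree < n → f ∈ Submodule.span K (Set.range g) := by
      intro n
      induction n with
      | zero => intro f _ h; omega
      | succ n ih =>
        intro f hf hn
        by_cases hf0 : f = 0
        · rw [hf0]
          exact zero_mem _
        let δ : D := ⟨f.natDegree, f, hf, hf0, rfl⟩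
        have hgδ : (g δ).natDegree = f.natDegree := hgd δ
        let c : K := f.leadingCoeff / (g δ).leadingCoeff
        have hlc : (g δ).leadingCoeff ≠ 0 := leadingCoeff_ne_zero.2 (hg0 δ)
        have hc : c ≠ 0 := div_ne_zero (leadingCoeff_ne_zero.2 hf0) hlc
        have hmem : c • g δ ∈ Submodule.span K (Set.range g) :=
          Submodule.smul_mem _ _ (Submodule.subset_span ⟨δ, rfl⟩)
        have hdeg : (c • g δ).degree = f.degree := by
          rw [degree_smul_of_smul_regular _ (IsSMulRegular.of_ne_zero hc),
            degree_eq_natDegree (hg0 δ), degree_eq_natDegree hf0, hgδ]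
        have hsub : f - c • g δ ∈ Submodule.span K (Set.range g) := by
          by_cases h0 : f - c • g δ = 0
          · rw [h0]
            exact zero_mem _
          refine ih _ (V.sub_mem hf (V.smul_mem _ (hgV δ))) ?_
          have h1 : (f - c • g δ).degree < f.degree := by
            refine degree_sub_lt_left hdeg.symm hf0 ?_
            rw [leadingCoeff_smul_of_smul_regular _ (IsSMulRegular.of_ne_zero hc), smul_eq_mul,
              div_mul_cancel₀ _ hlc]
          have h2 := natDegree_lt_natDegree h0 h1
          omega
        simpa using add_mem hsub hmem
    exact fun f hf => key _ f hf (Nat.lt_succ_self _)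

/-- The folded Wronskian of polynomials with distinct degrees does not vanish: its coefficient in
the largest possible degree is a Vandermonde determinant. -/
theorem foldedWronskian_ne_zero {ρ : ℕ} (f : Fin ρ → K[X]) (hf : ∀ a, f a ≠ 0) (γ : K)
    (hγ : Function.Injective fun a => γ ^ (f a).natDegree) :
    (Matrix.of fun a b : Fin ρ => (f a).comp (C (γ ^ (b : ℕ)) * X)).det ≠ 0 := by
  set δ : Fin ρ → ℕ := fun a => (f a).natDegree with hδ
  have hcoeff : (Matrix.of fun a b : Fin ρ => (f a).comp (C (γ ^ (b : ℕ)) * X)).det.coeff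
      (∑ a, δ a) = (∏ a, (f a).leadingCoeff) *
        (Matrix.vandermonde fun a => γ ^ δ a).det := by
    rw [← Matrix.det_mul_column, Matrix.det_apply, Matrix.det_apply, finsetSum_coeff]
    refine Finset.sum_congr rfl fun τ _ => ?_
    rw [coeff_smul]
    congr 1
    rw [← Equiv.sum_comp τ δ, coeff_prod_sum_of_natDegree_le]
    · refine Finset.prod_congr rfl fun a _ => ?_
      simp only [hδ, Matrix.of_apply, comp_C_mul_X_coeff, Matrix.vandermonde_apply, ← pow_mul,
        mul_comm (a : ℕ)]
      rfl
    · exact fun a _ => natDegree_comp_C_mul_X_le _ _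
  intro h0
  rw [h0, coeff_zero] at hcoeff
  refine mul_ne_zero (Finset.prod_ne_zero_iff.2 fun a _ => leadingCoeff_ne_zero.2 (hf a)) ?_
    hcoeff.symm
  exact Matrix.det_vandermonde_ne_zero_iff.2 hγ

theorem natDegree_foldedWronskian_le {ρ d : ℕ} (f : Fin ρ → K[X]) (hf : ∀ a, (f a).natDegree ≤ d)
    (γ : K) :
    (Matrix.of fun a b : Fin ρ => (f a).comp (C (γ ^ (b : ℕ)) * X)).det.natDegree ≤ ρ * d := by
  rw [Matrix.det_apply]
  refine natDegree_sum_le_of_forall_le _ _ fun τ _ => (natDegree_smul_le _ _).trans ?_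
  refine (natDegree_prod_le _ _).trans ?_
  refine (Finset.sum_le_card_nsmul _ _ d fun a _ => ?_).trans (by simp)
  exact (natDegree_comp_C_mul_X_le _ _).trans (hf _)

/-- If every index `i` in `I` has a nonzero polynomial in `V` that vanishes on the progression
`β i, β i γ, …, β i γ ^ (t - 1)`, where these progressions are disjoint, then the folded Wronskian
of `V` has at least `(t + 1 - r) * |I|` zeros. Its degree is at most `r * d`. -/
theorem card_mul_le_of_vanishing {ι : Type*} (V : Submodule K K[X]) [FiniteDimensional K V]
    {r d t : ℕ} (hr : 0 < r) (hV : Module.finrank K V ≤ r) (hd : ∀ f ∈ V, f.natDegree ≤ d) {γ : K}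
    (hγ : Set.InjOn (fun n : ℕ => γ ^ n) (Set.Iic d)) (I : Finset ι) (β : ι → K)
    (hβ : Set.InjOn (fun p : ι × ℕ => β p.1 * γ ^ p.2) {p | p.1 ∈ I ∧ p.2 < t})
    (hI : ∀ i ∈ I, ∃ f ∈ V, f ≠ 0 ∧ ∀ j < t, f.eval (β i * γ ^ j) = 0) :
    I.card * (t + 1 - r) ≤ r * d := by
  classical
  obtain ⟨ρ, f, hρ, hfV, hf0, hfd, hspan⟩ := exists_injective_natDegree_span V
  have hρr : ρ ≤ r := hρ.trans hV
  set W := (Matrix.of fun a b : Fin ρ => (f a).comp (C (γ ^ (b : ℕ)) * X)).det with hW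
  have hW0 : W ≠ 0 := foldedWronskian_ne_zero f hf0 γ fun a b hab =>
    hfd (hγ (hd _ (hfV a)) (hd _ (hfV b)) hab)
  have hroot : ∀ i ∈ I, ∀ j < t + 1 - r, W.IsRoot (β i * γ ^ j) := by
    intro i hi j hj
    obtain ⟨g, hgV, hg0, hg⟩ := hI i hi
    obtain ⟨c, rfl⟩ := (Submodule.mem_span_range_iff_exists_fun K).1 (hspan hgV)
    have hc : c ≠ 0 := by
      rintro rfl
      simp at hg0
    rw [IsRoot, hW, ← coe_evalRingHom, RingHom.map_det]
    -- the coefficients of the vanishing polynomial are in the left kernel of the evaluated matrix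
    refine Matrix.exists_vecMul_eq_zero_iff.1 ⟨c, hc, ?_⟩
    ext b
    have h1 := hg (j + b) (by have := b.2; omega)
    rw [eval_finsetSum] at h1
    rw [Pi.zero_apply, ← h1]
    simp only [Matrix.vecMul, dotProduct, RingHom.mapMatrix_apply, Matrix.map_apply,
      Matrix.of_apply, coe_evalRingHom, eval_comp, eval_mul, eval_C, eval_X, eval_smul, smul_eq_mul]
    refine Finset.sum_congr rfl fun a _ => ?_
    congr 2
    ring
  have hinj : Set.InjOn (fun p : ι × ℕ => β p.1 * γ ^ p.2)
      ↑(I ×ˢ Finset.range (t + 1 - r)) := by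
    refine hβ.mono fun p hp => ?_
    simp only [Finset.coe_product, Set.mem_prod, Finset.mem_coe, Finset.mem_range] at hp
    exact ⟨hp.1, by omega⟩
  have hcard : (I ×ˢ Finset.range (t + 1 - r)).card ≤ W.natDegree := by
    rw [← Finset.card_image_of_injOn hinj]
    refine card_le_degree_of_subset_roots fun z hz => ?_
    obtain ⟨p, hp, rfl⟩ := Finset.mem_image.1 (Finset.mem_def.2 hz)
    rw [Finset.mem_product, Finset.mem_range] at hp
    exact (mem_roots hW0).2 (hroot _ hp.1 _ hp.2)
  rw [Finset.card_product, Finset.card_range] at hcard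
  exact hcard.trans ((natDegree_foldedWronskian_le f (fun a => hd _ (hfV a)) γ).trans
    (Nat.mul_le_mul_right d hρr))

end Wronskian

/-! ### Field extensions from primitive linear recurrences -/

section Recurrence

variable {F : Type*} [Field F]

/-- The characteristic polynomial `Y ^ e - c (e - 1) Y ^ (e - 1) - ⋯ - c 0` of the linear recurrence
with coefficients `c 0, …, c (e - 1)`. -/
noncomputable def recPoly (c : ℕ → F) (e : ℕ) : F[X] :=
  X ^ e - ∑ u ∈ Finset.range e, C (c u) * X ^ u

theorem degree_sum_C_mul_X_pow_lt (c : ℕ → F) (e : ℕ) :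
    (∑ u ∈ Finset.range e, C (c u) * X ^ u).degree < (e : WithBot ℕ) := by
  rw [← Polynomial.mem_degreeLT]
  refine Submodule.sum_mem _ fun u hu => mem_degreeLT.2 ?_
  exact (degree_C_mul_X_pow_le _ _).trans_lt (by exact_mod_cast Finset.mem_range.1 hu)

theorem monic_recPoly (c : ℕ → F) (e : ℕ) : (recPoly c e).Monic :=
  monic_X_pow_sub (degree_sum_C_mul_X_pow_lt c e)

theorem degree_recPoly (c : ℕ → F) (e : ℕ) : (recPoly c e).degree = e := by
  rw [recPoly, degree_sub_eq_left_of_degree_lt, degree_X_pow]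
  rw [degree_X_pow]
  exact degree_sum_C_mul_X_pow_lt c e

theorem natDegree_recPoly (c : ℕ → F) (e : ℕ) : (recPoly c e).natDegree = e :=
  natDegree_eq_of_degree_eq_some (degree_recPoly c e)

theorem recPoly_coeff (c : ℕ → F) {e u : ℕ} (hu : u < e) : (recPoly c e).coeff u = -c u := by
  simp [recPoly, coeff_X_pow, hu.ne, hu]

/-- The `u`-th coordinate of an element of `F[Y] / (recPoly c e)` in the basis of powers of `Y`. -/
noncomputable def coord (c : ℕ → F) (e u : ℕ) : AdjoinRoot (recPoly c e) →ₗ[F] F :=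
  lcoeff F u ∘ₗ AdjoinRoot.modByMonicHom (monic_recPoly c e)

theorem coord_apply (c : ℕ → F) (e u : ℕ) (z : AdjoinRoot (recPoly c e)) :
    coord c e u z = (AdjoinRoot.modByMonicHom (monic_recPoly c e) z).coeff u := rfl

theorem degree_modByMonicHom_lt (c : ℕ → F) (e : ℕ) (z : AdjoinRoot (recPoly c e)) :
    (AdjoinRoot.modByMonicHom (monic_recPoly c e) z).degree < e := by
  obtain ⟨f, rfl⟩ := AdjoinRoot.mk_surjective z
  rw [AdjoinRoot.modByMonicHom_mk]
  exact (degree_modByMonic_lt f (monic_recPoly c e)).trans_eq (degree_recPoly c e)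

theorem coord_ext {c : ℕ → F} {e : ℕ} {z w : AdjoinRoot (recPoly c e)}
    (h : ∀ u < e, coord c e u z = coord c e u w) : z = w := by
  rw [← AdjoinRoot.mk_leftInverse (monic_recPoly c e) z,
    ← AdjoinRoot.mk_leftInverse (monic_recPoly c e) w]
  congr 1
  ext u
  rcases lt_or_ge u e with hu | hu
  · exact h u hu
  · have hu' : (e : WithBot ℕ) ≤ (u : WithBot ℕ) := by exact_mod_cast hu
    rw [coeff_eq_zero_of_degree_lt ((degree_modByMonicHom_lt c e z).trans_le hu'),
      coeff_eq_zero_of_degree_lt ((degree_modByMonicHom_lt c e w).trans_le hu')]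

theorem coord_root_pow (c : ℕ → F) {e u : ℕ} (u' : ℕ) (hu : u < e) :
    coord c e u' (AdjoinRoot.root (recPoly c e) ^ u) = if u' = u then 1 else 0 := by
  rw [coord_apply, ← AdjoinRoot.mk_X, ← map_pow, AdjoinRoot.modByMonicHom_mk,
    (modByMonic_eq_self_iff (monic_recPoly c e)).2, coeff_X_pow]
  rw [degree_recPoly, degree_X_pow]
  exact_mod_cast hu

/-- Multiplication by `Y` is one step of the shift register with feedback `c`. -/
theorem coord_root_mul (c : ℕ → F) {e u : ℕ} (hu : u < e) (z : AdjoinRoot (recPoly c e)) :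
    coord c e u (AdjoinRoot.root (recPoly c e) * z) =
      (if u = 0 then 0 else coord c e (u - 1) z) + coord c e (e - 1) z * c u := by
  set h := AdjoinRoot.modByMonicHom (monic_recPoly c e) z with hh
  have hz : z = AdjoinRoot.mk (recPoly c e) h :=
    (AdjoinRoot.mk_leftInverse (monic_recPoly c e) z).symm
  have hdeg : h.degree < e := degree_modByMonicHom_lt c e z
  set a := h.coeff (e - 1) with ha
  have hmod : (X * h) %ₘ recPoly c e = X * h - C a * recPoly c e := by
    refine (div_modByMonic_unique (C a) _ (monic_recPoly c e) ⟨by ring, ?_⟩).2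
    rw [degree_recPoly, degree_lt_iff_coeff_zero]
    intro n hn
    obtain ⟨n, rfl⟩ : ∃ n', n = n' + 1 := ⟨n - 1, by omega⟩
    rw [coeff_sub, coeff_X_mul, coeff_C_mul]
    rcases hn.eq_or_lt with h1 | h1
    · have h2 : (recPoly c e).coeff (n + 1) = 1 := by
        have := monic_recPoly c e
        rw [Monic, leadingCoeff, natDegree_recPoly] at this
        rwa [← h1]
      rw [h2, ha, h1]
      simp
    · rw [coeff_eq_zero_of_degree_lt (hdeg.trans_le (by exact_mod_cast Nat.lt_succ_iff.1 h1)),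
        coeff_eq_zero_of_degree_lt (p := recPoly c e) (by
          rw [degree_recPoly]
          exact_mod_cast h1)]
      simp
  rw [coord_apply, coord_apply, coord_apply, ← hh]
  conv_lhs => rw [hz, ← AdjoinRoot.mk_X, ← map_mul, AdjoinRoot.modByMonicHom_mk, hmod]
  rw [coeff_sub, coeff_C_mul, recPoly_coeff c hu]
  cases u with
  | zero => simp [ha]
  | succ u => simp [ha, coeff_X_mul]

/-- The recurrence is primitive: `Y` is invertible modulo `recPoly c e`, and its order is not
smaller than the number of nonzero elements of a field with `|F| ^ e` elements. -/
def IsPrimitive (c : ℕ → F) (e : ℕ) : Prop :=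
  c 0 ≠ 0 ∧ ∀ i, 1 ≤ i → i < Nat.card F ^ e - 1 → AdjoinRoot.root (recPoly c e) ^ i ≠ 1

theorem natCard_adjoinRoot_recPoly (c : ℕ → F) (e : ℕ) :
    Nat.card (AdjoinRoot (recPoly c e)) = Nat.card F ^ e := by
  have := (monic_recPoly c e).free_adjoinRoot
  have := (monic_recPoly c e).finite_adjoinRoot
  rw [Module.natCard_eq_pow_finrank (K := F), (AdjoinRoot.powerBasis' (monic_recPoly c e)).finrank,
    AdjoinRoot.powerBasis'_dim, natDegree_recPoly]

theorem IsPrimitive.isUnit_root {c : ℕ → F} {e : ℕ} (he : 0 < e) (h : IsPrimitive c e) :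
    IsUnit (AdjoinRoot.root (recPoly c e)) := by
  have h1 : AdjoinRoot.mk (recPoly c e) (recPoly c e) = 0 := AdjoinRoot.mk_self
  -- `Y` divides the nonzero constant `c 0`
  have h2 : recPoly c e = X * (recPoly c e).divX - C (c 0) := by
    conv_lhs => rw [← X_mul_divX_add (recPoly c e), recPoly_coeff c he]
    simp [sub_eq_add_neg]
  rw [h2, map_sub, map_mul, ← h2, sub_eq_zero, AdjoinRoot.mk_X, AdjoinRoot.mk_C] at h1
  have h3 : IsUnit (AdjoinRoot.of (recPoly c e) (c 0)) := (isUnit_iff_ne_zero.2 h.1).map _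
  rw [← h1] at h3
  exact isUnit_of_mul_isUnit_left h3

theorem IsPrimitive.injOn {c : ℕ → F} {e : ℕ} (he : 0 < e) (h : IsPrimitive c e) :
    Set.InjOn (fun n : ℕ => AdjoinRoot.root (recPoly c e) ^ n)
      (Set.Iio (Nat.card F ^ e - 1)) := by
  have key : ∀ i j : ℕ, i < j → j < Nat.card F ^ e - 1 →
      AdjoinRoot.root (recPoly c e) ^ i ≠ AdjoinRoot.root (recPoly c e) ^ j := by
    intro i j hij hj heq
    refine h.2 (j - i) (by omega) (by omega) ?_
    have hu := (h.isUnit_root he).pow i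
    refine hu.mul_left_cancel ?_
    rw [← pow_add, mul_one, heq]
    congr 1
    omega
  intro i hi j hj hij
  by_contra hne
  rcases lt_or_gt_of_ne hne with h1 | h1
  · exact key i j h1 hj hij
  · exact key j i h1 hi hij.symm

/-- The powers of `Y` are all the nonzero residues, so that these are units. -/
theorem IsPrimitive.irreducible [Finite F] {c : ℕ → F} {e : ℕ} (he : 0 < e)
    (h : IsPrimitive c e) : Irreducible (recPoly c e) := by
  have hq : 1 < Nat.card F := Finite.one_lt_card
  have hQ : 1 < Nat.card F ^ e := Nat.one_lt_pow he.ne' hq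
  have hcard := natCard_adjoinRoot_recPoly c e
  have : Finite (AdjoinRoot (recPoly c e)) := Nat.finite_of_card_ne_zero (by omega)
  have : Nontrivial (AdjoinRoot (recPoly c e)) :=
    (Finite.one_lt_card_iff_nontrivial).1 (by omega)
  have : Fintype (AdjoinRoot (recPoly c e)) := Fintype.ofFinite _
  classical
  have hunit : ∀ z : AdjoinRoot (recPoly c e), z ≠ 0 → IsUnit z := by
    intro z hz
    have hu := h.isUnit_root he
    have himg : (Finset.range (Nat.card F ^ e - 1)).image
        (fun n : ℕ => AdjoinRoot.root (recPoly c e) ^ n) = Finset.univ.erase 0 := by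
      refine Finset.eq_of_subset_of_card_le (fun w hw => ?_) ?_
      · obtain ⟨n, -, rfl⟩ := Finset.mem_image.1 hw
        exact Finset.mem_erase.2 ⟨(hu.pow n).ne_zero, Finset.mem_univ _⟩
      · rw [Finset.card_erase_of_mem (Finset.mem_univ _), Finset.card_univ,
          Finset.card_image_of_injOn, Finset.card_range, ← Nat.card_eq_fintype_card, hcard]
        intro i hi j hj hij
        exact h.injOn he (by simpa using hi) (by simpa using hj) hij
    have hz' : z ∈ Finset.univ.erase (0 : AdjoinRoot (recPoly c e)) :=
      Finset.mem_erase.2 ⟨hz, Finset.mem_univ _⟩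
    rw [← himg] at hz'
    obtain ⟨n, -, rfl⟩ := Finset.mem_image.1 hz'
    exact hu.pow n
  refine Prime.irreducible ⟨(monic_recPoly c e).ne_zero, fun hp => ?_, fun a b hab => ?_⟩
  · have := degree_eq_zero_of_isUnit hp
    rw [degree_recPoly] at this
    exact he.ne' (by exact_mod_cast this)
  · rw [← AdjoinRoot.mk_eq_zero, ← AdjoinRoot.mk_eq_zero]
    rw [← AdjoinRoot.mk_eq_zero, map_mul] at hab
    by_contra! hne
    exact ((hunit _ hne.1).mul (hunit _ hne.2)).ne_zero hab

/-- A primitive recurrence comes from the minimal polynomial of a generator of the multiplicative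
group of the extension of degree `e`. -/
theorem exists_isPrimitive [Finite F] {e : ℕ} (he : 0 < e) : ∃ c : ℕ → F, IsPrimitive c e := by
  have : NeZero e := ⟨he.ne'⟩
  let p := ringChar F
  have : Fact p.Prime := ⟨CharP.char_is_prime F p⟩
  let E := FiniteField.Extension F p e
  have hE : Nat.card E = Nat.card F ^ e := FiniteField.natCard_extension F p e
  obtain ⟨g, hg⟩ := IsCyclic.exists_generator (α := Eˣ)
  have hord : orderOf g = Nat.card F ^ e - 1 := by
    rw [orderOf_eq_card_of_forall_mem_zpowers hg, Nat.card_units, hE]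
  have hint : IsIntegral F (g : E) := .of_finite F _
  have htop : IntermediateField.adjoin F {(g : E)} = ⊤ := by
    rw [eq_top_iff]
    rintro x -
    by_cases hx : x = 0
    · rw [hx]
      exact zero_mem _
    · obtain ⟨n, hn⟩ := Subgroup.mem_zpowers_iff.1 (hg (Units.mk0 x hx))
      have : x = (g : E) ^ n := by
        rw [← Units.val_zpow_eq_zpow_val, hn, Units.val_mk0]
      rw [this]
      exact zpow_mem (IntermediateField.mem_adjoin_simple_self F (g : E)) n
  have hdeg : (minpoly F (g : E)).natDegree = e := by
    rw [← IntermediateField.adjoin.finrank hint, htop, IntermediateField.finrank_top']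
    exact FiniteField.finrank_extension F p e
  have hrec : recPoly (fun u => -(minpoly F (g : E)).coeff u) e = minpoly F (g : E) := by
    have h1 := (minpoly.monic hint).as_sum
    rw [hdeg] at h1
    rw [recPoly]
    conv_rhs => rw [h1]
    simp [sub_eq_add_neg]
  refine ⟨fun u => -(minpoly F (g : E)).coeff u, ?_, fun i hi1 hi2 h => ?_⟩
  · rw [neg_ne_zero]
    exact minpoly.coeff_zero_ne_zero hint g.ne_zero
  · let φ := AdjoinRoot.lift (algebraMap F E) (g : E)
      (f := recPoly (fun u => -(minpoly F (g : E)).coeff u) e)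
      (by rw [hrec]; exact minpoly.aeval F (g : E))
    have h2 := congrArg φ h
    rw [map_pow, map_one, AdjoinRoot.lift_root] at h2
    have h3 : g ^ i = 1 := Units.ext (by simpa using h2)
    have := orderOf_dvd_of_pow_eq_one h3
    have := Nat.le_of_dvd (by omega) this
    omega

end Recurrence

/-! ### The spaces of multiples of products of linear factors -/

section Spaces

variable {F : Type*} [Field F] (c : ℕ → F) (e : ℕ)

/-- The vectors of length `n` as polynomials over `F[Y] / (recPoly c e)`: the coordinate with number
`b * e + u`, where `u < e`, is the coefficient of `Y ^ u * X ^ b`. -/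
noncomputable def vecPoly (n : ℕ) : (Fin n → F) →ₗ[F] (AdjoinRoot (recPoly c e))[X] :=
  Fintype.linearCombination F
    fun j : Fin n => monomial (j / e) (AdjoinRoot.root (recPoly c e) ^ (j % e : ℕ))

/-- The first `n` coordinates of a polynomial over `F[Y] / (recPoly c e)`. -/
noncomputable def coords (n : ℕ) : (AdjoinRoot (recPoly c e))[X] →ₗ[F] (Fin n → F) :=
  LinearMap.pi fun j : Fin n => coord c e (j % e) ∘ₗ
    (lcoeff (AdjoinRoot (recPoly c e)) (j / e)).restrictScalars F

theorem coords_apply (n : ℕ) (f : (AdjoinRoot (recPoly c e))[X]) (j : Fin n) :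
    coords c e n f j = coord c e (j % e) (f.coeff (j / e)) := rfl

/-- All coordinates of the polynomial with numbers from `s` on vanish. -/
def HasSize (s : ℕ) (f : (AdjoinRoot (recPoly c e))[X]) : Prop :=
  ∀ b u, u < e → s ≤ b * e + u → coord c e u (f.coeff b) = 0

variable {c e}

theorem div_eq_of_lt_of_eq {l b u : ℕ} (hu : u < e) (h : l = b * e + u) : l / e = b ∧ l % e = u := by
  have he : 0 < e := by omega
  subst h
  rw [mul_comm, Nat.mul_add_div he, Nat.div_eq_of_lt hu, add_zero, Nat.mul_add_mod,
    Nat.mod_eq_of_lt hu]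
  exact ⟨rfl, rfl⟩

theorem coord_coeff_monomial {b u : ℕ} (hu : u < e) (l : ℕ) :
    coord c e u ((monomial (l / e) (AdjoinRoot.root (recPoly c e) ^ (l % e))).coeff b) =
      if b * e + u = l then 1 else 0 := by
  have he : 0 < e := by omega
  rw [coeff_monomial]
  have h2 : l / e * e + l % e = l := by rw [mul_comm, Nat.div_add_mod]
  by_cases hb : l / e = b
  · rw [if_pos hb, coord_root_pow _ _ (Nat.mod_lt _ he)]
    refine if_congr ⟨fun h => ?_, fun h => ?_⟩ rfl rfl
    · rw [h, ← hb, h2]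
    · exact (div_eq_of_lt_of_eq hu h.symm).2.symm
  · rw [if_neg hb, map_zero, if_neg]
    exact fun h => hb (div_eq_of_lt_of_eq hu h.symm).1

theorem coord_coeff_vecPoly {n b u : ℕ} (hu : u < e) (v : Fin n → F) :
    coord c e u ((vecPoly c e n v).coeff b) = if h : b * e + u < n then v ⟨b * e + u, h⟩ else 0 := by
  simp only [vecPoly, Fintype.linearCombination_apply, finsetSum_coeff, map_sum, coeff_smul,
    map_smul, coord_coeff_monomial hu, smul_eq_mul, mul_ite, mul_one, mul_zero]
  split_ifs with h
  · rw [Finset.sum_eq_single ⟨b * e + u, h⟩] <;> simp [Fin.ext_iff]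
    intro j hj hj'
    exact absurd hj'.symm hj
  · refine Finset.sum_eq_zero fun j _ => if_neg fun hj => h ?_
    rw [hj]
    exact j.2

theorem hasSize_vecPoly {n : ℕ} (v : Fin n → F) : HasSize c e n (vecPoly c e n v) := by
  intro b u hu hn
  rw [coord_coeff_vecPoly hu, dif_neg (by omega)]

theorem coords_vecPoly (he : 0 < e) {n : ℕ} (v : Fin n → F) :
    coords c e n (vecPoly c e n v) = v := by
  ext j
  rw [coords_apply, coord_coeff_vecPoly (Nat.mod_lt _ he)]
  have := Nat.div_add_mod (j : ℕ) e
  rw [mul_comm] at this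
  simp only [this]
  simp

theorem vecPoly_coords (he : 0 < e) {n : ℕ} {f : (AdjoinRoot (recPoly c e))[X]}
    (hf : HasSize c e n f) : vecPoly c e n (coords c e n f) = f := by
  ext b
  refine coord_ext fun u hu => ?_
  rw [coord_coeff_vecPoly hu]
  split_ifs with h
  · rw [coords_apply]
    congr 2
    · simp [Nat.mod_eq_of_lt hu]
    · simp only
      rw [mul_comm, Nat.mul_add_div he, Nat.div_eq_of_lt hu, add_zero]
  · exact (hf b u hu (by omega)).symm

theorem vecPoly_injective (he : 0 < e) (n : ℕ) : Function.Injective (vecPoly c e n) :=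
  Function.LeftInverse.injective (coords_vecPoly he)

theorem natDegree_vecPoly_le {n : ℕ} (v : Fin n → F) :
    (vecPoly c e n v).natDegree ≤ (n - 1) / e := by
  rw [vecPoly, Fintype.linearCombination_apply]
  refine natDegree_sum_le_of_forall_le _ _ fun j _ => (natDegree_smul_le _ _).trans ?_
  refine (natDegree_monomial_le _).trans (Nat.div_le_div_right ?_)
  omega

theorem HasSize.X_add_C_mul {s : ℕ} {f : (AdjoinRoot (recPoly c e))[X]} (hf : HasSize c e s f)
    (y : AdjoinRoot (recPoly c e)) : HasSize c e (s + e) ((X + C y) * f) := by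
  intro b u hu hs
  have hb : f.coeff b = 0 := coord_ext fun u' hu' => by
    rw [map_zero]
    exact hf b u' hu' (by omega)
  rw [add_mul, coeff_add, coeff_C_mul, hb, mul_zero, add_zero]
  cases b with
  | zero => simp
  | succ b =>
    rw [coeff_X_mul]
    refine hf b u hu ?_
    rw [add_mul] at hs
    omega

variable (c e)

/-- The product of the factors `X + Y ^ j` for `a ≤ j < a + t`. -/
noncomputable def factorProd (a t : ℕ) : (AdjoinRoot (recPoly c e))[X] :=
  ∏ j ∈ Finset.range t, (X + C (AdjoinRoot.root (recPoly c e) ^ (a + j)))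

theorem factorProd_succ (a t : ℕ) : factorProd c e a (t + 1) =
    (X + C (AdjoinRoot.root (recPoly c e) ^ (a + t))) * factorProd c e a t := by
  rw [factorProd, Finset.prod_range_succ, mul_comm]
  rfl

theorem monic_factorProd (a t : ℕ) : (factorProd c e a t).Monic :=
  monic_prod_of_monic _ _ fun _ _ => monic_X_add_C _

variable {c e}

theorem HasSize.factorProd_mul {s : ℕ} {f : (AdjoinRoot (recPoly c e))[X]} (hf : HasSize c e s f)
    (a t : ℕ) : HasSize c e (s + t * e) (factorProd c e a t * f) := by
  induction t with
  | zero => simpa [factorProd] using hf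
  | succ t ih =>
    rw [factorProd_succ, mul_assoc, add_mul, one_mul, ← add_assoc]
    exact ih.X_add_C_mul _

variable (c e)

/-- The linear map that sends a vector of length `L` to the coordinates of the corresponding multiple
of `factorProd c e a t`. -/
noncomputable def designMap (m t L a : ℕ) : (Fin L → F) →ₗ[F] (Fin m → F) :=
  coords c e m ∘ₗ LinearMap.mulLeft F (factorProd c e a t) ∘ₗ vecPoly c e L

theorem designMap_single (m t L a : ℕ) (l : Fin L) (j : Fin m) :
    designMap c e m t L a (Pi.single l 1) j = coord c e (j % e) ((factorProd c e a t *
      monomial (l / e) (AdjoinRoot.root (recPoly c e) ^ (l % e : ℕ))).coeff (j / e)) := by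
  rw [designMap, LinearMap.comp_apply, LinearMap.comp_apply, coords_apply, vecPoly,
    Fintype.linearCombination_apply_single, one_smul]
  rfl

variable {c e}

/-- Multiplication by the product of `t` factors raises the size by `t * e`, so that no coordinate is
cut off. The alternative `L = 0` covers the design of zero spaces, where `t * e` may exceed `m`. -/
theorem vecPoly_designMap (he : 0 < e) {m t L : ℕ} (hL : L + t * e ≤ m ∨ L = 0) (a : ℕ)
    (v : Fin L → F) :
    vecPoly c e m (designMap c e m t L a v) = factorProd c e a t * vecPoly c e L v := by
  rcases hL with hL | rfl
  · have h1 := (hasSize_vecPoly (c := c) (e := e) v).factorProd_mul a t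
    exact vecPoly_coords he fun b u hu hb => h1 b u hu (by omega)
  · rw [Subsingleton.elim v 0, map_zero, map_zero, map_zero, mul_zero]

theorem designMap_injective (he : 0 < e) {m t L : ℕ} (hL : L + t * e ≤ m ∨ L = 0) (a : ℕ) :
    Function.Injective (designMap c e m t L a) := by
  intro v w hvw
  refine vecPoly_injective (c := c) he L ?_
  have h1 := congrArg (vecPoly c e m) hvw
  rw [vecPoly_designMap he hL, vecPoly_designMap he hL] at h1
  exact (monic_factorProd c e a t).isRegular.left h1

/-- A product of images of injective maps has the obvious basis. -/
theorem exists_basis_blockProduct {k m L : ℕ} (B : Fin k → (Fin L → F) →ₗ[F] (Fin m → F))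
    (hB : ∀ i, Function.Injective (B i)) :
    ∃ b : Module.Basis (Fin k × Fin L) F ↥(blockProduct fun i => LinearMap.range (B i)),
      ∀ i l i' j, (b (i, l) : Fin k × Fin m → F) (i', j) =
        if i' = i then B i (Pi.single l 1) j else 0 := by
  let φ : (Fin k × Fin L → F) →ₗ[F] (Fin k × Fin m → F) :=
    LinearMap.pi fun p => LinearMap.proj p.2 ∘ₗ B p.1 ∘ₗ
      LinearMap.funLeft F F fun l : Fin L => (p.1, l)
  have hφ : ∀ u i j, φ u (i, j) = B i (fun l => u (i, l)) j := fun _ _ _ => rfl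
  have hinj : Function.Injective φ := by
    intro u v huv
    ext ⟨i, l⟩
    refine congrFun (hB i (a₁ := fun l => u (i, l)) (a₂ := fun l => v (i, l)) ?_) l
    ext j
    exact congrFun huv (i, j)
  have hrange : LinearMap.range φ = blockProduct fun i => LinearMap.range (B i) := by
    ext w
    rw [mem_blockProduct]
    constructor
    · rintro ⟨u, rfl⟩ i
      exact ⟨fun l => u (i, l), rfl⟩
    · intro h
      choose u hu using h
      exact ⟨fun p => u p.1 p.2, funext fun p => congrFun (hu p.1) p.2⟩
  let E := (LinearEquiv.ofInjective φ hinj).trans (LinearEquiv.ofEq _ _ hrange)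
  refine ⟨Module.Basis.ofEquivFun E.symm, fun i l i' j => ?_⟩
  have h1 : ((Module.Basis.ofEquivFun E.symm) (i, l) : Fin k × Fin m → F) =
      φ (Pi.single (i, l) 1) := by
    rw [Module.Basis.coe_ofEquivFun]
    rfl
  rw [h1, hφ]
  by_cases hi : i' = i
  · subst hi
    have : (fun l' => (Pi.single (i', l) 1 : Fin k × Fin L → F) (i', l')) = Pi.single l 1 := by
      ext l'
      simp [Pi.single_apply]
    rw [if_pos rfl, this]
  · rw [if_neg hi]
    have : (fun l' => (Pi.single (i, l) 1 : Fin k × Fin L → F) (i', l')) = 0 := by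
      ext l'
      simp [hi]
    rw [this, map_zero]
    rfl

theorem finrank_quotient_range_designMap (he : 0 < e) {m t L : ℕ}
    (hL : L + t * e ≤ m ∨ L = 0) (a : ℕ) :
    Module.finrank F ((Fin m → F) ⧸ LinearMap.range (designMap c e m t L a)) = m - L := by
  have h1 := Submodule.finrank_quotient_add_finrank (LinearMap.range (designMap c e m t L a))
  rw [LinearMap.finrank_range_of_inj (designMap_injective he hL a)] at h1
  simp only [Module.finrank_fintype_fun_eq_card, Fintype.card_fin] at h1
  omega

/-- At most `r d / (t + 1 - r)` members of the family meet a given space of dimension at most `r`,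
where `d` is the degree bound of the polynomials that correspond to vectors of length `m`. -/
theorem card_inf_designMap_ne_bot_mul_le [Finite F] (he : 0 < e) (hc : IsPrimitive c e)
    {k m r t L : ℕ} (hr : 0 < r) (hL : L + t * e ≤ m ∨ L = 0)
    (hkt : k * t ≤ Nat.card F ^ e - 1) (hm : (m - 1) / e < Nat.card F ^ e - 1)
    (V : Submodule F (Fin m → F)) (hV : Module.finrank F V ≤ r) (I : Finset (Fin k))
    (hI : ∀ i ∈ I, V ⊓ LinearMap.range (designMap c e m t L (i * t)) ≠ ⊥) :
    I.card * (t + 1 - r) ≤ r * ((m - 1) / e) := by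
  have : Fact (Irreducible (recPoly c e)) := ⟨hc.irreducible he⟩
  set K := AdjoinRoot (recPoly c e) with hK
  set γ : K := AdjoinRoot.root (recPoly c e) with hγ
  let b := Module.finBasis F V
  let g : Fin (Module.finrank F V) → K[X] := fun a => vecPoly c e m (b a)
  -- the `K`-span of `V`, which has dimension at most `r` over `K`
  let V' : Submodule K K[X] := Submodule.span K (Set.range g)
  have hVV' : ∀ v ∈ V, vecPoly c e m v ∈ V' := by
    intro v hv
    have h1 := b.sum_repr ⟨v, hv⟩
    have h2 : v = ∑ a, b.repr ⟨v, hv⟩ a • (b a : Fin m → F) := by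
      have h2 := congrArg V.subtype h1
      rw [map_sum] at h2
      exact h2.symm
    rw [h2, map_sum]
    refine Submodule.sum_mem _ fun a _ => ?_
    rw [map_smul, ← algebraMap_smul K (b.repr ⟨v, hv⟩ a)]
    exact Submodule.smul_mem _ _ (Submodule.subset_span ⟨a, rfl⟩)
  have hfd : FiniteDimensional K V' := FiniteDimensional.span_of_finite K (Set.finite_range g)
  refine card_mul_le_of_vanishing (γ := γ) V' hr ((finrank_range_le_card g).trans ?_) ?_ ?_ I
    (fun i => -γ ^ ((i : ℕ) * t)) ?_ ?_
  · simpa using hV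
  · intro f hf
    have : V' ≤ degreeLE K (((m - 1) / e : ℕ) : WithBot ℕ) := by
      refine Submodule.span_le.2 ?_
      rintro _ ⟨a, rfl⟩
      exact mem_degreeLE.2 (natDegree_le_iff_degree_le.1 (natDegree_vecPoly_le _))
    exact natDegree_le_iff_degree_le.2 (mem_degreeLE.1 (this hf))
  · exact (hc.injOn he).mono fun n hn => lt_of_le_of_lt hn hm
  · rintro ⟨i, j⟩ ⟨-, hj⟩ ⟨i', j'⟩ ⟨-, hj'⟩ hij
    simp only at hj hj' hij
    rw [neg_mul, neg_mul, neg_inj, ← pow_add, ← pow_add] at hij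
    have hlt : ∀ (i : Fin k) (j : ℕ), j < t → (i : ℕ) * t + j < Nat.card F ^ e - 1 := by
      intro i j hj
      have : ((i : ℕ) + 1) * t ≤ k * t := Nat.mul_le_mul_right t i.2
      rw [add_mul] at this
      omega
    have h1 : (i : ℕ) * t + j = i' * t + j' := hc.injOn he (hlt i j hj) (hlt i' j' hj') hij
    have ht : 0 < t := by omega
    have h2 : (i : ℕ) = i' := by
      have := congrArg (· / t) h1
      simpa [mul_comm _ t, Nat.mul_add_div ht, Nat.div_eq_of_lt hj, Nat.div_eq_of_lt hj'] using this
    rw [h2] at h1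
    exact Prod.ext (Fin.ext h2) (by simpa using h1)
  · intro i hi
    obtain ⟨v, ⟨hvV, w, rfl⟩, hv0⟩ := Submodule.exists_mem_ne_zero_of_ne_bot (hI i hi)
    refine ⟨_, hVV' _ hvV, fun h0 => hv0 ?_, fun j hj => ?_⟩
    · exact vecPoly_injective he m (h0.trans (map_zero _).symm)
    · rw [vecPoly_designMap he hL, eval_mul, factorProd, eval_prod,
        Finset.prod_eq_zero (Finset.mem_range.2 hj), zero_mul]
      simp only [eval_add, eval_X, eval_C]
      rw [neg_mul, ← hγ, pow_add, neg_add_cancel]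

end Spaces

section Algorithm

open Ram

/-! The registers and arrays of the algorithm. Those with the numbers `0, …, 5` (registers) and
`0, 1` (arrays) hold the input, and register `0` and array `2` the output. -/

local notation "r_q" => (0 : ℕ)
local notation "r_k" => (1 : ℕ)
local notation "r_m" => (2 : ℕ)
local notation "r_rr" => (3 : ℕ)
local notation "r_D" => (4 : ℕ)
local notation "r_S" => (5 : ℕ)
local notation "r_km" => (6 : ℕ)
local notation "r_e" => (7 : ℕ)
local notation "r_card" => (8 : ℕ)
local notation "r_t" => (9 : ℕ)
local notation "r_L" => (10 : ℕ)
local notation "r_len" => (11 : ℕ)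
local notation "r_card2" => (12 : ℕ)
local notation "r_zero" => (13 : ℕ)
local notation "r_one" => (14 : ℕ)
local notation "r_found" => (15 : ℕ)
local notation "r_km1" => (16 : ℕ)
local notation "r_kr" => (17 : ℕ)
local notation "r_te" => (18 : ℕ)
local notation "r_c0" => (19 : ℕ)
local notation "r_u" => (20 : ℕ)
local notation "r_block" => (21 : ℕ)
local notation "r_base" => (22 : ℕ)
local notation "r_top" => (23 : ℕ)
local notation "r_prev" => (24 : ℕ)
local notation "r_cur" => (25 : ℕ)
local notation "r_l" => (26 : ℕ)
local notation "r_a" => (27 : ℕ)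
local notation "r_s" => (28 : ℕ)
local notation "r_n" => (29 : ℕ)
local notation "r_y" => (30 : ℕ)
local notation "r_quo" => (31 : ℕ)
local notation "r_rem" => (32 : ℕ)
local notation "r_diff" => (33 : ℕ)
local notation "r_j" => (34 : ℕ)
local notation "r_cand" => (35 : ℕ)
local notation "r_i" => (36 : ℕ)
local notation "r_col" => (37 : ℕ)
local notation "r_fac" => (38 : ℕ)
local notation "r_a0" => (39 : ℕ)
local notation "r_pos" => (40 : ℕ)
local notation "r_count" => (41 : ℕ)
local notation "a_add" => (0 : ℕ)
local notation "a_mul" => (1 : ℕ)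
local notation "a_out" => (2 : ℕ)
local notation "a_row" => (3 : ℕ)
local notation "a_c" => (4 : ℕ)
local notation "a_v" => (5 : ℕ)
local notation "a_w" => (6 : ℕ)
local notation "a_div" => (7 : ℕ)
local notation "a_mod" => (8 : ℕ)

/-! ### The shift register and multiplication by linear factors on the machine -/

/-- The number of the sum of two field elements. -/
def addE (A B : Expr) : Expr := .get a_add (.add (.get a_row A) B)

/-- The number of the product of two field elements. -/
def mulE (A B : Expr) : Expr := .get a_mul (.add (.get a_row A) B)

/-- An expression that vanishes if and only if `A` and `B` agree. -/
def neqE (A B : Expr) : Expr := .add (.sub A B) (.sub B A)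

@[simp] theorem neqE_eval_eq_zero (A B : Expr) (σ : State) :
    (neqE A B).eval σ = 0 ↔ A.eval σ = B.eval σ := by
  simp only [neqE, Expr.eval]
  omega

/-- The update of one entry in a step of the shift register. -/
def shiftEntry : Cmd :=
  .seq (.set r_cur (.get a_v (.var r_base))) <|
  .seq (.put a_v (.var r_base)
    (addE (.var r_prev) (mulE (.var r_top) (.get a_c (.var r_u))))) <|
  .seq (.set r_prev (.var r_cur)) <|
  .set r_base (.add (.var r_base) (.lit 1))

/-- A step of the shift register on the block that starts at `r_base`, with the feedback `r_top`
taken from the last entry. -/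
def shiftBlock : Cmd :=
  .seq (.set r_top (.get a_v (.sub (.add (.var r_base) (.var r_e)) (.lit 1)))) <|
  .seq (.set r_prev (.var r_zero)) <|
  .rep r_u r_e shiftEntry

theorem eval_ite_neqE (A B : Expr) (P P' : Cmd) (σ : State) :
    (Cmd.ite (neqE A B) P P').eval σ = if A.eval σ = B.eval σ then P'.eval σ else P.eval σ := by
  rw [Cmd.eval_ite, ← ite_not]
  exact if_congr (by rw [not_not, neqE_eval_eq_zero]) rfl rfl

/-- Multiplication of the polynomial in the array `a_v` by `Y`. -/
def yStep : Cmd :=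
  .seq (.set r_base (.lit 0)) <| .rep r_block r_m shiftBlock

/-- Storing the basis vector with number `l` in the array `a_v`. -/
def initUnit : Cmd :=
  .rep r_u r_len <|
    .ite (neqE (.var r_u) (.var r_l))
      (.put a_v (.var r_u) (.var r_zero))
      (.put a_v (.var r_u) (.var r_one))

/-- Multiplication of the polynomial in the array `a_v` by `X + Y ^ a`, where `a` is the content of
`r_a`. The array `a_w` keeps a copy, which is shifted by one block of `e` entries for the product
with `X`; the product with `Y ^ a` is computed in place. -/
def mulFactor : Cmd :=
  .seq (.rep r_u r_len (.put a_w (.var r_u) (.get a_v (.var r_u)))) <|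
  .seq (.rep r_s r_km (.ite (.sub (.var r_a) (.var r_s)) yStep .skip)) <|
  .rep r_u r_len <|
    .ite (.sub (.add (.var r_u) (.lit 1)) (.var r_e))
      (.put a_v (.var r_u) (addE (.get a_w (.sub (.var r_u) (.var r_e))) (.get a_v (.var r_u))))
      .skip

section

theorem opTable_apply {F : Type*} {q : ℕ} (ν : F ≃ Fin q) (op : F → F → F)
    (a b : F) :
    opTable ν op ((ν a : ℕ) * q + ν b) = ν (op a b) := by
  have ha := (ν a).2
  have hb := (ν b).2
  have h1 : ((ν a : ℕ) + 1) * q ≤ q * q := Nat.mul_le_mul_right q ha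
  rw [add_mul, one_mul] at h1
  rw [opTable, dif_pos (by omega)]
  have h2 : finProdFinEquiv.symm ⟨(ν a : ℕ) * q + ν b, by omega⟩ = (ν a, ν b) := by
    rw [Equiv.symm_apply_eq]
    ext
    simp [finProdFinEquiv]
    ring
  rw [h2]
  simp

variable {F : Type*} [Field F] {q : ℕ} (ν : F ≃ Fin q)

/-- The part of the memory that stays fixed once the parameters and tables are available: the array
`a_row` holds the offsets of the rows of the operation tables. -/
structure Ctx (m e : ℕ) (σ : State) : Prop where
  reg_q : σ.reg r_q = q
  reg_m : σ.reg r_m = m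
  reg_e : σ.reg r_e = e
  reg_len : σ.reg r_len = m * e
  reg_zero : σ.reg r_zero = ν 0
  reg_one : σ.reg r_one = ν 1
  arr_add : σ.arr a_add = opTable ν (· + ·)
  arr_mul : σ.arr a_mul = opTable ν (· * ·)
  arr_row : ∀ a < q, σ.arr a_row a = a * q

/-- The array `a_c` holds the coefficients of the recurrence. -/
def HasCoeffs (c : ℕ → F) (e : ℕ) (σ : State) : Prop :=
  ∀ u < e, σ.arr a_c u = ν (c u)

/-- The array `a_v` holds the coordinates of the first `m` coefficients of the polynomial. -/
def Stores {c : ℕ → F} {e : ℕ} (m : ℕ) (f : (AdjoinRoot (recPoly c e))[X]) (σ : State) : Prop :=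
  ∀ b < m, ∀ u < e, σ.arr a_v (b * e + u) = ν (coord c e u (f.coeff b))

variable {ν}

theorem Ctx.of_agree {m e : ℕ} {σ τ : State} (h : Ctx ν m e σ)
    (hr : ∀ x ∈ [r_q, r_m, r_e, r_len, r_zero, r_one], τ.reg x = σ.reg x)
    (ha : ∀ a ∈ [a_add, a_mul, a_row], τ.arr a = σ.arr a) : Ctx ν m e τ where
  reg_q := (hr _ (by simp)).trans h.reg_q
  reg_m := (hr _ (by simp)).trans h.reg_m
  reg_e := (hr _ (by simp)).trans h.reg_e
  reg_len := (hr _ (by simp)).trans h.reg_len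
  reg_zero := (hr _ (by simp)).trans h.reg_zero
  reg_one := (hr _ (by simp)).trans h.reg_one
  arr_add := (ha _ (by simp)).trans h.arr_add
  arr_mul := (ha _ (by simp)).trans h.arr_mul
  arr_row := fun a haq => by
    rw [ha _ (by simp)]
    exact h.arr_row a haq

/-- The registers and arrays of the fixed part of the memory are not written by `P`. -/
def KeepsCtx (P : Cmd) : Prop :=
  (∀ x ∈ [r_q, r_m, r_e, r_len, r_zero, r_one], x ∉ P.writes) ∧
    ∀ a ∈ [a_add, a_mul, a_row], a ∉ P.arrWrites

instance (P : Cmd) : Decidable (KeepsCtx P) := inferInstanceAs (Decidable (_ ∧ _))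

theorem Ctx.of_frame {m e : ℕ} {σ τ : State} {P : Cmd} (h : Ctx ν m e σ)
    (hr : ∀ y, y ∉ P.writes → τ.reg y = σ.reg y) (ha : ∀ a, a ∉ P.arrWrites → τ.arr a = σ.arr a)
    (hP : KeepsCtx P) : Ctx ν m e τ :=
  h.of_agree (fun x hx => hr x (hP.1 x hx)) fun a haa => ha a (hP.2 a haa)

theorem Ctx.eval {m e : ℕ} {σ : State} (h : Ctx ν m e σ) (P : Cmd) (hP : KeepsCtx P) :
    Ctx ν m e (P.eval σ) :=
  h.of_frame (fun _ hy => Cmd.eval_reg P hy σ) (fun _ ha => Cmd.eval_arr P ha σ) hP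

theorem Ctx.add_get {m e : ℕ} {σ : State} (h : Ctx ν m e σ) (a b : F) :
    σ.arr a_add (σ.arr a_row (ν a) + ν b) = ν (a + b) := by
  rw [h.arr_row _ (ν a).2, h.arr_add, opTable_apply]

theorem Ctx.mul_get {m e : ℕ} {σ : State} (h : Ctx ν m e σ) (a b : F) :
    σ.arr a_mul (σ.arr a_row (ν a) + ν b) = ν (a * b) := by
  rw [h.arr_row _ (ν a).2, h.arr_mul, opTable_apply]

theorem block_eq_iff {e b b' u u' : ℕ} (hu : u < e) (hu' : u' < e) :
    b * e + u = b' * e + u' ↔ b = b' ∧ u = u' := by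
  refine ⟨fun h => ?_, by rintro ⟨rfl, rfl⟩; rfl⟩
  have h1 := div_eq_of_lt_of_eq hu rfl (b := b)
  have h2 := div_eq_of_lt_of_eq hu' h
  exact ⟨h1.1.symm.trans h2.1, h1.2.symm.trans h2.2⟩

theorem stores_yStep {c : ℕ → F} {m e : ℕ} {σ : State} (hσ : Ctx ν m e σ)
    (hc : HasCoeffs ν c e σ) {f : (AdjoinRoot (recPoly c e))[X]} (hf : Stores ν m f σ) :
    Stores ν m (C (AdjoinRoot.root (recPoly c e)) * f) (yStep.eval σ) := by
  -- the entries below position `n` have been updated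
  let J : ℕ → State → Prop := fun n τ => ∀ b < m, ∀ u < e, τ.arr a_v (b * e + u) =
    ν (if b * e + u < n then coord c e u (AdjoinRoot.root (recPoly c e) * f.coeff b)
      else coord c e u (f.coeff b))
  have houter := Cmd.eval_rep_induction (x := r_block) (n := r_m) (σ := σ.setReg r_base 0)
    (I := fun b τ => τ.reg r_base = b * e ∧ J (b * e) τ)
    (P := shiftBlock) ?_ ?_
  · simp only [State.setReg_reg, show r_m ≠ r_base by decide, if_false, hσ.reg_m] at houter
    intro b hb u hu
    have h1 := houter.2 b hb u hu
    have h2 : b * e + u < m * e := by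
      have := Nat.mul_le_mul_right e hb
      rw [Nat.succ_mul] at this
      omega
    rw [if_pos h2] at h1
    rw [coeff_C_mul]
    exact h1
  · refine ⟨by simp, fun b hb u hu => ?_⟩
    simp [hf b hb u hu]
  · rintro b hb τ hτb hfr hfa ⟨hbase, hJ⟩
    rw [State.setReg_reg, if_neg (by decide), hσ.reg_m] at hb
    have hτ : Ctx ν m e τ := (hσ.eval (.set r_base (.lit 0)) (by decide)).of_frame hfr hfa
      (by decide)
    have hcτ : HasCoeffs ν c e τ := fun u hu => by
      rw [hfa a_c (by decide)]
      exact hc u hu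
    rcases Nat.eq_zero_or_pos e with rfl | he
    · refine ⟨?_, fun b hb u hu => absurd hu (by omega)⟩
      simp [shiftBlock, Cmd.eval, hτ.reg_e, hbase]
    have htop : τ.arr a_v (b * e + e - 1) = ν (coord c e (e - 1) (f.coeff b)) := by
      rw [Nat.add_sub_assoc he, hJ b hb (e - 1) (by omega), if_neg (by omega)]
    have hinner := Cmd.eval_rep_induction (x := r_u) (n := r_e)
      (σ := (τ.setReg r_top (ν (coord c e (e - 1) (f.coeff b)))).setReg r_prev (ν (0 : F)))
      (I := fun u τ => τ.reg r_base = b * e + u ∧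
        τ.reg r_prev = ν (if u = 0 then 0 else coord c e (u - 1) (f.coeff b)) ∧ J (b * e + u) τ)
      (P := shiftEntry) ?_ ?_
    · simp only [State.setReg_reg, show r_e ≠ r_prev by decide, show r_e ≠ r_top by decide,
        if_false, hτ.reg_e] at hinner
      simp only [shiftBlock, Cmd.eval_seq, Cmd.eval_set, Expr.eval, hbase, hτ.reg_e, htop,
        State.setReg_reg, show r_zero ≠ r_top by decide, if_false, hτ.reg_zero]
      have h1 : (b + 1) * e = b * e + e := by ring
      rw [h1]
      refine ⟨?_, fun b hb u hu => ?_⟩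
      · simpa using hinner.1
      · simpa using hinner.2.2 b hb u hu
    · exact ⟨by simp [hbase], by simp, fun b hb u hu => by simpa using hJ b hb u hu⟩
    · rintro u hu ρ hρu hfr' hfa' ⟨hbase', hprev, hJ'⟩
      simp only [State.setReg_reg, show r_e ≠ r_prev by decide, show r_e ≠ r_top by decide,
        if_false, hτ.reg_e] at hu
      have hρ : Ctx ν m e ρ := (hτ.eval (.seq (.set r_top (.lit _)) (.set r_prev (.lit _)))
        ⟨by simp [Cmd.writes], by simp [Cmd.arrWrites]⟩).of_frame hfr' hfa' (by decide)
      have hcρ : ρ.arr a_c u = ν (c u) := by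
        rw [hfa' a_c (by decide)]
        exact hcτ u hu
      have htopρ : ρ.reg r_top = ν (coord c e (e - 1) (f.coeff b)) := by
        rw [hfr' r_top (by decide)]
        simp
      have hcur : ρ.arr a_v (b * e + u) = ν (coord c e u (f.coeff b)) := by
        rw [hJ' b hb u hu, if_neg (by omega)]
      refine ⟨?_, ?_, fun b' hb' u' hu' => ?_⟩
      · simp [shiftEntry, hbase', add_assoc]
      · simp [shiftEntry, hbase', hcur]
      · simp only [shiftEntry, Cmd.eval_seq, Cmd.eval_set, Cmd.eval_put, addE, mulE, Expr.eval,
          State.setReg_reg, State.setReg_arr, State.setArr_arr, State.setArr_reg]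
        simp only [hbase', htopρ, hρu, hcρ, hprev, hρ.add_get, hρ.mul_get, reduceIte,
          Nat.reduceEqDiff, ← coord_root_mul c hu]
        rw [Function.update_apply]
        by_cases heq : b' * e + u' = b * e + u
        · obtain ⟨rfl, rfl⟩ := (block_eq_iff hu' hu).1 heq
          simp
        · rw [if_neg heq, hJ' b' hb' u' hu']
          have : b' * e + u' < b * e + (u + 1) ↔ b' * e + u' < b * e + u := by omega
          simp only [this]

theorem stores_initUnit (c : ℕ → F) {m e : ℕ} {σ : State} (hσ : Ctx ν m e σ) :
    Stores ν m (monomial (σ.reg r_l / e) (AdjoinRoot.root (recPoly c e) ^ (σ.reg r_l % e)))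
      (initUnit.eval σ) := by
  have h := Cmd.eval_rep_induction (x := r_u) (n := r_len) (σ := σ)
    (I := fun n τ => ∀ j < n, τ.arr a_v j = ν (if j = σ.reg r_l then 1 else 0))
    (P := .ite (neqE (.var r_u) (.var r_l)) (.put a_v (.var r_u) (.var r_zero))
      (.put a_v (.var r_u) (.var r_one))) (fun j hj => absurd hj (by omega)) ?_
  · intro b hb u hu
    have h2 : b * e + u < m * e := by
      have := Nat.mul_le_mul_right e hb
      rw [Nat.succ_mul] at this
      omega
    rw [coord_coeff_monomial hu]
    rw [hσ.reg_len] at h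
    exact h _ h2
  · intro i _ τ hτi hfr hfa ih j hj
    have h1 : τ.reg r_l = σ.reg r_l := hfr r_l (by decide)
    have h2 : τ.reg r_zero = ν 0 := (hfr r_zero (by decide)).trans hσ.reg_zero
    have h3 : τ.reg r_one = ν 1 := (hfr r_one (by decide)).trans hσ.reg_one
    by_cases hil : i = σ.reg r_l
    · simp only [eval_ite_neqE, Expr.eval, hτi, h1, hil, Cmd.eval_put, h3,
        State.setReg_arr, State.setArr_arr, if_true, Function.update_apply]
      by_cases hj' : j = σ.reg r_l
      · simp [hj']
      · rw [if_neg hj', ih j (by omega)]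
    · simp only [eval_ite_neqE, Expr.eval, hτi, h1, hil, if_false, Cmd.eval_put, h2,
        State.setReg_arr, State.setArr_arr, if_true, Function.update_apply]
      by_cases hj' : j = i
      · simp [hj', hil]
      · rw [if_neg hj', ih j (by omega)]

theorem stores_mulFactor {c : ℕ → F} {m e : ℕ} {σ : State} (hσ : Ctx ν m e σ)
    (hc : HasCoeffs ν c e σ) (ha : σ.reg r_a ≤ σ.reg r_km)
    {f : (AdjoinRoot (recPoly c e))[X]} (hf : Stores ν m f σ) :
    Stores ν m ((X + C (AdjoinRoot.root (recPoly c e) ^ σ.reg r_a)) * f) (mulFactor.eval σ) := by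
  set γ := AdjoinRoot.root (recPoly c e) with hγ
  have hlt : ∀ b < m, ∀ u < e, b * e + u < m * e := by
    intro b hb u hu
    have := Nat.mul_le_mul_right e hb
    rw [Nat.succ_mul] at this
    omega
  -- the copy
  set P1 : Cmd := .rep r_u r_len (.put a_w (.var r_u) (.get a_v (.var r_u))) with hP1
  set P2 : Cmd := .rep r_s r_km (.ite (.sub (.var r_a) (.var r_s)) yStep .skip) with hP2
  set σ1 := P1.eval σ with hσ1
  have hctx1 : Ctx ν m e σ1 := hσ.eval P1 (by decide)
  have hc1 : HasCoeffs ν c e σ1 := fun u hu => by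
    rw [hσ1, Cmd.eval_arr P1 (by decide)]
    exact hc u hu
  have hf1 : Stores ν m f σ1 := fun b hb u hu => by
    rw [hσ1, Cmd.eval_arr P1 (by decide)]
    exact hf b hb u hu
  have ha1 : σ1.reg r_a = σ.reg r_a := Cmd.eval_reg P1 (by decide) σ
  have hw1 : ∀ b < m, ∀ u < e, σ1.arr a_w (b * e + u) = ν (coord c e u (f.coeff b)) := by
    have h := Cmd.eval_rep_induction (x := r_u) (n := r_len) (σ := σ)
      (I := fun n τ => ∀ j < n, τ.arr a_w j = σ.arr a_v j)
      (P := .put a_w (.var r_u) (.get a_v (.var r_u))) (fun j hj => absurd hj (by omega)) ?_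
    · intro b hb u hu
      rw [hσ.reg_len] at h
      rw [h _ (hlt b hb u hu)]
      exact hf b hb u hu
    · intro i _ τ hτi hfr hfa ih j hj
      simp only [Cmd.eval_put, Expr.eval, State.setReg_arr, State.setArr_arr, if_true, hτi,
        Function.update_apply, hfa a_v (by decide)]
      by_cases hj' : j = i
      · simp [hj']
      · rw [if_neg hj', ih j (by omega)]
  -- the product with `γ ^ a`
  set σ2 := P2.eval σ1 with hσ2
  have hctx2 : Ctx ν m e σ2 := hctx1.eval P2 (by decide)
  have hf2 : Stores ν m (C (γ ^ σ.reg r_a) * f) σ2 := by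
    have h := Cmd.eval_rep_induction (x := r_s) (n := r_km) (σ := σ1)
      (I := fun n τ => Stores ν m (C (γ ^ min n (σ.reg r_a)) * f) τ)
      (P := .ite (.sub (.var r_a) (.var r_s)) yStep .skip) ?_ ?_
    · rwa [Cmd.eval_reg P1 (by decide) σ, min_eq_right ha] at h
    · intro b hb u hu
      simpa using hf1 b hb u hu
    · intro i _ τ hτi hfr hfa ih b hb u hu
      have hτa : τ.reg r_a = σ.reg r_a := (hfr r_a (by decide)).trans ha1
      simp only [State.setReg_arr, Cmd.eval_ite, Expr.eval, hτa, hτi]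
      by_cases hi : i < σ.reg r_a
      · rw [if_pos (by omega)]
        have h1 := stores_yStep (hctx1.of_frame hfr hfa (by decide)) (fun u hu => by
          rw [hfa a_c (by decide)]
          exact hc1 u hu) ih b hb u hu
        rw [h1, min_eq_left (by omega), min_eq_left (by omega), ← mul_assoc, ← C_mul, ← pow_succ']
      · rw [if_neg (by omega), Cmd.eval_skip, ih b hb u hu, min_eq_right (by omega),
          min_eq_right (by omega)]
  have hw2 : ∀ b < m, ∀ u < e, σ2.arr a_w (b * e + u) = ν (coord c e u (f.coeff b)) := by
    intro b hb u hu
    rw [hσ2, Cmd.eval_arr P2 (by decide)]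
    exact hw1 b hb u hu
  -- the addition of the shifted copy
  have h := Cmd.eval_rep_induction (x := r_u) (n := r_len) (σ := σ2)
    (I := fun n τ => ∀ b < m, ∀ u < e, τ.arr a_v (b * e + u) =
      ν (coord c e u ((if b * e + u < n then (X + C (γ ^ σ.reg r_a)) * f
        else C (γ ^ σ.reg r_a) * f).coeff b)))
    (P := .ite (.sub (.add (.var r_u) (.lit 1)) (.var r_e))
      (.put a_v (.var r_u) (addE (.get a_w (.sub (.var r_u) (.var r_e))) (.get a_v (.var r_u))))
      .skip) ?_ ?_
  · rw [hctx2.reg_len] at h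
    intro b hb u hu
    have h1 := h b hb u hu
    rwa [if_pos (hlt b hb u hu)] at h1
  · intro b hb u hu
    simpa using hf2 b hb u hu
  · intro i hi τ hτi hfr hfa ih b hb u hu
    have hτ : Ctx ν m e τ := hctx2.of_frame hfr hfa (by decide)
    have hstep : b * e + u ≠ i → ∀ g g' : (AdjoinRoot (recPoly c e))[X],
        (if b * e + u < i + 1 then g else g') = if b * e + u < i then g else g' := by
      intro h g g'
      refine if_congr ?_ rfl rfl
      omega
    simp only [State.setReg_arr, Cmd.eval_ite, Expr.eval, hτi, hτ.reg_e]
    by_cases hie : e ≤ i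
    · rw [if_pos (by omega)]
      simp only [Cmd.eval_put, addE, Expr.eval, State.setArr_arr, if_true, Function.update_apply,
        hτi, hτ.reg_e]
      by_cases heq : b * e + u = i
      · obtain ⟨b, rfl⟩ : ∃ b', b = b' + 1 := Nat.exists_eq_succ_of_ne_zero (by
          rintro rfl
          omega)
        have h1 : i - e = b * e + u := by
          rw [Nat.succ_mul] at heq
          omega
        have h2 : τ.arr a_w (b * e + u) = ν (coord c e u (f.coeff b)) := by
          rw [hfa a_w (by decide)]
          exact hw2 b (by omega) u hu
        have h3 := ih (b + 1) hb u hu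
        rw [if_neg (by omega), heq] at h3
        rw [if_pos heq, if_pos (by omega), h1, h2, h3, hτ.add_get, ← map_add, add_mul, coeff_add,
          coeff_X_mul]
      · rw [if_neg heq, ih b hb u hu, hstep heq]
    · rw [if_neg (by omega), Cmd.eval_skip, ih b hb u hu]
      by_cases heq : b * e + u = i
      · obtain rfl : b = 0 := by
          by_contra hb0
          have := Nat.le_mul_of_pos_left e (Nat.pos_of_ne_zero hb0)
          omega
        rw [if_neg (by omega), if_pos (by omega), add_mul, coeff_add, coeff_X_mul_zero, zero_add]
      · rw [hstep heq]

end

/-! ### Tables, and the search for a primitive recurrence -/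

/-- Filling the array of row offsets. -/
def buildRows : Cmd :=
  .seq (.set r_y (.lit 0)) <|
  .rep r_n r_q <|
    .seq (.put a_row (.var r_n) (.var r_y)) (.set r_y (.add (.var r_y) (.var r_q)))

/-- Tabulating quotients and remainders modulo `q`. -/
def buildDivMod : Cmd :=
  .seq (.set r_quo (.lit 0)) <|
  .seq (.set r_rem (.lit 0)) <|
  .rep r_n r_card <|
    .seq (.put a_div (.var r_n) (.var r_quo)) <|
    .seq (.put a_mod (.var r_n) (.var r_rem)) <|
    .seq (.set r_rem (.add (.var r_rem) (.lit 1))) <|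
    .ite (.sub (.var r_q) (.var r_rem)) .skip <|
    .seq (.set r_rem (.lit 0)) (.set r_quo (.add (.var r_quo) (.lit 1)))

/-- Finding the number of `0`, as the solution of `x + x = x`. -/
def findZero : Cmd :=
  .rep r_n r_q <|
    .ite (neqE (addE (.var r_n) (.var r_n)) (.var r_n)) .skip (.set r_zero (.var r_n))

/-- Finding the number of `1`, as the nonzero solution of `x * x = x`. -/
def findOne : Cmd :=
  .rep r_n r_q <|
    .ite (neqE (mulE (.var r_n) (.var r_n)) (.var r_n)) .skip <|
    .ite (neqE (.var r_n) (.var r_zero)) (.set r_one (.var r_n)) .skip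

/-- All the tables. -/
def buildTables : Cmd := .seq buildRows (.seq buildDivMod (.seq findZero findOne))

/-- Comparing the polynomial in the array `a_v` with `1`. -/
def compareOne : Cmd :=
  .seq (.set r_diff (.lit 0)) <|
  .rep r_j r_len <|
    .ite (.var r_j)
      (.set r_diff (.add (.var r_diff) (neqE (.get a_v (.var r_j)) (.var r_zero))))
      (.set r_diff (.add (.var r_diff) (neqE (.get a_v (.var r_j)) (.var r_one))))

/-- One more power of `Y` in the test whether the recurrence is primitive. -/
def testPower : Cmd :=
  .seq yStep (.seq compareOne (.ite (.var r_diff) .skip (.set r_found (.lit 0))))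

/-- The test whether the recurrence in the array `a_c` is primitive. The powers `Y ^ i` are compared
with `1` for `1 ≤ i ≤ q ^ e - 2`. -/
def testCoeffs : Cmd :=
  .seq (.set r_l (.lit 0)) <|
  .seq initUnit <|
  .seq (.ite (neqE (.get a_c (.lit 0)) (.var r_zero)) (.set r_found (.lit 1))
    (.set r_found (.lit 0))) <|
  .rep r_n r_card2 testPower

/-- Storing the base `q` digits of `r_y` as the coefficients of the recurrence. -/
def decodeDigits : Cmd :=
  .rep r_u r_e <|
    .seq (.put a_c (.var r_u) (.get a_mod (.var r_y))) (.set r_y (.get a_div (.var r_y)))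

/-- Testing the next recurrence, unless a primitive one has been found. -/
def searchStep : Cmd :=
  .ite (.var r_found) .skip <|
    .seq (.set r_y (.var r_cand)) <| .seq decodeDigits testCoeffs

section

variable {F : Type*} [Field F] {q : ℕ} {ν : F ≃ Fin q}

theorem row_buildRows {σ : State} (hq : σ.reg r_q = q) :
    ∀ a < q, (buildRows.eval σ).arr a_row a = a * q := by
  have h := Cmd.eval_rep_induction (x := r_n) (n := r_q) (σ := σ.setReg r_y 0)
    (I := fun n τ => τ.reg r_y = n * q ∧ ∀ a < n, τ.arr a_row a = a * q)
    (P := .seq (.put a_row (.var r_n) (.var r_y)) (.set r_y (.add (.var r_y) (.var r_q))))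
    ⟨by simp, fun a ha => absurd ha (by omega)⟩ ?_
  · simp only [State.setReg_reg, show r_q ≠ r_y by decide, if_false, hq] at h
    exact h.2
  · rintro i hi τ hτi hfr hfa ⟨hy, ih⟩
    have h1 : τ.reg r_q = q := by
      rw [hfr r_q (by decide)]
      simpa using hq
    refine ⟨?_, fun a ha => ?_⟩
    · simp [hy, h1, add_mul]
    · simp only [Cmd.eval_seq, Cmd.eval_set, Cmd.eval_put, Expr.eval, State.setReg_arr,
        State.setArr_arr, if_true, hτi, hy, Function.update_apply]
      by_cases hai : a = i
      · simp [hai]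
      · rw [if_neg hai, ih a (by omega)]

theorem divMod_buildDivMod {σ : State} (hq : σ.reg r_q = q) (hq0 : 0 < q) :
    ∀ n < σ.reg r_card, (buildDivMod.eval σ).arr a_div n = n / q ∧
      (buildDivMod.eval σ).arr a_mod n = n % q := by
  have h := Cmd.eval_rep_induction (x := r_n) (n := r_card)
    (σ := (σ.setReg r_quo 0).setReg r_rem 0)
    (I := fun n τ => (τ.reg r_quo = n / q ∧ τ.reg r_rem = n % q) ∧
      ∀ a < n, τ.arr a_div a = a / q ∧ τ.arr a_mod a = a % q)
    (P := .seq (.put a_div (.var r_n) (.var r_quo)) <|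
      .seq (.put a_mod (.var r_n) (.var r_rem)) <|
      .seq (.set r_rem (.add (.var r_rem) (.lit 1))) <|
      .ite (.sub (.var r_q) (.var r_rem)) .skip <|
      .seq (.set r_rem (.lit 0)) (.set r_quo (.add (.var r_quo) (.lit 1))))
    ⟨by simp, fun a ha => absurd ha (by omega)⟩ ?_
  · simp only [State.setReg_reg, show r_card ≠ r_rem by decide, show r_card ≠ r_quo by decide,
      if_false] at h
    exact h.2
  · rintro i hi τ hτi hfr hfa ⟨⟨hquo, hrem⟩, ih⟩
    have h1 : τ.reg r_q = q := by
      rw [hfr r_q (by decide)]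
      simpa using hq
    have hlt := Nat.mod_lt i hq0
    have hda := Nat.div_add_mod i q
    have harr : ∀ a < i + 1, Function.update (τ.arr a_div) i (i / q) a = a / q ∧
        Function.update (τ.arr a_mod) i (i % q) a = a % q := by
      intro a ha
      simp only [Function.update_apply]
      by_cases hai : a = i
      · simp [hai]
      · rw [if_neg hai, if_neg hai]
        exact ih a (by omega)
    by_cases hc : i % q + 1 < q
    · have h2 : (i + 1) / q = i / q ∧ (i + 1) % q = i % q + 1 :=
        div_eq_of_lt_of_eq hc (by rw [mul_comm]; omega)
      refine ⟨?_, fun a ha => ?_⟩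
      · simp [hτi, hquo, hrem, h1, h2, show q - (i % q + 1) ≠ 0 by omega]
      · simpa [hτi, hquo, hrem, h1, show q - (i % q + 1) ≠ 0 by omega] using harr a ha
    · have h2 : (i + 1) / q = i / q + 1 ∧ (i + 1) % q = 0 :=
        div_eq_of_lt_of_eq hq0 (by rw [add_mul, mul_comm (i / q)]; omega)
      refine ⟨?_, fun a ha => ?_⟩
      · simp [hτi, hquo, hrem, h1, h2, show q - (i % q + 1) = 0 by omega]
      · simpa [hτi, hquo, hrem, h1, show q - (i % q + 1) = 0 by omega] using harr a ha

theorem zero_findZero {σ : State} (hq : σ.reg r_q = q)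
    (hadd : σ.arr a_add = opTable ν (· + ·)) (hrow : ∀ a < q, σ.arr a_row a = a * q) :
    (findZero.eval σ).reg r_zero = ν 0 := by
  classical
  have h := Cmd.eval_rep_induction (x := r_n) (n := r_q) (σ := σ)
    (I := fun n τ => (ν 0 : ℕ) < n → τ.reg r_zero = ν 0)
    (P := .ite (neqE (addE (.var r_n) (.var r_n)) (.var r_n)) .skip (.set r_zero (.var r_n)))
    (fun h => absurd h (by omega)) ?_
  · rw [hq] at h
    exact h (ν 0).2
  · intro i hi τ hτi hfr hfa ih h0
    rw [hq] at hi
    obtain ⟨a, rfl⟩ : ∃ a, i = ν a := ⟨ν.symm ⟨i, hi⟩, by simp⟩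
    have h1 : τ.arr a_add (τ.arr a_row (ν a) + ν a) = ν (a + a) := by
      rw [hfa a_add (by decide), hfa a_row (by decide), hrow _ hi, hadd, opTable_apply]
    have h2 : (ν (a + a) : ℕ) = ν a ↔ a = 0 := by
      rw [Fin.val_inj, ν.injective.eq_iff, add_eq_left]
    have h3 : (addE (.var r_n) (.var r_n)).eval τ = (Expr.var r_n).eval τ ↔ a = 0 := by
      simp only [addE, Expr.eval, hτi, h1, h2]
    rw [eval_ite_neqE, if_congr h3 rfl rfl]
    simp only [Cmd.eval_set, Cmd.eval_skip, Expr.eval, hτi]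
    by_cases ha : a = 0
    · simp [ha]
    · rw [if_neg ha, State.setReg_reg, if_neg (by decide)]
      refine ih ?_
      have : (ν 0 : ℕ) ≠ ν a := by
        rw [Ne, Fin.val_inj, ν.injective.eq_iff]
        exact fun h => ha h.symm
      omega

theorem one_findOne {σ : State} (hq : σ.reg r_q = q)
    (hmul : σ.arr a_mul = opTable ν (· * ·)) (hrow : ∀ a < q, σ.arr a_row a = a * q)
    (hzero : σ.reg r_zero = ν 0) : (findOne.eval σ).reg r_one = ν 1 := by
  classical
  have h := Cmd.eval_rep_induction (x := r_n) (n := r_q) (σ := σ)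
    (I := fun n τ => (ν 1 : ℕ) < n → τ.reg r_one = ν 1)
    (P := .ite (neqE (mulE (.var r_n) (.var r_n)) (.var r_n)) .skip <|
      .ite (neqE (.var r_n) (.var r_zero)) (.set r_one (.var r_n)) .skip)
    (fun h => absurd h (by omega)) ?_
  · rw [hq] at h
    exact h (ν 1).2
  · intro i hi τ hτi hfr hfa ih h0
    rw [hq] at hi
    obtain ⟨a, rfl⟩ : ∃ a, i = ν a := ⟨ν.symm ⟨i, hi⟩, by simp⟩
    have h1 : τ.arr a_mul (τ.arr a_row (ν a) + ν a) = ν (a * a) := by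
      rw [hfa a_mul (by decide), hfa a_row (by decide), hrow _ hi, hmul, opTable_apply]
    have h2 : (ν (a * a) : ℕ) = ν a ↔ a * a = a := by rw [Fin.val_inj, ν.injective.eq_iff]
    have h3 : (ν a : ℕ) = ν 0 ↔ a = 0 := by rw [Fin.val_inj, ν.injective.eq_iff]
    have h4 : τ.reg r_zero = ν 0 := (hfr r_zero (by decide)).trans hzero
    have h5 : (mulE (.var r_n) (.var r_n)).eval τ = (Expr.var r_n).eval τ ↔ a * a = a := by
      simp only [mulE, Expr.eval, hτi, h1, h2]
    have h6 : (Expr.var r_n).eval τ = (Expr.var r_zero).eval τ ↔ a = 0 := by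
      simp only [Expr.eval, hτi, h3, h4]
    rw [eval_ite_neqE, eval_ite_neqE, if_congr h5 rfl rfl, if_congr h6 rfl rfl]
    simp only [Cmd.eval_set, Cmd.eval_skip, Expr.eval, hτi]
    by_cases ha : a = 1
    · simp [ha]
    · have h7 : ∀ ρ : State, ρ = τ → (ρ.setReg r_n ((ν a : ℕ) + 1)).reg r_one = ν 1 := by
        rintro ρ rfl
        rw [State.setReg_reg, if_neg (by decide)]
        refine ih ?_
        have : (ν 1 : ℕ) ≠ ν a := by
          rw [Ne, Fin.val_inj, ν.injective.eq_iff]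
          exact fun h => ha h.symm
        omega
      refine h7 _ ?_
      by_cases ha0 : a = 0
      · simp [ha0]
      · have : a * a ≠ a := by
          rw [Ne, mul_eq_left₀ ha0]
          exact ha
        simp [this]

theorem ctx_buildTables {m e : ℕ} {σ : State} (hq : σ.reg r_q = q) (hm : σ.reg r_m = m)
    (he : σ.reg r_e = e) (hlen : σ.reg r_len = m * e)
    (hadd : σ.arr a_add = opTable ν (· + ·)) (hmul : σ.arr a_mul = opTable ν (· * ·)) :
    Ctx ν m e (buildTables.eval σ) ∧ ∀ n < σ.reg r_card,
      (buildTables.eval σ).arr a_div n = n / q ∧ (buildTables.eval σ).arr a_mod n = n % q := by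
  have hq0 : 0 < q := Fin.pos (ν 0)
  have hreg : ∀ x, x ∉ buildTables.writes → (buildTables.eval σ).reg x = σ.reg x :=
    fun x hx => Cmd.eval_reg _ hx σ
  have harr : ∀ a, a ∉ buildTables.arrWrites → (buildTables.eval σ).arr a = σ.arr a :=
    fun a ha => Cmd.eval_arr _ ha σ
  set σ1 := buildRows.eval σ with hσ1
  set σ2 := buildDivMod.eval σ1 with hσ2
  set σ3 := findZero.eval σ2 with hσ3
  have h4 : buildTables.eval σ = findOne.eval σ3 := rfl
  have q1 : σ1.reg r_q = q := (Cmd.eval_reg buildRows (by decide) σ).trans hq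
  have q2 : σ2.reg r_q = q := (Cmd.eval_reg buildDivMod (by decide) σ1).trans q1
  have q3 : σ3.reg r_q = q := (Cmd.eval_reg findZero (by decide) σ2).trans q2
  have card1 : σ1.reg r_card = σ.reg r_card := Cmd.eval_reg buildRows (by decide) σ
  have row1 := row_buildRows hq
  have row2 : ∀ a < q, σ2.arr a_row a = a * q := fun a ha => by
    rw [hσ2, Cmd.eval_arr buildDivMod (by decide)]
    exact row1 a ha
  have row3 : ∀ a < q, σ3.arr a_row a = a * q := fun a ha => by
    rw [hσ3, Cmd.eval_arr findZero (by decide)]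
    exact row2 a ha
  have row4 : ∀ a < q, (findOne.eval σ3).arr a_row a = a * q := fun a ha => by
    rw [Cmd.eval_arr findOne (by decide)]
    exact row3 a ha
  have add2 : σ2.arr a_add = opTable ν (· + ·) := by
    rw [hσ2, Cmd.eval_arr buildDivMod (by decide), hσ1, Cmd.eval_arr buildRows (by decide), hadd]
  have mul3 : σ3.arr a_mul = opTable ν (· * ·) := by
    rw [hσ3, Cmd.eval_arr findZero (by decide), hσ2, Cmd.eval_arr buildDivMod (by decide), hσ1,
      Cmd.eval_arr buildRows (by decide), hmul]
  have zero3 : σ3.reg r_zero = ν 0 := zero_findZero q2 add2 row2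
  have one4 : (findOne.eval σ3).reg r_one = ν 1 := one_findOne q3 mul3 row3 zero3
  have zero4 : (findOne.eval σ3).reg r_zero = ν 0 :=
    (Cmd.eval_reg findOne (by decide) σ3).trans zero3
  refine ⟨⟨(hreg _ (by decide)).trans hq, (hreg _ (by decide)).trans hm,
    (hreg _ (by decide)).trans he, (hreg _ (by decide)).trans hlen, zero4, one4,
    (harr _ (by decide)).trans hadd, (harr _ (by decide)).trans hmul, row4⟩, ?_⟩
  rw [← card1, h4, Cmd.eval_arr findOne (by decide), Cmd.eval_arr findOne (by decide), hσ3,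
    Cmd.eval_arr findZero (by decide), Cmd.eval_arr findZero (by decide)]
  exact divMod_buildDivMod q1 hq0

theorem diff_compareOne {c : ℕ → F} {m e : ℕ} (hm : 0 < m) {σ : State} (hσ : Ctx ν m e σ)
    {z : AdjoinRoot (recPoly c e)} (hz : Stores ν m (C z) σ) :
    (compareOne.eval σ).reg r_diff = 0 ↔ z = 1 := by
  have h := Cmd.eval_rep_induction (x := r_j) (n := r_len) (σ := σ.setReg r_diff 0)
    (I := fun n τ => τ.reg r_diff = 0 ↔ ∀ j < n, σ.arr a_v j = ν (if j = 0 then 1 else 0))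
    (P := .ite (.var r_j)
      (.set r_diff (.add (.var r_diff) (neqE (.get a_v (.var r_j)) (.var r_zero))))
      (.set r_diff (.add (.var r_diff) (neqE (.get a_v (.var r_j)) (.var r_one)))))
    (by simp) ?_
  · rw [State.setReg_reg, if_neg (by decide), hσ.reg_len] at h
    refine h.trans ⟨fun h1 => coord_ext fun u hu => ?_, ?_⟩
    · have h2 : u < m * e := hu.trans_le (Nat.le_mul_of_pos_left e hm)
      have h3 := hz 0 hm u hu
      rw [zero_mul, zero_add, h1 u h2, Fin.val_inj, ν.injective.eq_iff, coeff_C_zero] at h3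
      rw [← h3]
      have h4 := coord_root_pow c (e := e) (u := 0) u (by omega)
      rw [pow_zero] at h4
      exact h4.symm
    · rintro rfl j hj
      have he : 0 < e := by
        rcases Nat.eq_zero_or_pos e with rfl | he
        · simp at hj
        · exact he
      have h1 := hz (j / e) (Nat.div_lt_of_lt_mul (by rwa [mul_comm])) (j % e) (Nat.mod_lt j he)
      have h2 := coord_coeff_monomial (c := c) (b := j / e) (Nat.mod_lt j he) 0
      rw [Nat.zero_div, Nat.zero_mod, pow_zero, monomial_zero_left] at h2
      rwa [h2, mul_comm, Nat.div_add_mod] at h1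
  · intro i _ τ hτi hfr hfa ih
    have h1 : τ.reg r_zero = ν 0 := by
      rw [hfr r_zero (by decide)]
      simpa using hσ.reg_zero
    have h2 : τ.reg r_one = ν 1 := by
      rw [hfr r_one (by decide)]
      simpa using hσ.reg_one
    have h3 : τ.arr a_v = σ.arr a_v := hfa a_v (by decide)
    rw [Nat.forall_lt_succ_right, ← ih]
    by_cases hi : i = 0
    · simp [hτi, hi, h2, h3]
    · simp [hτi, hi, h1, h3]

theorem found_testCoeffs {c : ℕ → F} {m e : ℕ} (hm : 0 < m) (he : 0 < e) {σ : State}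
    (hσ : Ctx ν m e σ) (hc : HasCoeffs ν c e σ) (hcard : σ.reg r_card2 = q ^ e - 2) :
    ((testCoeffs.eval σ).reg r_found = 1 ∧ IsPrimitive c e) ∨
      ((testCoeffs.eval σ).reg r_found = 0 ∧ ¬ IsPrimitive c e) := by
  classical
  have hqcard : Nat.card F = q := by rw [Nat.card_congr ν, Nat.card_fin]
  set P1 : Cmd := .seq (.set r_l (.lit 0)) initUnit with hP1
  set σ1 := P1.eval σ with hσ1
  have hs1 : Stores ν m (C (1 : AdjoinRoot (recPoly c e))) σ1 := by
    have h1 := stores_initUnit c (hσ.eval (.set r_l (.lit 0)) (by decide))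
    simpa [hσ1, hP1] using h1
  set P2 : Cmd := .ite (neqE (.get a_c (.lit 0)) (.var r_zero)) (.set r_found (.lit 1))
    (.set r_found (.lit 0)) with hP2
  set σ2 := P2.eval σ1 with hσ2
  have hctx2 : Ctx ν m e σ2 := (hσ.eval P1 (by decide)).eval P2 (by decide)
  have hc2 : HasCoeffs ν c e σ2 := fun u hu => by
    rw [hσ2, Cmd.eval_arr P2 (by decide), hσ1, Cmd.eval_arr P1 (by decide)]
    exact hc u hu
  have hs2 : Stores ν m (C (1 : AdjoinRoot (recPoly c e))) σ2 := fun b hb u hu => by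
    rw [hσ2, Cmd.eval_arr P2 (by decide)]
    exact hs1 b hb u hu
  have hf2 : (σ2.reg r_found = 1 ∧ c 0 ≠ 0) ∨ (σ2.reg r_found = 0 ∧ ¬ c 0 ≠ 0) := by
    have h1 : σ1.arr a_c 0 = ν (c 0) := by
      rw [hσ1, Cmd.eval_arr P1 (by decide)]
      exact hc 0 he
    have h2 : σ1.reg r_zero = ν 0 := (Cmd.eval_reg P1 (by decide) σ).trans hσ.reg_zero
    have h3 : (ν (c 0) : ℕ) = ν 0 ↔ c 0 = 0 := by rw [Fin.val_inj, ν.injective.eq_iff]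
    have h4 : (Expr.get a_c (.lit 0)).eval σ1 = (Expr.var r_zero).eval σ1 ↔ c 0 = 0 := by
      simp only [Expr.eval, h1, h2, h3]
    rw [hσ2, hP2, eval_ite_neqE, if_congr h4 rfl rfl]
    by_cases h : c 0 = 0 <;> simp [h]
  have h := Cmd.eval_rep_induction (x := r_n) (n := r_card2) (σ := σ2)
    (I := fun n τ => Stores ν m (C (AdjoinRoot.root (recPoly c e) ^ n)) τ ∧
      ((τ.reg r_found = 1 ∧ c 0 ≠ 0 ∧
        ∀ i, 1 ≤ i → i < n + 1 → AdjoinRoot.root (recPoly c e) ^ i ≠ 1) ∨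
      (τ.reg r_found = 0 ∧ ¬ (c 0 ≠ 0 ∧
        ∀ i, 1 ≤ i → i < n + 1 → AdjoinRoot.root (recPoly c e) ^ i ≠ 1))))
    (P := testPower) ?_ ?_
  · have h1 : σ2.reg r_card2 = q ^ e - 2 := by
      rw [hσ2, Cmd.eval_reg P2 (by decide), hσ1, Cmd.eval_reg P1 (by decide), hcard]
    have hQ : 1 < q ^ e := by
      refine Nat.one_lt_pow he.ne' ?_
      have : Finite F := .of_equiv _ ν.symm
      rw [← hqcard]
      exact Finite.one_lt_card
    rw [h1, show q ^ e - 2 + 1 = q ^ e - 1 by omega] at h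
    rw [IsPrimitive, hqcard]
    exact h.2
  · refine ⟨fun b hb u hu => by simpa using hs2 b hb u hu, ?_⟩
    have h1 : ∀ i : ℕ, 1 ≤ i → i < 0 + 1 → AdjoinRoot.root (recPoly c e) ^ i ≠ 1 := by
      intro i h1 h2
      omega
    simpa only [and_iff_left h1, State.setReg_reg, show r_found ≠ r_n by decide, if_false] using hf2
  · rintro i _ τ hτi hfr hfa ⟨hs, hfound⟩
    have hτ : Ctx ν m e τ := hctx2.of_frame hfr hfa (by decide)
    have hcτ : HasCoeffs ν c e τ := fun u hu => by
      rw [hfa a_c (by decide)]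
      exact hc2 u hu
    have hs' : Stores ν m (C (AdjoinRoot.root (recPoly c e) ^ (i + 1))) (yStep.eval τ) := by
      have h1 := stores_yStep hτ hcτ hs
      rwa [← C_mul, ← pow_succ'] at h1
    have hd := diff_compareOne hm (hτ.eval yStep (by decide)) hs'
    refine ⟨fun b hb u hu => ?_, ?_⟩
    · rw [State.setReg_arr, testPower, Cmd.eval_seq, Cmd.eval_arr _ (by decide)]
      exact hs' b hb u hu
    · have h1 : (compareOne.eval (yStep.eval τ)).reg r_found = τ.reg r_found := by
        rw [Cmd.eval_reg _ (by decide), Cmd.eval_reg _ (by decide)]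
      have h2 : (∀ j, 1 ≤ j → j < i + 1 + 1 → AdjoinRoot.root (recPoly c e) ^ j ≠ 1) ↔
          (∀ j, 1 ≤ j → j < i + 1 → AdjoinRoot.root (recPoly c e) ^ j ≠ 1) ∧
            AdjoinRoot.root (recPoly c e) ^ (i + 1) ≠ 1 := by
        refine ⟨fun h => ⟨fun j hj1 hj2 => h j hj1 (by omega), h _ (by omega) (by omega)⟩,
          fun h j hj1 hj2 => ?_⟩
        rcases (Nat.lt_succ_iff.1 hj2).eq_or_lt with rfl | h3
        · exact h.2
        · exact h.1 j hj1 h3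
      simp only [testPower, Cmd.eval_seq, Cmd.eval_ite, Cmd.eval_set, Cmd.eval_skip, Expr.eval,
        ne_eq, hd, h2, State.setReg_reg, show r_found ≠ r_n by decide, if_false]
      by_cases h3 : AdjoinRoot.root (recPoly c e) ^ (i + 1) = 1
      · simp [h3]
      · simpa [h3, h1] using hfound

theorem isPrimitive_congr {c c' : ℕ → F} {e : ℕ} (he : 0 < e) (h : ∀ u < e, c u = c' u) :
    IsPrimitive c e ↔ IsPrimitive c' e := by
  have h1 : recPoly c e = recPoly c' e := by
    rw [recPoly, recPoly]
    congr 1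
    exact Finset.sum_congr rfl fun u hu => by rw [h u (Finset.mem_range.1 hu)]
  rw [IsPrimitive, IsPrimitive, h1, h 0 he]

theorem digits_decodeDigits {e n Q : ℕ} {σ : State} (he : σ.reg r_e = e)
    (htab : ∀ n < Q, σ.arr a_div n = n / q ∧ σ.arr a_mod n = n % q)
    (hy : σ.reg r_y = n) (hn : n < Q) :
    ∀ u < e, (decodeDigits.eval σ).arr a_c u = n / q ^ u % q := by
  have h := Cmd.eval_rep_induction (x := r_u) (n := r_e) (σ := σ)
    (I := fun i τ => τ.reg r_y = n / q ^ i ∧ ∀ u < i, τ.arr a_c u = n / q ^ u % q)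
    (P := .seq (.put a_c (.var r_u) (.get a_mod (.var r_y))) (.set r_y (.get a_div (.var r_y))))
    ⟨by simpa using hy, fun a ha => absurd ha (by omega)⟩ ?_
  · rw [he] at h
    exact h.2
  · rintro i hi τ hτi hfr hfa ⟨hy, ih⟩
    have h1 := htab (n / q ^ i) ((Nat.div_le_self _ _).trans_lt hn)
    have h2 : τ.arr a_div = σ.arr a_div := hfa a_div (by decide)
    have h3 : τ.arr a_mod = σ.arr a_mod := hfa a_mod (by decide)
    refine ⟨?_, fun u hu => ?_⟩
    · simp [hy, h1, h2, Nat.div_div_eq_div_mul, pow_succ]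
    · simp only [Cmd.eval_seq, Cmd.eval_set, Cmd.eval_put, Expr.eval, State.setReg_arr,
        State.setArr_arr, if_true, hτi, hy, h3, h1.2, Function.update_apply]
      by_cases hui : u = i
      · simp [hui]
      · rw [if_neg hui, ih u (by omega)]

/-- The recurrence whose coefficients have the base `q` digits of `n` as their numbers. -/
def digitCoeffs (ν : F ≃ Fin q) (n : ℕ) (u : ℕ) : F :=
  ν.symm ⟨n / q ^ u % q, Nat.mod_lt _ (Fin.pos (ν 0))⟩

theorem exists_digitCoeffs (ν : F ≃ Fin q) (c : ℕ → F) (e : ℕ) :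
    ∃ n < q ^ e, ∀ u < e, digitCoeffs ν n u = c u := by
  let x : Fin e → Fin q := fun u => ν (c u)
  refine ⟨finFunctionFinEquiv x, (finFunctionFinEquiv x).2, fun u hu => ?_⟩
  rw [digitCoeffs, Equiv.symm_apply_eq]
  have h1 : finFunctionFinEquiv.symm (finFunctionFinEquiv x) ⟨u, hu⟩ = x ⟨u, hu⟩ := by
    rw [Equiv.symm_apply_apply]
  rw [← show x ⟨u, hu⟩ = ν (c u) from rfl, ← h1]
  ext
  simp [finFunctionFinEquiv]

theorem hasCoeffs_search {m e : ℕ} (hm : 0 < m) (he : 0 < e) {σ : State}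
    (hσ : Ctx ν m e σ) (hcard : σ.reg r_card = q ^ e) (hcard2 : σ.reg r_card2 = q ^ e - 2)
    (htab : ∀ n < q ^ e, σ.arr a_div n = n / q ∧ σ.arr a_mod n = n % q)
    (hfound : σ.reg r_found = 0) :
    ∃ c : ℕ → F, IsPrimitive c e ∧ HasCoeffs ν c e ((Cmd.rep r_cand r_card searchStep).eval σ) := by
  have hq0 : 0 < q := Fin.pos (ν 0)
  have : Finite F := .of_equiv _ ν.symm
  have h := Cmd.eval_rep_induction (x := r_cand) (n := r_card) (σ := σ)
    (I := fun n τ => (τ.reg r_found = 1 ∧ ∃ c : ℕ → F, IsPrimitive c e ∧ HasCoeffs ν c e τ) ∨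
      (τ.reg r_found = 0 ∧ ∀ n' < n, ¬ IsPrimitive (digitCoeffs ν n') e))
    (P := searchStep) (Or.inr ⟨by simpa using hfound, fun n hn => absurd hn (by omega)⟩) ?_
  · rcases h with ⟨-, h⟩ | ⟨-, h⟩
    · exact h
    · obtain ⟨c, hc⟩ := exists_isPrimitive (F := F) he
      obtain ⟨n, hn, hcn⟩ := exists_digitCoeffs ν c e
      rw [hcard] at h
      exact absurd ((isPrimitive_congr he hcn).2 hc) (h n hn)
  · intro n hn τ hτn hfr hfa ih
    rw [hcard] at hn
    rcases ih with ⟨hf, c, hcp, hcc⟩ | ⟨hf, hnot⟩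
    · refine Or.inl ⟨?_, c, hcp, fun u hu => ?_⟩
      · simp [searchStep, hf]
      · simpa [searchStep, hf] using hcc u hu
    · set P1 : Cmd := .seq (.set r_y (.var r_cand)) decodeDigits with hP1
      set τ1 := P1.eval τ with hτ1
      have heval : searchStep.eval τ = testCoeffs.eval τ1 := by
        simp [searchStep, hf, hτ1, hP1]
      have hctx1 : Ctx ν m e τ1 := (hσ.of_frame hfr hfa (by decide)).eval P1 (by decide)
      have hc1 : HasCoeffs ν (digitCoeffs ν n) e τ1 := by
        intro u hu
        have h1 := digits_decodeDigits (q := q) (σ := τ.setReg r_y n) (e := e) (n := n) (Q := q ^ e)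
          ?_ ?_ (by simp) hn u hu
        · rw [digitCoeffs, Equiv.apply_symm_apply]
          simpa [hτ1, hP1, hτn] using h1
        · rw [State.setReg_reg, if_neg (by decide), hfr r_e (by decide), hσ.reg_e]
        · rw [State.setReg_arr, hfa a_div (by decide), hfa a_mod (by decide)]
          exact htab
      have hcard1 : τ1.reg r_card2 = q ^ e - 2 := by
        rw [hτ1, Cmd.eval_reg P1 (by decide), hfr r_card2 (by decide), hcard2]
      rw [heval]
      rcases found_testCoeffs hm he hctx1 hc1 hcard1 with ⟨h1, h2⟩ | ⟨h1, h2⟩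
      · refine Or.inl ⟨by simpa using h1, _, h2, fun u hu => ?_⟩
        rw [State.setReg_arr, Cmd.eval_arr testCoeffs (by decide)]
        exact hc1 u hu
      · refine Or.inr ⟨by simpa using h1, fun n' hn' => ?_⟩
        rcases (Nat.lt_succ_iff.1 hn').eq_or_lt with rfl | h3
        · exact h2
        · exact hnot n' h3

end

/-! ### Writing the basis -/

/-- Writing the vector whose block with number `r_i` is the content of the array `a_v`, and whose
other blocks vanish. -/
def writeRow : Cmd :=
  .rep r_col r_k <| .rep r_j r_m <|
    .seq (.ite (neqE (.var r_col) (.var r_i)) (.put a_out (.var r_pos) (.var r_zero))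
      (.put a_out (.var r_pos) (.get a_v (.var r_j))))
    (.set r_pos (.add (.var r_pos) (.lit 1)))

/-- Computing the multiple of the unit vector with number `r_l` by the product of the factors
`X + Y ^ a` for `r_a0 ≤ a < r_a0 + r_t`. -/
def computeVector : Cmd :=
  .seq initUnit <|
  .seq (.set r_a (.var r_a0)) <|
  .rep r_fac r_t <| .seq mulFactor (.set r_a (.add (.var r_a) (.lit 1)))

/-- Writing one basis vector. -/
def emitVector : Cmd :=
  .seq computeVector <| .seq writeRow (.set r_count (.add (.var r_count) (.lit 1)))

/-- Writing all basis vectors. -/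
def emitBasis : Cmd :=
  .seq (.set r_a0 (.lit 0)) <| .seq (.set r_pos (.lit 0)) <| .seq (.set r_count (.lit 0)) <|
  .rep r_i r_k <|
    .seq (.rep r_l r_L emitVector) (.set r_a0 (.add (.var r_a0) (.var r_t)))

section

variable {F : Type*} [Field F] {q : ℕ} {ν : F ≃ Fin q}

theorem writeRow_spec {k m : ℕ} {σ : State} (hk : σ.reg r_k = k) (hm : σ.reg r_m = m) :
    (writeRow.eval σ).reg r_pos = σ.reg r_pos + k * m ∧
    (∀ x < σ.reg r_pos, (writeRow.eval σ).arr a_out x = σ.arr a_out x) ∧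
    ∀ x < k * m, (writeRow.eval σ).arr a_out (σ.reg r_pos + x) =
      if x / m = σ.reg r_i then σ.arr a_v (x % m) else σ.reg r_zero := by
  let J : ℕ → State → Prop := fun n τ => τ.reg r_pos = σ.reg r_pos + n ∧
    (∀ x < σ.reg r_pos, τ.arr a_out x = σ.arr a_out x) ∧
    ∀ x < n, τ.arr a_out (σ.reg r_pos + x) =
      if x / m = σ.reg r_i then σ.arr a_v (x % m) else σ.reg r_zero
  have h := Cmd.eval_rep_induction (x := r_col) (n := r_k) (σ := σ) (I := fun i => J (i * m))
    (P := .rep r_j r_m <|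
      .seq (.ite (neqE (.var r_col) (.var r_i)) (.put a_out (.var r_pos) (.var r_zero))
        (.put a_out (.var r_pos) (.get a_v (.var r_j))))
      (.set r_pos (.add (.var r_pos) (.lit 1))))
    ⟨by simp, by simp, fun x hx => absurd hx (by omega)⟩ ?_
  · rwa [hk] at h
  · intro i _ τ hτi hfr hfa ih
    have hτm : τ.reg r_m = m := (hfr r_m (by decide)).trans hm
    have h := Cmd.eval_rep_induction (x := r_j) (n := r_m) (σ := τ) (I := fun j => J (i * m + j))
      (P := .seq (.ite (neqE (.var r_col) (.var r_i)) (.put a_out (.var r_pos) (.var r_zero))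
          (.put a_out (.var r_pos) (.get a_v (.var r_j))))
        (.set r_pos (.add (.var r_pos) (.lit 1)))) ?_ ?_
    · rw [hτm] at h
      rw [add_mul, one_mul]
      exact ⟨by simpa using h.1, by simpa using h.2.1, by simpa using h.2.2⟩
    · exact ⟨by simpa using ih.1, by simpa using ih.2.1, by simpa using ih.2.2⟩
    · rintro j hj ρ hρj hfr' hfa' ⟨hpos, hold, hnew⟩
      rw [hτm] at hj
      have h1 : ρ.reg r_col = i := (hfr' r_col (by decide)).trans hτi
      have h2 : ρ.reg r_i = σ.reg r_i := (hfr' r_i (by decide)).trans (hfr r_i (by decide))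
      have h3 : ρ.reg r_zero = σ.reg r_zero :=
        (hfr' r_zero (by decide)).trans (hfr r_zero (by decide))
      have h4 : ρ.arr a_v = σ.arr a_v := (hfa' a_v (by decide)).trans (hfa a_v (by decide))
      have hdm := div_eq_of_lt_of_eq hj (rfl : i * m + j = i * m + j)
      have hval : ∀ v : ℕ, v = (if i = σ.reg r_i then σ.arr a_v j else σ.reg r_zero) →
          ∀ τ' : State, τ'.reg r_pos = ρ.reg r_pos + 1 →
          τ'.arr a_out = Function.update (ρ.arr a_out) (ρ.reg r_pos) v → J (i * m + (j + 1)) τ' := by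
        rintro v hv τ' hp ha
        refine ⟨by rw [hp, hpos]; ring, fun x hx => ?_, fun x hx => ?_⟩
        · rw [ha, Function.update_apply, if_neg (by omega), hold x hx]
        · rw [ha, Function.update_apply, hpos]
          by_cases hxe : x = i * m + j
          · subst hxe
            rw [if_pos rfl, hv, hdm.1, hdm.2]
          · rw [if_neg (by omega), hnew x (by omega)]
      by_cases hi : i = σ.reg r_i
      · refine hval (σ.arr a_v j) (by rw [if_pos hi]) _ ?_ ?_
        · simp [h1, h2, hi]
        · simp [h1, h2, hi, h4, hρj]
      · refine hval (σ.reg r_zero) (by rw [if_neg hi]) _ ?_ ?_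
        · simp [h1, h2, hi]
        · simp [h1, h2, hi, h3]

theorem stores_computeVector {c : ℕ → F} {m e t : ℕ} {σ : State} (hσ : Ctx ν m e σ)
    (hc : HasCoeffs ν c e σ) (ht : σ.reg r_t = t) (ha : σ.reg r_a0 + t ≤ σ.reg r_km) :
    Stores ν m (factorProd c e (σ.reg r_a0) t *
      monomial (σ.reg r_l / e) (AdjoinRoot.root (recPoly c e) ^ (σ.reg r_l % e)))
      (computeVector.eval σ) := by
  set P1 : Cmd := .seq initUnit (.set r_a (.var r_a0)) with hP1
  set σ1 := P1.eval σ with hσ1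
  have hs1 : Stores ν m (monomial (σ.reg r_l / e)
      (AdjoinRoot.root (recPoly c e) ^ (σ.reg r_l % e))) σ1 := by
    have h1 := stores_initUnit c hσ
    intro b hb u hu
    simpa [hσ1, hP1] using h1 b hb u hu
  have ha1 : σ1.reg r_a = σ.reg r_a0 := by
    simp [hσ1, hP1, Cmd.eval_reg initUnit (show r_a0 ∉ initUnit.writes by decide)]
  have h := Cmd.eval_rep_induction (x := r_fac) (n := r_t) (σ := σ1)
    (I := fun n τ => τ.reg r_a = σ.reg r_a0 + n ∧ Stores ν m (factorProd c e (σ.reg r_a0) n *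
      monomial (σ.reg r_l / e) (AdjoinRoot.root (recPoly c e) ^ (σ.reg r_l % e))) τ)
    (P := .seq mulFactor (.set r_a (.add (.var r_a) (.lit 1)))) ?_ ?_
  · rw [hσ1, Cmd.eval_reg P1 (by decide), ht] at h
    exact h.2
  · refine ⟨by simpa using ha1, fun b hb u hu => ?_⟩
    simpa [factorProd] using hs1 b hb u hu
  · rintro i hi τ hτi hfr hfa ⟨hτa, hs⟩
    have hτt : σ1.reg r_t = t := (Cmd.eval_reg P1 (by decide) σ).trans ht
    rw [hτt] at hi
    have hkm : τ.reg r_km = σ.reg r_km :=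
      (hfr r_km (by decide)).trans (Cmd.eval_reg P1 (by decide) σ)
    have hτ : Ctx ν m e τ := (hσ.eval P1 (by decide)).of_frame hfr hfa (by decide)
    have hcτ : HasCoeffs ν c e τ := fun u hu => by
      rw [hfa a_c (by decide), hσ1, Cmd.eval_arr P1 (by decide)]
      exact hc u hu
    have h1 := stores_mulFactor hτ hcτ (by omega) hs
    rw [hτa, ← mul_assoc, ← factorProd_succ] at h1
    refine ⟨?_, fun b hb u hu => ?_⟩
    · simp [Cmd.eval_reg mulFactor (show r_a ∉ mulFactor.writes by decide), hτa, add_assoc]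
    · simpa using h1 b hb u hu

/-- The entry with number `x` of the basis vector with number `g`: this is the vector with number
`g % L` of the space with number `g / L`. -/
noncomputable def basisEntry (ν : F ≃ Fin q) (c : ℕ → F) (e m t L g x : ℕ) : ℕ :=
  if x / m = g / L then ν (coord c e (x % m % e) ((factorProd c e (g / L * t) t *
    monomial (g % L / e) (AdjoinRoot.root (recPoly c e) ^ (g % L % e))).coeff (x % m / e)))
  else ν 0

theorem emitVector_spec {c : ℕ → F} {k m e t L i l : ℕ} (he : 0 < e) {σ : State}
    (hσ : Ctx ν m e σ) (hc : HasCoeffs ν c e σ) (hk : σ.reg r_k = k) (hkm : σ.reg r_km = k * m)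
    (ht : σ.reg r_t = t) (htm : t ≤ m) (hi : σ.reg r_i = i) (hik : i < k) (hl : σ.reg r_l = l)
    (hlL : l < L) (ha : σ.reg r_a0 = i * t) (hcount : σ.reg r_count = i * L + l)
    (hpos : σ.reg r_pos = (i * L + l) * (k * m))
    (hout : ∀ g < i * L + l, ∀ x < k * m,
      σ.arr a_out (g * (k * m) + x) = basisEntry ν c e m t L g x) :
    (emitVector.eval σ).reg r_count = i * L + (l + 1) ∧
    (emitVector.eval σ).reg r_pos = (i * L + (l + 1)) * (k * m) ∧
    ∀ g < i * L + (l + 1), ∀ x < k * m,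
      (emitVector.eval σ).arr a_out (g * (k * m) + x) = basisEntry ν c e m t L g x := by
  have hakm : σ.reg r_a0 + t ≤ σ.reg r_km := by
    rw [ha, hkm]
    calc i * t + t = (i + 1) * t := by ring
      _ ≤ k * m := Nat.mul_le_mul hik htm
  have hs := stores_computeVector hσ hc ht hakm
  set σ1 := computeVector.eval σ with hσ1
  have hreg : ∀ x, x ∉ computeVector.writes → σ1.reg x = σ.reg x :=
    fun x hx => Cmd.eval_reg _ hx σ
  obtain ⟨h1, h2, h3⟩ := writeRow_spec (σ := σ1) ((hreg r_k (by decide)).trans hk)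
    ((hreg r_m (by decide)).trans hσ.reg_m)
  rw [hreg r_pos (by decide), hpos] at h1 h2 h3
  rw [hreg r_i (by decide), hi, hreg r_zero (by decide), hσ.reg_zero] at h3
  have hdm := div_eq_of_lt_of_eq hlL (rfl : i * L + l = i * L + l)
  refine ⟨?_, ?_, fun g hg x hx => ?_⟩
  · simp only [emitVector, Cmd.eval_seq, Cmd.eval_set, Expr.eval, State.setReg_reg, if_true]
    rw [Cmd.eval_reg writeRow (by decide), ← hσ1, hreg r_count (by decide), hcount, add_assoc]
  · simp only [emitVector, Cmd.eval_seq, Cmd.eval_set, State.setReg_reg]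
    rw [if_neg (by decide), ← hσ1, h1]
    ring
  · simp only [emitVector, Cmd.eval_seq, Cmd.eval_set, State.setReg_arr, ← hσ1]
    rcases (show g = i * L + l ∨ g < i * L + l by omega) with rfl | hg
    · have hm : 0 < m := by
        rcases Nat.eq_zero_or_pos m with rfl | hm
        · simp at hx
        · exact hm
      rw [h3 x hx, basisEntry, hdm.1, hdm.2]
      refine if_congr Iff.rfl ?_ rfl
      have h4 := hs (x % m / e) ((Nat.div_le_self _ _).trans_lt (Nat.mod_lt _ hm)) (x % m % e)
        (Nat.mod_lt _ he)
      rw [mul_comm (x % m / e) e, Nat.div_add_mod, ha, hl] at h4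
      exact h4
    · have h5 : g * (k * m) + x < (i * L + l) * (k * m) := by
        calc g * (k * m) + x < (g + 1) * (k * m) := by
              rw [add_mul]
              omega
          _ ≤ _ := Nat.mul_le_mul_right _ hg
      rw [h2 _ h5, hσ1, Cmd.eval_arr computeVector (by decide)]
      exact hout g hg x hx

theorem emitBasis_spec {c : ℕ → F} {k m e t L : ℕ} (he : 0 < e) {σ : State} (hσ : Ctx ν m e σ)
    (hc : HasCoeffs ν c e σ) (hk : σ.reg r_k = k) (hkm : σ.reg r_km = k * m)
    (ht : σ.reg r_t = t) (htm : t ≤ m) (hL : σ.reg r_L = L) :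
    (emitBasis.eval σ).reg r_count = k * L ∧
    ∀ g < k * L, ∀ x < k * m,
      (emitBasis.eval σ).arr a_out (g * (k * m) + x) = basisEntry ν c e m t L g x := by
  let J : ℕ → State → Prop := fun n τ => τ.reg r_count = n ∧ τ.reg r_pos = n * (k * m) ∧
    ∀ g < n, ∀ x < k * m, τ.arr a_out (g * (k * m) + x) = basisEntry ν c e m t L g x
  set P0 : Cmd := .seq (.set r_a0 (.lit 0)) (.seq (.set r_pos (.lit 0)) (.set r_count (.lit 0)))
    with hP0
  set σ0 := P0.eval σ with hσ0
  have hreg0 : ∀ x, x ∉ P0.writes → σ0.reg x = σ.reg x := fun x hx => Cmd.eval_reg _ hx σ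
  have h := Cmd.eval_rep_induction (x := r_i) (n := r_k) (σ := σ0)
    (I := fun i τ => τ.reg r_a0 = i * t ∧ J (i * L) τ)
    (P := .seq (.rep r_l r_L emitVector) (.set r_a0 (.add (.var r_a0) (.var r_t)))) ?_ ?_
  · rw [hreg0 r_k (by decide), hk] at h
    exact ⟨h.2.1, h.2.2.2⟩
  · exact ⟨by simp [hσ0, hP0], by simp [hσ0, hP0], by simp [hσ0, hP0],
      fun g hg => absurd hg (by omega)⟩
  · rintro i hi τ hτi hfr hfa ⟨hτa, hτJ⟩
    rw [hreg0 r_k (by decide), hk] at hi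
    have hreg : ∀ x, x ∉ P0.writes →
        x ∉ (Cmd.rep r_i r_k (.seq (.rep r_l r_L emitVector)
          (.set r_a0 (.add (.var r_a0) (.var r_t))))).writes → τ.reg x = σ.reg x :=
      fun x hx hx' => (hfr x hx').trans (hreg0 x hx)
    have hτ : Ctx ν m e τ := (hσ.eval P0 (by decide)).of_frame hfr hfa (by decide)
    have hcτ : HasCoeffs ν c e τ := fun u hu => by
      rw [hfa a_c (by decide), hσ0, Cmd.eval_arr P0 (by decide)]
      exact hc u hu
    have h := Cmd.eval_rep_induction (x := r_l) (n := r_L) (σ := τ)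
      (I := fun l => J (i * L + l)) (P := emitVector) ?_ ?_
    · rw [hreg r_L (by decide) (by decide), hL, ← Nat.succ_mul] at h
      refine ⟨?_, by simpa using h.1, by simpa using h.2.1, by simpa using h.2.2⟩
      rw [State.setReg_reg, if_neg (by decide), Cmd.eval_seq, Cmd.eval_set, State.setReg_reg,
        if_pos rfl, Expr.eval, Expr.eval, Expr.eval, Cmd.eval_reg _ (by decide),
        Cmd.eval_reg _ (by decide), hτa, hreg r_t (by decide) (by decide), ht, Nat.succ_mul]
    · exact ⟨by simpa using hτJ.1, by simpa using hτJ.2.1, by simpa using hτJ.2.2⟩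
    · rintro l hl ρ hρl hfr' hfa' ⟨hρc, hρp, hρo⟩
      rw [hreg r_L (by decide) (by decide), hL] at hl
      have hreg' : ∀ x, x ∉ (Cmd.rep r_i r_k (.seq (.rep r_l r_L emitVector)
          (.set r_a0 (.add (.var r_a0) (.var r_t))))).writes → x ∉ P0.writes →
          x ∉ (Cmd.rep r_l r_L emitVector).writes → ρ.reg x = σ.reg x :=
        fun x hx hx' hx'' => (hfr' x hx'').trans (hreg x hx' hx)
      have hρcoef : HasCoeffs ν c e ρ := fun u hu => by
        rw [hfa' a_c (by decide)]
        exact hcτ u hu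
      obtain ⟨h1, h2, h3⟩ := emitVector_spec he (hτ.of_frame hfr' hfa' (by decide)) hρcoef
        ((hreg' r_k (by decide) (by decide) (by decide)).trans hk)
        ((hreg' r_km (by decide) (by decide) (by decide)).trans hkm)
        ((hreg' r_t (by decide) (by decide) (by decide)).trans ht) htm
        ((hfr' r_i (by decide)).trans hτi) hi hρl hl
        ((hfr' r_a0 (by decide)).trans hτa) hρc hρp hρo
      exact ⟨by simpa using h1, by simpa using h2, by simpa using h3⟩

end

/-! ### The parameters, and the whole program -/

/-- `d := n * s`, for the contents of three registers. -/
def mulInto (d n s : ℕ) : Cmd :=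
  .seq (.set d (.lit 0)) (.rep r_n n (.set d (.add (.var d) (.var s))))

/-- Division with remainder by repeated subtraction, if the quotient is less than `r_km1`. -/
def divide (n d : ℕ) : Cmd :=
  .seq (.set r_rem (.var n)) <| .seq (.set r_quo (.lit 0)) <|
  .rep r_n r_km1 <|
    .ite (.sub (.add (.var r_rem) (.lit 1)) (.var d))
      (.seq (.set r_rem (.sub (.var r_rem) (.var d))) (.set r_quo (.add (.var r_quo) (.lit 1))))
      .skip

/-- The products `k * m` and `k * r`. -/
def computeProducts : Cmd :=
  .seq (mulInto r_km r_k r_m) <| .seq (mulInto r_kr r_k r_rr) <|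
  .set r_km1 (.add (.var r_km) (.lit 1))

/-- The least `e` with `k * m < q ^ e`, together with `q ^ e`. -/
def computeDegree : Cmd :=
  .seq (.set r_card (.lit 1)) <| .seq (.set r_e (.lit 0)) <|
  .rep r_cand r_km1 <|
    .ite (.sub (.var r_card) (.var r_km)) .skip <|
      .seq (.set r_e (.add (.var r_e) (.lit 1))) <|
      .seq (mulInto r_y r_q r_card) (.set r_card (.var r_y))

/-- The number `t` of linear factors. -/
def computeFactors : Cmd :=
  .ite (.sub (.var r_kr) (.var r_S))
    (.ite (.sub (.var r_km) (.var r_D))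
      (.seq (divide r_D r_k) <| .seq (.set r_c0 (.var r_quo)) <|
        .seq (divide r_c0 r_e) (.set r_t (.var r_quo)))
      (.set r_t (.var r_m)))
    (.set r_t (.lit 0))

/-- The dimension `m - t * e` of the spaces, the length of the working arrays, and `q ^ e - 2`. -/
def computeSizes : Cmd :=
  .seq (mulInto r_te r_t r_e) <| .seq (.set r_L (.sub (.var r_m) (.var r_te))) <|
  .seq (mulInto r_len r_m r_e) (.set r_card2 (.sub (.var r_card) (.lit 2)))

/-- Finding a primitive recurrence. -/
def findCoeffs : Cmd :=
  .seq buildTables <| .seq (.set r_found (.lit 0)) (.rep r_cand r_card searchStep)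

/-- The whole algorithm. -/
def listBasis : Cmd :=
  .seq computeProducts <| .seq (.seq computeDegree computeFactors) <| .seq computeSizes <|
  .seq (.seq findCoeffs emitBasis) (.set r_q (.var r_count))

theorem mulInto_spec {d n s : ℕ} (hd : d ≠ r_n) (hs : s ≠ r_n) (hsd : s ≠ d) (hnd : n ≠ d)
    (σ : State) : ((mulInto d n s).eval σ).reg d = σ.reg n * σ.reg s := by
  have h := Cmd.eval_rep_induction (x := r_n) (n := n) (σ := σ.setReg d 0)
    (I := fun i τ => τ.reg d = i * σ.reg s) (P := .set d (.add (.var d) (.var s)))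
    (by simp [hd]) ?_
  · rwa [State.setReg_reg, if_neg hnd] at h
  · intro i _ τ _ hfr _ ih
    have h1 : τ.reg s = σ.reg s := by
      rw [hfr s (by simp [Cmd.writes, hs, hsd]), State.setReg_reg, if_neg hsd]
    simp [hd, ih, h1, add_mul]

theorem divide_spec {n d : ℕ} (hd : d ∉ [r_n, r_quo, r_rem]) (σ : State)
    (hlt : σ.reg n < σ.reg r_km1 * σ.reg d) :
    ((divide n d).eval σ).reg r_quo = σ.reg n / σ.reg d := by
  simp only [List.mem_cons, List.not_mem_nil, or_false, not_or] at hd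
  have h := Cmd.eval_rep_induction (x := r_n) (n := r_km1)
    (σ := (σ.setReg r_rem (σ.reg n)).setReg r_quo 0)
    (I := fun i τ => τ.reg r_rem + τ.reg r_quo * σ.reg d = σ.reg n ∧
      (τ.reg r_rem < σ.reg d ∨ τ.reg r_quo = i))
    (P := .ite (.sub (.add (.var r_rem) (.lit 1)) (.var d))
      (.seq (.set r_rem (.sub (.var r_rem) (.var d))) (.set r_quo (.add (.var r_quo) (.lit 1))))
      .skip) (by simp) ?_
  · simp only [State.setReg_reg, show r_km1 ≠ r_quo by decide, show r_km1 ≠ r_rem by decide,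
      if_false] at h
    have h1 : ((divide n d).eval σ).reg r_rem < σ.reg d := by
      refine h.2.resolve_right fun h2 => ?_
      have h3 := h.1
      rw [h2] at h3
      omega
    refine (div_eq_of_lt_of_eq h1 ?_).1.symm
    rw [← h.1, add_comm]
    rfl
  · rintro i _ τ _ hfr _ ⟨h1, h2⟩
    have hτd : τ.reg d = σ.reg d := by
      rw [hfr d (by simp [Cmd.writes, hd]), State.setReg_reg, if_neg hd.2.1, State.setReg_reg,
        if_neg hd.2.2]
    by_cases hc : τ.reg r_rem < σ.reg d
    · have h3 : τ.reg r_rem + 1 - σ.reg d = 0 := by omega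
      simp [hτd, h3, h1, hc]
    · have h3 : τ.reg r_rem + 1 - σ.reg d ≠ 0 := by omega
      have h4 : τ.reg r_quo = i := h2.resolve_left hc
      rw [h4] at h1
      simp only [State.setReg_reg, Cmd.eval_ite, Expr.eval, hτd, if_pos h3, Cmd.eval_seq,
        Cmd.eval_set, h4]
      simp only [reduceIte, Nat.reduceEqDiff]
      refine ⟨?_, Or.inr trivial⟩
      rw [add_mul]
      omega

theorem computeDegree_spec {q N : ℕ} (hq : 1 < q) (hN : 0 < N) {σ : State} (hσq : σ.reg r_q = q)
    (hkm : σ.reg r_km = N) (hkm1 : σ.reg r_km1 = N + 1) :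
    ∃ e, 0 < e ∧ N < q ^ e ∧ q ^ (e - 1) ≤ N ∧ (computeDegree.eval σ).reg r_e = e ∧
      (computeDegree.eval σ).reg r_card = q ^ e := by
  have h := Cmd.eval_rep_induction (x := r_cand) (n := r_km1)
    (σ := (σ.setReg r_card 1).setReg r_e 0)
    (I := fun i τ => τ.reg r_card = q ^ τ.reg r_e ∧ (τ.reg r_e = 0 ∨ q ^ (τ.reg r_e - 1) ≤ N) ∧
      (N < τ.reg r_card ∨ τ.reg r_e = i))
    (P := .ite (.sub (.var r_card) (.var r_km)) .skip <|
      .seq (.set r_e (.add (.var r_e) (.lit 1))) <|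
      .seq (mulInto r_y r_q r_card) (.set r_card (.var r_y))) (by simp) ?_
  · simp only [State.setReg_reg, show r_km1 ≠ r_e by decide, show r_km1 ≠ r_card by decide,
      if_false, hkm1] at h
    obtain ⟨h1, h2, h3⟩ := h
    set e := (computeDegree.eval σ).reg r_e with he
    have h1' : (computeDegree.eval σ).reg r_card = q ^ e := h1
    have h4 : N < q ^ e := by
      rcases h3 with h3 | h3
      · rw [← h1']
        exact h3
      · have h5 : e = N + 1 := h3
        rw [h5]
        exact (Nat.lt_succ_self N).trans (Nat.lt_pow_self hq)
    have h5 : e ≠ 0 := by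
      intro h5
      rw [h5, pow_zero] at h4
      omega
    exact ⟨e, Nat.pos_of_ne_zero h5, h4, h2.resolve_left h5, rfl, h1'⟩
  · rintro i _ τ _ hfr _ ⟨h1, h2, h3⟩
    have hτq : τ.reg r_q = q := by
      rw [hfr r_q (by decide)]
      simpa using hσq
    have hτkm : τ.reg r_km = N := by
      rw [hfr r_km (by decide)]
      simpa using hkm
    by_cases hc : N < τ.reg r_card
    · have h4 : τ.reg r_card - N ≠ 0 := by omega
      simpa [hτkm, h4, hc] using ⟨h1, h2⟩
    · have h4 : τ.reg r_card - N = 0 := by omega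
      have h5 : τ.reg r_e = i := h3.resolve_left hc
      set τ1 := τ.setReg r_e (i + 1) with hτ1
      have h6 : ((mulInto r_y r_q r_card).eval τ1).reg r_y = q ^ (i + 1) := by
        rw [mulInto_spec (by decide) (by decide) (by decide) (by decide)]
        simp [hτ1, hτq, h1, h5, pow_succ']
      have h7 : ((mulInto r_y r_q r_card).eval τ1).reg r_e = i + 1 := by
        rw [Cmd.eval_reg _ (by decide)]
        simp [hτ1]
      have h8 : q ^ i ≤ N := by
        rw [← h5, ← h1]
        omega
      simp [hτkm, h4, h5, ← hτ1, h6, h7, h8]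

theorem computeFactors_spec {k m r e D S : ℕ} (hk0 : 0 < k) (he0 : 0 < e) {σ : State}
    (hk : σ.reg r_k = k) (hm : σ.reg r_m = m) (hD : σ.reg r_D = D) (hS : σ.reg r_S = S)
    (hkm : σ.reg r_km = k * m) (hkr : σ.reg r_kr = k * r) (hkm1 : σ.reg r_km1 = k * m + 1)
    (he : σ.reg r_e = e) :
    (computeFactors.eval σ).reg r_t =
      if S < k * r then if D < k * m then D / k / e else m else 0 := by
  by_cases h1 : S < k * r
  · by_cases h2 : D < k * m
    · have h3 : k * r - S ≠ 0 := by omega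
      have h4 : k * m - D ≠ 0 := by omega
      set σ1 := (divide r_D r_k).eval σ with hσ1
      have h5 : σ1.reg r_quo = D / k := by
        rw [hσ1, divide_spec (by decide), hD, hk]
        rw [hD, hk, hkm1]
        exact (h2.trans (Nat.lt_succ_self _)).trans_le (Nat.le_mul_of_pos_right _ hk0)
      have hreg : ∀ x, x ∉ (divide r_D r_k).writes → σ1.reg x = σ.reg x :=
        fun x hx => Cmd.eval_reg _ hx σ
      set σ2 := σ1.setReg r_c0 (D / k) with hσ2
      have he2 : σ2.reg r_e = e := by
        rw [hσ2, State.setReg_reg, if_neg (by decide), hreg _ (by decide), he]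
      have hkm2 : σ2.reg r_km1 = k * m + 1 := by
        rw [hσ2, State.setReg_reg, if_neg (by decide), hreg _ (by decide), hkm1]
      have hc2 : σ2.reg r_c0 = D / k := by simp [hσ2]
      have h6 : ((divide r_c0 r_e).eval σ2).reg r_quo = D / k / e := by
        rw [divide_spec (by decide), hc2, he2]
        rw [hc2, he2, hkm2]
        exact ((Nat.div_le_self _ _).trans_lt (h2.trans (Nat.lt_succ_self _))).trans_le
          (Nat.le_mul_of_pos_right _ he0)
      simp [computeFactors, hkr, hS, hkm, hD, h3, h4, ← hσ1, h5, ← hσ2, h6, h1, h2]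
    · have h3 : k * r - S ≠ 0 := by omega
      have h4 : k * m - D = 0 := by omega
      simp [computeFactors, hkr, hS, hkm, hD, h3, h4, hm, h1, h2]
  · have h3 : k * r - S = 0 := by omega
    simp [computeFactors, hkr, hS, h3, h1]

theorem computeSizes_spec {m e t Q : ℕ} {σ : State} (hm : σ.reg r_m = m) (he : σ.reg r_e = e)
    (ht : σ.reg r_t = t) (hQ : σ.reg r_card = Q) :
    (computeSizes.eval σ).reg r_L = m - t * e ∧ (computeSizes.eval σ).reg r_len = m * e ∧
      (computeSizes.eval σ).reg r_card2 = Q - 2 := by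
  set σ1 := (mulInto r_te r_t r_e).eval σ with hσ1
  have hreg : ∀ x, x ∉ (mulInto r_te r_t r_e).writes → σ1.reg x = σ.reg x :=
    fun x hx => Cmd.eval_reg _ hx σ
  have h1 : σ1.reg r_te = t * e := by
    rw [hσ1, mulInto_spec (by decide) (by decide) (by decide) (by decide), ht, he]
  set σ2 := σ1.setReg r_L (m - t * e) with hσ2
  set σ3 := (mulInto r_len r_m r_e).eval σ2 with hσ3
  have hreg3 : ∀ x, x ∉ (mulInto r_len r_m r_e).writes → σ3.reg x = σ2.reg x :=
    fun x hx => Cmd.eval_reg _ hx σ2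
  have h3 : σ3.reg r_len = m * e := by
    rw [hσ3, mulInto_spec (by decide) (by decide) (by decide) (by decide)]
    simp [hσ2, hreg r_m (by decide), hreg r_e (by decide), hm, he]
  have h4 : computeSizes.eval σ = σ3.setReg r_card2 (Q - 2) := by
    simp only [computeSizes, Cmd.eval_seq, Cmd.eval_set, Expr.eval, ← hσ1, h1,
      hreg r_m (by decide), hm, ← hσ2, ← hσ3, hreg3 r_card (by decide)]
    simp [hσ2, hreg r_card (by decide), hQ]
  rw [h4]
  refine ⟨?_, by simpa using h3, by simp⟩
  simp [hreg3 r_L (by decide), hσ2]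

section

variable {F : Type*} [Field F] {q : ℕ} (ν : F ≃ Fin q)

theorem findCoeffs_spec {m e : ℕ} (hm0 : 0 < m) (he0 : 0 < e) {σ : State} (hq : σ.reg r_q = q)
    (hm : σ.reg r_m = m) (he : σ.reg r_e = e) (hlen : σ.reg r_len = m * e)
    (hcard : σ.reg r_card = q ^ e) (hcard2 : σ.reg r_card2 = q ^ e - 2)
    (hadd : σ.arr a_add = opTable ν (· + ·)) (hmul : σ.arr a_mul = opTable ν (· * ·)) :
    Ctx ν m e (findCoeffs.eval σ) ∧
      ∃ c : ℕ → F, IsPrimitive c e ∧ HasCoeffs ν c e (findCoeffs.eval σ) := by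
  obtain ⟨h1, h2⟩ := ctx_buildTables hq hm he hlen hadd hmul
  set σ1 := buildTables.eval σ with hσ1
  have hreg : ∀ x, x ∉ buildTables.writes → σ1.reg x = σ.reg x :=
    fun x hx => Cmd.eval_reg _ hx σ
  have h3 : Ctx ν m e (σ1.setReg r_found 0) := h1.eval (.set r_found (.lit 0)) (by decide)
  refine ⟨h3.eval (.rep r_cand r_card searchStep) (by decide), ?_⟩
  rw [hcard] at h2
  exact hasCoeffs_search (σ := σ1.setReg r_found 0) hm0 he0 h3
    (by simp [hreg r_card (by decide), hcard]) (by simp [hreg r_card2 (by decide), hcard2])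
    h2 (by simp)

end

theorem computeProducts_spec {k m r : ℕ} {σ : State} (hk : σ.reg r_k = k) (hm : σ.reg r_m = m)
    (hr : σ.reg r_rr = r) :
    (computeProducts.eval σ).reg r_km = k * m ∧ (computeProducts.eval σ).reg r_kr = k * r ∧
      (computeProducts.eval σ).reg r_km1 = k * m + 1 := by
  have h1 : (computeProducts.eval σ).reg r_km = k * m := by
    rw [computeProducts, Cmd.eval_seq, Cmd.eval_reg _ (by decide),
      mulInto_spec (by decide) (by decide) (by decide) (by decide), hk, hm]
  refine ⟨h1, ?_, ?_⟩
  · rw [computeProducts, Cmd.eval_seq, Cmd.eval_seq, Cmd.eval_reg _ (by decide),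
      mulInto_spec (by decide) (by decide) (by decide) (by decide),
      Cmd.eval_reg _ (by decide), Cmd.eval_reg _ (by decide), hk, hr]
  · rw [← h1, computeProducts]
    simp

theorem listBasis_spec {F : Type*} [Field F] {q : ℕ} (hq : 1 < q) (ν : F ≃ Fin q)
    {k m r D S : ℕ} (hk : 0 < k) (hm : 0 < m) {σ : State} (hσq : σ.reg r_q = q)
    (hσk : σ.reg r_k = k) (hσm : σ.reg r_m = m) (hσr : σ.reg r_rr = r) (hσD : σ.reg r_D = D)
    (hσS : σ.reg r_S = S) (hadd : σ.arr a_add = opTable ν (· + ·))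
    (hmul : σ.arr a_mul = opTable ν (· * ·)) :
    ∃ (c : ℕ → F) (e t L : ℕ),
      0 < e ∧ IsPrimitive c e ∧ k * m < q ^ e ∧ q ^ (e - 1) ≤ k * m ∧
      t = (if S < k * r then if D < k * m then D / k / e else m else 0) ∧ L = m - t * e ∧
      listBasis.Runs ((q + k + m) ^ 3) σ ∧
      (listBasis.eval σ).reg 0 = k * L ∧
      ∀ g < k * L, ∀ x < k * m,
        (listBasis.eval σ).arr 2 (g * (k * m) + x) = basisEntry ν c e m t L g x := by
  have hN0 : 0 < k * m := Nat.mul_pos hk hm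
  -- the products
  obtain ⟨hkm1, hkr1, hkm11⟩ := computeProducts_spec hσk hσm hσr
  have reg1 := fun x hx => Cmd.eval_reg computeProducts (y := x) hx σ
  have arr1 := fun x hx => Cmd.eval_arr computeProducts (a := x) hx σ
  obtain ⟨σ1, hσ1⟩ : ∃ τ, τ = computeProducts.eval σ := ⟨_, rfl⟩
  rw [← hσ1] at hkm1 hkr1 hkm11
  rw [← hσ1] at reg1 arr1
  have hq1 := (reg1 r_q (by decide)).trans hσq
  have hk1 := (reg1 r_k (by decide)).trans hσk
  have hm1 := (reg1 r_m (by decide)).trans hσm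
  have hD1 := (reg1 r_D (by decide)).trans hσD
  have hS1 := (reg1 r_S (by decide)).trans hσS
  -- the degree and the number of factors
  obtain ⟨e, he, hNe, heN, he2, hcard2⟩ := computeDegree_spec hq hN0 hq1 hkm1 hkm11
  have reg2 := fun x hx => Cmd.eval_reg computeDegree (y := x) hx σ1
  have arr2 := fun x hx => Cmd.eval_arr computeDegree (a := x) hx σ1
  have htm : (if S < k * r then if D < k * m then D / k / e else m else 0) ≤ m := by
    split_ifs with h1 h2
    · exact (Nat.div_le_self _ _).trans (Nat.div_lt_of_lt_mul h2).le
    · exact le_rfl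
    · exact Nat.zero_le _
  obtain ⟨t, ht⟩ : ∃ t, t = if S < k * r then if D < k * m then D / k / e else m else 0 :=
    ⟨_, rfl⟩
  obtain ⟨σ2, hσ2⟩ : ∃ τ, τ = computeDegree.eval σ1 := ⟨_, rfl⟩
  rw [← hσ2] at he2 hcard2
  rw [← hσ2] at reg2 arr2
  have ht3 := computeFactors_spec (r := r) (D := D) (S := S) hk he (σ := σ2)
    ((reg2 r_k (by decide)).trans hk1) ((reg2 r_m (by decide)).trans hm1)
    ((reg2 r_D (by decide)).trans hD1) ((reg2 r_S (by decide)).trans hS1)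
    ((reg2 r_km (by decide)).trans hkm1) ((reg2 r_kr (by decide)).trans hkr1)
    ((reg2 r_km1 (by decide)).trans hkm11) he2
  have reg3 := fun x hx => Cmd.eval_reg computeFactors (y := x) hx σ2
  have arr3 := fun x hx => Cmd.eval_arr computeFactors (a := x) hx σ2
  obtain ⟨σ3, hσ3⟩ : ∃ τ, τ = computeFactors.eval σ2 := ⟨_, rfl⟩
  rw [← hσ3, ← ht] at ht3
  rw [← hσ3] at reg3 arr3
  rw [← ht] at htm
  have hm3 := (reg3 r_m (by decide)).trans ((reg2 r_m (by decide)).trans hm1)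
  have he3 := (reg3 r_e (by decide)).trans he2
  -- the sizes
  obtain ⟨hL4, hlen4, hcard24⟩ := computeSizes_spec (σ := σ3) hm3 he3 ht3
    ((reg3 r_card (by decide)).trans hcard2)
  have reg4 := fun x hx => Cmd.eval_reg computeSizes (y := x) hx σ3
  have arr4 := fun x hx => Cmd.eval_arr computeSizes (a := x) hx σ3
  obtain ⟨σ4, hσ4⟩ : ∃ τ, τ = computeSizes.eval σ3 := ⟨_, rfl⟩
  rw [← hσ4] at hL4 hlen4 hcard24
  rw [← hσ4] at reg4 arr4
  have hq4 := (reg4 r_q (by decide)).trans ((reg3 r_q (by decide)).trans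
    ((reg2 r_q (by decide)).trans hq1))
  have hk4 := (reg4 r_k (by decide)).trans ((reg3 r_k (by decide)).trans
    ((reg2 r_k (by decide)).trans hk1))
  have hkm4 := (reg4 r_km (by decide)).trans ((reg3 r_km (by decide)).trans
    ((reg2 r_km (by decide)).trans hkm1))
  have hm4 := (reg4 r_m (by decide)).trans hm3
  have he4 := (reg4 r_e (by decide)).trans he3
  have hcard4 := (reg4 r_card (by decide)).trans ((reg3 r_card (by decide)).trans hcard2)
  have ht4 := (reg4 r_t (by decide)).trans ht3
  have hadd4 := (arr4 a_add (by decide)).trans ((arr3 a_add (by decide)).trans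
    ((arr2 a_add (by decide)).trans ((arr1 a_add (by decide)).trans hadd)))
  have hmul4 := (arr4 a_mul (by decide)).trans ((arr3 a_mul (by decide)).trans
    ((arr2 a_mul (by decide)).trans ((arr1 a_mul (by decide)).trans hmul)))
  -- the recurrence and the basis
  obtain ⟨hctx5, c, hcp, hcc⟩ := findCoeffs_spec ν hm he hq4 hm4 he4 hlen4 hcard4 hcard24
    hadd4 hmul4
  have reg5 := fun x hx => Cmd.eval_reg findCoeffs (y := x) hx σ4
  obtain ⟨σ5, hσ5⟩ : ∃ τ, τ = findCoeffs.eval σ4 := ⟨_, rfl⟩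
  rw [← hσ5] at hctx5 hcc
  rw [← hσ5] at reg5
  obtain ⟨hcount, hout⟩ := emitBasis_spec he hctx5 hcc ((reg5 r_k (by decide)).trans hk4)
    ((reg5 r_km (by decide)).trans hkm4) ((reg5 r_t (by decide)).trans ht4) htm
    ((reg5 r_L (by decide)).trans hL4)
  obtain ⟨σ6, hσ6⟩ : ∃ τ, τ = emitBasis.eval σ5 := ⟨_, rfl⟩
  rw [← hσ6] at hcount hout
  have hrun : listBasis.eval σ = (Cmd.set r_q (.var r_count)).eval σ6 := by
    rw [listBasis, Cmd.eval_seq, Cmd.eval_seq, Cmd.eval_seq, Cmd.eval_seq, Cmd.eval_seq,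
      Cmd.eval_seq, hσ6, hσ5, hσ4, hσ3, hσ2, hσ1]
  refine ⟨c, e, t, m - t * e, he, hcp, hNe, heN, ht, rfl, ?_, ?_, ?_⟩
  · -- the registers that bound the loops hold numbers of size at most `X ^ 3`
    obtain ⟨X, hX⟩ : ∃ X, X = q + k + m := ⟨_, rfl⟩
    rw [← hX]
    have hNX : k * m + 1 ≤ X ^ 2 := by
      have h1 : (k + 1) * (m + 1) ≤ X * X := Nat.mul_le_mul (by omega) (by omega)
      have h2 : (k + 1) * (m + 1) = k * m + k + m + 1 := by ring
      rw [pow_two]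
      omega
    have hX3 : X ^ 2 ≤ X ^ 3 := Nat.pow_le_pow_right (by omega) (by omega)
    have hXX : X ≤ X ^ 3 := Nat.le_self_pow (by omega) X
    have heN' : e ≤ k * m := by
      have : e - 1 < q ^ (e - 1) := Nat.lt_pow_self hq
      omega
    have hQX : q ^ e ≤ X ^ 3 := by
      have h1 : q ^ e = q * q ^ (e - 1) := by
        rw [← pow_succ', Nat.sub_add_cancel he]
      have h2 : q * q ^ (e - 1) ≤ X * X ^ 2 := Nat.mul_le_mul (by omega) (by omega)
      calc q ^ e ≤ X * X ^ 2 := h1.trans_le h2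
        _ = X ^ 3 := by ring
    have hlenX : m * e ≤ X ^ 3 := by
      have h2 : m * e ≤ X * X ^ 2 := Nat.mul_le_mul (by omega) (by omega)
      calc m * e ≤ X * X ^ 2 := h2
        _ = X ^ 3 := by ring
    have run1 : computeProducts.Runs (X ^ 3) σ := Cmd.runs_of_wf (B := [r_k]) (by decide) <| by
      simp only [List.mem_cons, List.not_mem_nil, or_false, forall_eq, hσk]
      omega
    have run2 : (Cmd.seq computeDegree computeFactors).Runs (X ^ 3) σ1 :=
      Cmd.runs_of_wf (B := [r_q, r_km1]) (by decide) <| by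
        simp only [List.mem_cons, List.not_mem_nil, or_false, forall_eq_or_imp, forall_eq, hq1,
          hkm11]
        omega
    have run3 : computeSizes.Runs (X ^ 3) σ3 :=
      Cmd.runs_of_wf (B := [r_t, r_m]) (by decide) <| by
        simp only [List.mem_cons, List.not_mem_nil, or_false, forall_eq_or_imp, forall_eq, ht3,
          hm3]
        omega
    have run4 : (Cmd.seq findCoeffs emitBasis).Runs (X ^ 3) σ4 :=
      Cmd.runs_of_wf (B := [r_q, r_k, r_m, r_km, r_e, r_card, r_t, r_L, r_len, r_card2])
        (by decide) <| by
        simp only [List.mem_cons, List.not_mem_nil, or_false, forall_eq_or_imp, forall_eq, hq4,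
          hk4, hm4, hkm4, he4, hcard4, ht4, hL4, hlen4, hcard24]
        omega
    have run5 : (Cmd.set r_q (.var r_count)).Runs (X ^ 3) σ6 :=
      Cmd.runs_of_wf (B := []) (by decide) (by simp)
    refine run1.seq hσ1 (run2.seq ?_ (run3.seq hσ4 (run4.seq ?_ run5)))
    · rw [hσ3, hσ2, Cmd.eval_seq]
    · rw [hσ6, hσ5, Cmd.eval_seq]
  · rw [hrun]
    simpa using hcount
  · rw [hrun]
    exact hout

/-- What the algorithm computes, and in which time. -/
theorem exists_exec_listBasis : ∃ C : ℕ, ∀ {F : Type*} [Field F] {q : ℕ} (ν : F ≃ Fin q)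
    (k m r D S : ℕ), 0 < k → 0 < m → ∃ (c : ℕ → F) (e t L : ℕ),
      0 < e ∧ IsPrimitive c e ∧ k * m < q ^ e ∧ q ^ (e - 1) ≤ k * m ∧
      t = (if S < k * r then if D < k * m then D / k / e else m else 0) ∧ L = m - t * e ∧
      ∃ (τ : State) (s : ℕ), Exec listBasis.code (inputState ν k m r D S) τ s ∧
        s ≤ C * (q + k + m) ^ C ∧ τ.reg 0 = k * L ∧
        ∀ g < k * L, ∀ x < k * m,
          τ.arr 2 (g * (k * m) + x) = basisEntry ν c e m t L g x := by
  obtain ⟨C, hC⟩ := Cmd.exists_time_le listBasis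
  use 4 * C
  intro F _ q ν k m r D S hk hm
  have hq : 1 < q := by
    have : Finite F := .of_equiv _ ν.symm
    rw [← Nat.card_fin q, ← Nat.card_congr ν]
    exact Finite.one_lt_card
  obtain ⟨c, e, t, L, he, hc, h1, h2, ht, hL, hrun, hreg, harr⟩ :=
    listBasis_spec hq ν (r := r) (D := D) (S := S) hk hm (σ := inputState ν k m r D S)
      rfl rfl rfl rfl rfl rfl rfl rfl
  obtain ⟨τ, s, hexec, hs, hr, ha⟩ := hrun _ (fun _ _ => rfl) rfl
  refine ⟨c, e, t, L, he, hc, h1, h2, ht, hL, τ, s, hexec, ?_, ?_, ?_⟩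
  · set X := q + k + m with hX
    have h2 : X ^ 3 + 1 ≤ X ^ 4 := by
      have h3 : X ^ 4 = X * X ^ 3 := by ring
      have h4 : 0 < X ^ 3 := Nat.pow_pos (by omega)
      have h5 : 2 * X ^ 3 ≤ X * X ^ 3 := Nat.mul_le_mul_right _ (by omega)
      omega
    calc s ≤ C * (X ^ 3 + 1) ^ C := hs.trans (hC _)
      _ ≤ C * (X ^ 4) ^ C := Nat.mul_le_mul_left _ (Nat.pow_le_pow_left h2 C)
      _ = C * X ^ (4 * C) := by rw [pow_mul]
      _ ≤ 4 * C * X ^ (4 * C) := Nat.mul_le_mul_right _ (by omega)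
  · exact (hr 0 (by decide)).trans hreg
  · rw [ha]
    exact harr

end Algorithm

/-! ### The size of the parameters -/

/-- The extension degree is at most `ε m / (2 r)`: this is where the lower bound for `q ^ m` is
needed. -/
theorem degree_le {ε : ℝ} {k m r q e : ℕ} (hε : 0 < ε) (hε1 : ε < 1) (hr : 0 < r) (hq : 2 ≤ q)
    (hrm : (r : ℝ) < ε * m / 4) (hk : 2 * r / ε < k)
    (hqm : (k : ℝ) ^ (24 * r / ε) ≤ (q : ℝ) ^ m) (he : q ^ (e - 1) ≤ k * m) :
    (e : ℝ) ≤ ε * m / (2 * r) := by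
  have hr' : (1 : ℝ) ≤ r := by exact_mod_cast hr
  obtain ⟨x, hx⟩ : ∃ x, x = ε * m / (2 * r) := ⟨_, rfl⟩
  have hx2 : 2 < x := by
    rw [hx, lt_div_iff₀ (by positivity)]
    linarith
  have hmx : (m : ℝ) = 2 * r / ε * x := by
    rw [hx]
    field_simp
  have hn2 : 2 < 2 * r / ε := by
    rw [lt_div_iff₀ hε]
    nlinarith
  have hk3 : (3 : ℝ) ≤ k := by
    have : (2 : ℝ) < k := hn2.trans hk
    exact_mod_cast this
  have hm0 : (0 : ℝ) < m := by
    rw [hmx]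
    positivity
  have hlq : 0.69 < Real.log q := by
    have h1 : Real.log 2 ≤ Real.log q := Real.log_le_log (by norm_num) (by exact_mod_cast hq)
    have h2 := Real.log_two_gt_d9
    norm_num at h2 ⊢
    linarith
  -- the hypothesis on `q ^ m`, after taking logarithms
  have h12 : 12 * Real.log k ≤ x * Real.log q := by
    have h1 := Real.log_le_log (by positivity) hqm
    rw [Real.log_rpow (by linarith), Real.log_pow, hmx] at h1
    have h2 : 24 * (r : ℝ) / ε * Real.log k = 2 * r / ε * (12 * Real.log k) := by ring
    rw [h2, mul_assoc] at h1
    exact le_of_mul_le_mul_left h1 (by linarith)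
  have hl3 : Real.log 3 ≤ Real.log k := Real.log_le_log (by norm_num) hk3
  -- the minimality of `e`, after taking logarithms
  have hme : ((e - 1 : ℕ) : ℝ) * Real.log q ≤ 2 * Real.log k + Real.log x := by
    have h1 : ((q : ℝ) ^ (e - 1)) ≤ k * m := by exact_mod_cast he
    have h2 := Real.log_le_log (by positivity) h1
    rw [Real.log_pow, Real.log_mul (by linarith) hm0.ne', hmx,
      Real.log_mul (by linarith) (by linarith)] at h2
    have h3 := Real.log_le_log (by linarith) hk.le
    linarith
  -- the tangent of the logarithm at `9`
  have hlx : Real.log x ≤ x / 9 + 2 * Real.log 3 - 1 := by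
    have h1 := Real.log_le_sub_one_of_pos (x := x / 9) (by linarith)
    rw [Real.log_div (by linarith) (by norm_num), show (9 : ℝ) = 3 ^ 2 by norm_num,
      Real.log_pow] at h1
    norm_num at h1 ⊢
    linarith
  rw [← hx]
  -- otherwise `x / 2 ≤ e - 1`, and `log x` exceeds the mean of `0.23 x` and `4 log 3`
  by_contra! hcon
  have he1 : x / 2 ≤ ((e - 1 : ℕ) : ℝ) := by
    have h1 : (e : ℝ) ≤ ((e - 1 : ℕ) : ℝ) + 1 := by
      exact_mod_cast (by omega : e ≤ e - 1 + 1)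
    linarith
  have h1 : x / 2 * Real.log q ≤ ((e - 1 : ℕ) : ℝ) * Real.log q :=
    mul_le_mul_of_nonneg_right he1 (by linarith)
  have h2 : x * 0.69 ≤ x * Real.log q := mul_le_mul_of_nonneg_left hlq.le (by linarith)
  norm_num at h2
  linarith

/-- The bound `r ((m - 1) / e) / (t + 1 - r)` for the number `N` of nontrivial intersections is at most
`2 r / ε`, because `(t + 1) e > ε m ≥ 2 r e`. -/
theorem card_le_of_mul_le {ε : ℝ} {k m r e N D : ℕ} (hε : 0 < ε) (hk : 0 < k) (hm : 0 < m)
    (he : 0 < e) (hD : D = ⌊ε * k * m⌋₊) (hem : (e : ℝ) ≤ ε * m / (2 * r)) (hr : 0 < r)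
    (hN : N * (D / k / e + 1 - r) ≤ r * ((m - 1) / e)) : (N : ℝ) ≤ 2 * r / ε := by
  have hr' : (1 : ℝ) ≤ r := by exact_mod_cast hr
  have he' : (0 : ℝ) < e := by exact_mod_cast he
  have hm' : (0 : ℝ) < m := by exact_mod_cast hm
  have hDk : D / k = ⌊ε * m⌋₊ := by
    rw [hD, ← Nat.floor_div_natCast]
    congr 1
    field_simp
  have h1 : ε * m < ((D / k / e + 1 : ℕ) : ℝ) * e := by
    refine (Nat.lt_floor_add_one _).trans_le ?_
    rw [← hDk]
    have h2 : D / k + 1 ≤ (D / k / e + 1) * e := by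
      rw [mul_comm]
      exact Nat.lt_mul_div_succ (D / k) he
    exact_mod_cast h2
  have h2 : (e : ℝ) * (2 * r) ≤ ε * m := (le_div_iff₀ (by positivity)).1 hem
  have h3 : r ≤ D / k / e + 1 := by
    have h4 : (e : ℝ) * (2 * r) < ((D / k / e + 1 : ℕ) : ℝ) * e := h2.trans_lt h1
    have h5 : e * (2 * r) < (D / k / e + 1) * e := by exact_mod_cast h4
    have h6 : 2 * r < D / k / e + 1 := by
      rw [mul_comm] at h5
      exact lt_of_mul_lt_mul_right h5 (Nat.zero_le e)
    omega
  obtain ⟨T, hT⟩ := Nat.exists_eq_add_of_le h3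
  rw [hT, Nat.add_sub_cancel_left] at hN
  rw [hT] at h1
  push_cast at h1
  have h7 : N * T * e ≤ r * m := by
    calc N * T * e ≤ r * ((m - 1) / e) * e := Nat.mul_le_mul_right _ hN
      _ = r * ((m - 1) / e * e) := by ring
      _ ≤ r * m := Nat.mul_le_mul_left _ ((Nat.div_mul_le_self _ _).trans (Nat.sub_le _ _))
  have h8 : (N : ℝ) * T * e ≤ r * m := by exact_mod_cast h7
  have h9 : ε * m / 2 ≤ T * e := by linarith
  rw [le_div_iff₀ hε]
  have h10 : (N : ℝ) * (ε * m / 2) ≤ r * m :=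
    (mul_le_mul_of_nonneg_left h9 (Nat.cast_nonneg N)).trans (by linarith)
  have h11 : (N * ε) * m ≤ (2 * r) * m := by linarith
  exact le_of_mul_le_mul_right h11 hm'

/-! ### The subspace design -/

section Design

variable {F : Type*} [Field F] {k m : ℕ}

/-- If at most `b` members meet a space of dimension at most `r` nontrivially, then the sum of the
dimensions of the intersections is at most `b r`. -/
theorem isSubspaceDesign_of_card_le {r : ℕ} {b s : ℝ} {H : Fin k → Submodule F (Fin m → F)}
    (h : ∀ V : Submodule F (Fin m → F), Module.finrank F V ≤ r → ∀ I : Finset (Fin k),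
      (∀ i ∈ I, V ⊓ H i ≠ ⊥) → (I.card : ℝ) ≤ b) (hs : b * r ≤ s) : IsSubspaceDesign r s H := by
  classical
  intro V hV
  have h1 := h V hV (Finset.univ.filter fun i => V ⊓ H i ≠ ⊥) (by simp)
  have h2 : ∑ i, (Module.finrank F ↥(V ⊓ H i) : ℝ) =
      ∑ i with V ⊓ H i ≠ ⊥, (Module.finrank F ↥(V ⊓ H i) : ℝ) := by
    refine (Finset.sum_subset (Finset.subset_univ _) fun i _ hi => ?_).symm
    have h3 : V ⊓ H i = ⊥ := by simpa using hi
    rw [h3, finrank_bot, Nat.cast_zero]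
  have h4 : ∀ i ∈ Finset.univ.filter fun i => V ⊓ H i ≠ ⊥,
      (Module.finrank F ↥(V ⊓ H i) : ℝ) ≤ r := fun i _ => by
    exact_mod_cast (Submodule.finrank_mono inf_le_left).trans hV
  rw [h2]
  refine (Finset.sum_le_card_nsmul _ _ _ h4).trans ?_
  rw [nsmul_eq_mul]
  exact (mul_le_mul_of_nonneg_right h1 (Nat.cast_nonneg r)).trans hs

/-- Periodic subspaces have dimension at most `k r`. -/
theorem isPeriodicEvasive_of_mul_le {r : ℕ} {s : ℝ} (h : (k * r : ℝ) ≤ s)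
    (W : Submodule F (Fin k × Fin m → F)) : IsPeriodicEvasive r s W := by
  rintro V ⟨M, -, rfl⟩
  refine le_trans ?_ h
  have h1 := LinearMap.finrank_range_le M.mulVecLin
  rw [Module.finrank_fintype_fun_eq_card, Fintype.card_prod, Fintype.card_fin,
    Fintype.card_fin] at h1
  exact_mod_cast (Submodule.finrank_mono inf_le_left).trans h1

theorem isPeriodicEvasive_bot {r : ℕ} {s : ℝ} (h : 0 ≤ s) :
    IsPeriodicEvasive r s (⊥ : Submodule F (Fin k × Fin m → F)) := fun V _ => by
  rwa [inf_bot_eq, finrank_bot, Nat.cast_zero]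

/-- The space `W = ∏ H i` and the spaces `H i` have the required intersections, for the parameters
that the algorithm computes. -/
theorem isSubspaceDesign_and_isPeriodicEvasive [Finite F] {ε : ℝ} {r q D S e t L : ℕ} {c : ℕ → F}
    {H : Fin k → Submodule F (Fin m → F)} (hε : 0 < ε) (hk : 0 < k) (hm : 0 < m) (hr : 0 < r)
    (hrm : (r : ℝ) < ε * m / 4) (hqm : (k : ℝ) ^ (24 * r / ε) ≤ (q : ℝ) ^ m)
    (hq : Nat.card F = q) (hD : D = ⌊ε * k * m⌋₊) (hS : S = ⌊2 * (r : ℝ) ^ 2 / ε⌋₊) (he : 0 < e)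
    (hc : IsPrimitive c e) (hNe : k * m < q ^ e) (heN : q ^ (e - 1) ≤ k * m)
    (ht : t = if S < k * r then if D < k * m then D / k / e else m else 0) (hL : L = m - t * e)
    (hH : H = fun i : Fin k => LinearMap.range (designMap c e m t L (i * t))) :
    IsSubspaceDesign r (2 * (r : ℝ) ^ 2 / ε) H ∧
      IsPeriodicEvasive r (2 * (r : ℝ) ^ 2 / ε) (blockProduct H) := by
  have hq2 : 2 ≤ q := hq ▸ Finite.one_lt_card
  have hLm : L + t * e ≤ m ∨ L = 0 := by omega
  by_cases h1 : S < k * r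
  · by_cases h2 : D < k * m
    · -- the general case
      rw [if_pos h1, if_pos h2] at ht
      have hrk : 2 * r / ε < k := by
        have h3 : 2 * (r : ℝ) ^ 2 / ε < (k * r : ℕ) := (Nat.floor_lt (by positivity)).1 (hS ▸ h1)
        push_cast at h3
        have h4 : 2 * (r : ℝ) ^ 2 / ε = 2 * r / ε * r := by ring
        rw [h4] at h3
        exact lt_of_mul_lt_mul_right h3 (Nat.cast_nonneg r)
      have hε1 : ε < 1 := by
        have h3 : ε * k * m < (k * m : ℕ) := (Nat.floor_lt (by positivity)).1 (hD ▸ h2)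
        push_cast at h3
        have h4 : ε * (k * m) < 1 * (k * m) := by linarith
        exact lt_of_mul_lt_mul_right h4 (by positivity)
      have hem := degree_le hε hε1 hr hq2 hrm hrk hqm heN
      have htm : t ≤ m := by
        rw [ht]
        exact (Nat.div_le_self _ _).trans (Nat.div_lt_of_lt_mul h2).le
      have hrm' : r ≤ m := by
        have h3 : (r : ℝ) ≤ m := by
          have : ε * m ≤ 1 * m := mul_le_mul_of_nonneg_right hε1.le (Nat.cast_nonneg m)
          linarith [(Nat.cast_nonneg m : (0 : ℝ) ≤ m)]
        exact_mod_cast h3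
      have hdes : IsSubspaceDesign r (2 * (r : ℝ) ^ 2 / ε) H := by
        refine isSubspaceDesign_of_card_le (b := 2 * r / ε) (fun V hV I hI => ?_)
          (le_of_eq (by ring))
        refine card_le_of_mul_le hε hk hm he hD hem hr ?_
        rw [← ht]
        have hkt : k * t ≤ k * m := Nat.mul_le_mul_left k htm
        have hkm : m ≤ k * m := Nat.le_mul_of_pos_left m hk
        refine card_inf_designMap_ne_bot_mul_le he hc hr hLm (by rw [hq]; omega) ?_ V hV I
          (by simpa only [hH] using hI)
        rw [hq]
        have := Nat.div_le_self (m - 1) e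
        omega
      exact ⟨hdes, hdes.isPeriodicEvasive hk hrm'⟩
    · -- all spaces are zero
      rw [if_pos h1, if_neg h2] at ht
      have hL0 : L = 0 := by
        rw [hL, ht, Nat.sub_eq_zero_iff_le]
        exact Nat.le_mul_of_pos_right m he
      have hHbot : ∀ i, H i = ⊥ := fun i => by
        subst hL0
        rw [hH]
        refine LinearMap.range_eq_bot.2 ?_
        exact Subsingleton.elim _ _
      have hWbot : blockProduct H = ⊥ := by
        refine (Submodule.eq_bot_iff _).2 fun w hw => funext fun p => ?_
        have h3 := (mem_blockProduct H w).1 hw p.1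
        rw [hHbot] at h3
        exact congrFun ((Submodule.mem_bot F).1 h3) p.2
      refine ⟨fun V _ => ?_, hWbot ▸ isPeriodicEvasive_bot (by positivity)⟩
      rw [Finset.sum_eq_zero fun i _ => by rw [hHbot, inf_bot_eq, finrank_bot, Nat.cast_zero]]
      positivity
  · -- the bound `s` is no restriction
    have h2 : (k * r : ℝ) ≤ 2 * (r : ℝ) ^ 2 / ε := by
      refine le_trans ?_ (Nat.floor_le (by positivity))
      rw [← hS]
      exact_mod_cast not_lt.1 h1
    refine ⟨isSubspaceDesign_of_card_le (b := k) (fun V _ I _ => ?_) h2,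
      isPeriodicEvasive_of_mul_le h2 _⟩
    exact_mod_cast (Finset.card_le_univ I).trans_eq (Fintype.card_fin k)

/-- The basis vector with number `g` belongs to the factor with number `g / L`. -/
theorem listsBasis_of_basisEntry {q e t L : ℕ} (ν : F ≃ Fin q) {c : ℕ → F}
    {H : Fin k → Submodule F (Fin m → F)} {τ : Ram.State} (hm : 0 < m) (hcount : τ.reg 0 = k * L)
    {b : Module.Basis (Fin k × Fin L) F (blockProduct H)}
    (hb : ∀ i l i' j, (b (i, l) : Fin k × Fin m → F) (i', j) =
      if i' = i then designMap c e m t L (i * t) (Pi.single l 1) j else 0)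
    (hout : ∀ g < k * L, ∀ x < k * m,
      τ.arr 2 (g * (k * m) + x) = basisEntry ν c e m t L g x) :
    ListsBasis ν (blockProduct H) τ := by
  refine ⟨b.reindex (finProdFinEquiv.trans (finCongr hcount.symm)), fun l i j => ?_⟩
  have hl : (l : ℕ) < k * L := hcount ▸ l.2
  have hx : (i * m + j : ℕ) < k * m := by
    calc (i * m + j : ℕ) < (i + 1) * m := by
          rw [add_mul, one_mul]
          exact Nat.add_lt_add_left j.2 _
      _ ≤ k * m := Nat.mul_le_mul_right m i.2
  have hx1 : (i * m + j : ℕ) / m = i := by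
    rw [mul_comm, Nat.mul_add_div hm, Nat.div_eq_of_lt j.2, add_zero]
  have hx2 : (i * m + j : ℕ) % m = j := by
    rw [mul_comm, Nat.mul_add_mod, Nat.mod_eq_of_lt j.2]
  have h1 : b.reindex (finProdFinEquiv.trans (finCongr hcount.symm)) l =
      b ((⟨l, hl⟩ : Fin (k * L)).divNat, (⟨l, hl⟩ : Fin (k * L)).modNat) := by
    rw [Module.Basis.reindex_apply]
    rfl
  rw [hout l hl _ hx, h1, hb, basisEntry, hx1, hx2, apply_ite ν, apply_ite Fin.val,
    designMap_single]
  exact if_congr (Fin.ext_iff (b := (⟨l, hl⟩ : Fin (k * L)).divNat)).symm rfl rfl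

end Design

end PeriodicEvasive

open PeriodicEvasive

theorem corollary2p6 :
    ∃ c : ℝ, 1 < c ∧ ∃ (P : Ram.Program) (C : ℕ),
      ∀ (ε : ℝ) (k m r q : ℕ) (F : Type*) [Field F] (ν : F ≃ Fin q),
        0 < ε → 0 < k → 0 < m → 0 < r → (r : ℝ) < ε * m / 4 →
        max ((k : ℝ) ^ (c * r / ε)) ((2 * r / ε : ℝ) ^ (2 * r / ε : ℝ)) ≤ (q : ℝ) ^ m →
        ∃ (H : Fin k → Submodule F (Fin m → F)) (W : Submodule F (Fin k × Fin m → F)),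
          PeriodicEvasive.IsSubspaceDesign r (2 * (r : ℝ) ^ 2 / ε) H ∧
          (∀ i, (Module.finrank F ((Fin m → F) ⧸ H i) : ℝ) ≤ ε * m) ∧
          W = PeriodicEvasive.blockProduct H ∧
          PeriodicEvasive.IsPeriodicEvasive r (2 * (r : ℝ) ^ 2 / ε) W ∧
          (Module.finrank F ((Fin k × Fin m → F) ⧸ W) : ℝ) ≤ ε * k * m ∧
          ∃ (τ : Ram.State) (t : ℕ),
            Ram.Exec P
              (PeriodicEvasive.inputState ν k m r ⌊ε * k * m⌋₊ ⌊2 * (r : ℝ) ^ 2 / ε⌋₊) τ t ∧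
            t ≤ C * (q + k + m) ^ C ∧
            PeriodicEvasive.ListsBasis ν W τ := by
  obtain ⟨C, hC⟩ := exists_exec_listBasis
  refine ⟨24, by norm_num, listBasis.code, C, ?_⟩
  intro ε k m r q F _ ν hε hk hm hr hrm hqm
  obtain ⟨D, hD⟩ : ∃ D, D = ⌊ε * k * m⌋₊ := ⟨_, rfl⟩
  obtain ⟨S, hS⟩ : ∃ S, S = ⌊2 * (r : ℝ) ^ 2 / ε⌋₊ := ⟨_, rfl⟩
  rw [← hD, ← hS]
  have : Finite F := .of_equiv _ ν.symm
  have hq : Nat.card F = q := by rw [Nat.card_congr ν, Nat.card_fin]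
  have hDε : (D : ℝ) ≤ ε * k * m := by
    rw [hD]
    exact Nat.floor_le (by positivity)
  obtain ⟨c, e, t, L, he, hc, hNe, heN, ht, hL, τ, s, hexec, hs, hcount, hout⟩ :=
    hC ν k m r D S hk hm
  obtain ⟨H, hH⟩ : ∃ H : Fin k → Submodule F (Fin m → F),
      H = fun i : Fin k => LinearMap.range (designMap c e m t L (i * t)) := ⟨_, rfl⟩
  have hLm : L + t * e ≤ m ∨ L = 0 := by omega
  have hcodim : ∀ i, Module.finrank F ((Fin m → F) ⧸ H i) = m - L := fun i => by
    rw [hH]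
    exact finrank_quotient_range_designMap he hLm _
  obtain ⟨b, hb⟩ : ∃ b : Module.Basis (Fin k × Fin L) F (blockProduct H), ∀ i l i' j,
      (b (i, l) : Fin k × Fin m → F) (i', j) =
        if i' = i then designMap c e m t L (i * t) (Pi.single l 1) j else 0 := by
    rw [hH]
    exact exists_basis_blockProduct _ fun i => designMap_injective he hLm _
  have hW : Module.finrank F (blockProduct H) = k * L := by
    rw [Module.finrank_eq_card_basis b, Fintype.card_prod, Fintype.card_fin, Fintype.card_fin]
  have hWcodim : Module.finrank F ((Fin k × Fin m → F) ⧸ blockProduct H) = k * (m - L) := by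
    have h1 := Submodule.finrank_quotient_add_finrank (blockProduct H)
    rw [hW, Module.finrank_fintype_fun_eq_card, Fintype.card_prod, Fintype.card_fin,
      Fintype.card_fin] at h1
    rw [Nat.mul_sub]
    omega
  -- both bounds for the codimension follow from this one
  have hLD : k * (m - L) ≤ D := by
    rw [hL, ht]
    split_ifs with h1 h2
    · refine (Nat.mul_le_mul_left k ?_).trans (Nat.mul_div_le D k)
      have := Nat.div_mul_le_self (D / k) e
      omega
    · have : m - (m - m * e) ≤ m := by omega
      exact (Nat.mul_le_mul_left k this).trans (by omega)
    · simp
  have hLε : ((k * (m - L) : ℕ) : ℝ) ≤ ε * k * m := (Nat.cast_le.2 hLD).trans hDε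
  have hk' : (0 : ℝ) < k := by exact_mod_cast hk
  obtain ⟨hdesign, hevasive⟩ := isSubspaceDesign_and_isPeriodicEvasive hε hk hm hr hrm
    ((le_max_left _ _).trans hqm) hq hD hS he hc hNe heN ht hL hH
  refine ⟨H, blockProduct H, hdesign, fun i => ?_, rfl, hevasive, ?_, τ, s, hexec, hs, ?_⟩
  · rw [hcodim]
    refine le_of_mul_le_mul_left ?_ hk'
    push_cast at hLε
    linarith
  · rwa [hWcodim]
  · exact listsBasis_of_basisEntry ν hm hcount hb hout
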